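/- Let $\mathcal H$ be a complex Hilbert space, let $H_s,W_s$ be bounded self-adjoint operators and $\rho_s(0)$ a bounded operator on $\mathcal H$, and let $\|\cdot\|$ be the operator norm. Let $B:\mathbb R^2\to\mathbb C$ satisfy $|B|\le\bar B$, and suppose that at all $(\tau_1,\tau_2)$ with $\tau_1,\tau_2\neq0$ the first- and second-order partial derivatives of $B$ exist, with $|\partial_{\tau_1}B|+|\partial_{\tau_2}B|\le\bar B'$ and all second-order ones bounded by $\bar B''$. *Exact solution.* For a finite real sequence put $\mathcal L_b(\tau_1,\dots,\tau_N)=\sum_{\mathfrak q}\prod_{(i,k)\in\mathfrak q,\ i<k}B(\tau_i,\tau_k)$, the sum running over all pairings $\mathfrak q$ of $\{1,\dots,N\}$ (so it is $1$ for $N=0$ and $0$ for odd $N$), and for $t\ge0$ $$\rho_s(t)=\sum_{m,m'\ge0}(-\mathrm i)^m\mathrm i^{m'}\int_{0<t_1<\dots<t_m<t}\int_{0<t_1'<\dots<t'_{m'}<t} e^{-\mathrm iH_s(t-t_m)}W_s\cdots W_se^{-\mathrm iH_st_1}\,\rho_s(0)\,e^{\mathrm iH_st_1'}W_s\cdots W_se^{\mathrm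 iH_s(t-t'_{m'})}\,\mathcal L_b(-t_m,\dots,-t_1,t_1',\dots,t'_{m'})\,\mathrm dt'\,\mathrm dt .$$ *Scheme.* Let $\Delta t>0$ and $P_0=e^{-\mathrm iH_s\Delta t}$, $P_1=-\mathrm i\Delta t\,e^{-\mathrm iH_s\Delta t/2}W_se^{-\mathrm iH_s\Delta t/2}$, $G_1=\frac{\mathrm i}{2}\Delta t\,W_se^{-\mathrm iH_s\Delta t/2}$, $G_2=\mathrm i\Delta t\,e^{-\mathrm iH_s\Delta t/2}W_s$. The intervals $k-$ and $k+$ ($k\ge1$) have midpoints $-(k-\frac12)\Delta t$ and $(k-\frac12)\Delta t$, and $\mathcal B_{r,r'}$ is $B$ at the midpoints of $r$ and $r'$. Starting from $\Lambda(\,;\,)=\rho_s(0)$, operators $\Lambda(j)$, with one index $j_\ell\in\{0,1,2\}$ for each interval $\ell$ present, are computed by alternating left and right extensions, the $k$-th time step adding the interval $k-$ and then the interval $k+$. Let $e_\ell$ be the unit multi-index at $\ell$. The left extension by a new interval $r$ first sets, for $j$ with values in $\{0,1\}$, $$L(1,j)=G_1\Lambda(j),\qquad L(0,j)=\sum_{\ell:\,j_\ell=0}\mathcal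 B_{r,\ell}\,G_1\Lambda(j+e_\ell),$$ and $L(\cdot,j)=0$ if some $j_\ell=2$; then, for all $j$ (the first argument being the index of $r$), $$\Lambda(0,j)=P_0\Lambda(j)+\sum_{\ell:\,j_\ell\neq2}\mathcal B_{r,\ell}P_1\Lambda(j+e_\ell)+\mathcal B_{r,r}G_2L(1,j)+\sum_{\ell:\,j_\ell=0}\mathcal B_{r,\ell}G_2L(0,j+e_\ell),$$ $$\Lambda(1,j)=P_1\Lambda(j)+G_2L(0,j)+\sum_{\ell:\,j_\ell=0}\mathcal B_{r,\ell}G_2L(1,j+e_\ell),\qquad \Lambda(2,j)=2G_2L(1,j).$$ The right extension is the same with multiplication on the right by $P_0^\dagger,P_1^\dagger,G_1^\dagger,G_2^\dagger$ and with $\mathcal B_{\ell,r}$ in place of $\mathcal B_{r,\ell}$. Let $\tilde\rho_{s,n}=\Lambda(0,\dots,0;0,\dots,0)$ after $n$ time steps. *Theorem.* All the integrals above converge absolutely, the double series for $\rho_s(n\Delta t)$ is (unconditionally) summable, and there is a constant $C$, depending only on $\|H_s\|$, $\|\rho_s(0)\|$, $\|W_s\|$, $\bar B$, $\bar B'$,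 $\bar B''$ and $T=n\Delta t$, such that $$\|\tilde\rho_{s,n}-\rho_s(n\Delta t)\|\le C\,\Delta t^2 .$$ -/

import Mathlib

namespace FRODS

open MeasureTheory

noncomputable section

/-! ### Bath correlation function and bath influence functional -/

/-- Partial derivative in the first time variable. -/
def pd₁ (B : ℝ → ℝ → ℂ) : ℝ → ℝ → ℂ := fun τ₁ τ₂ => deriv (fun s => B s τ₂) τ₁

/-- Partial derivative in the second time variable. -/
def pd₂ (B : ℝ → ℝ → ℂ) : ℝ → ℝ → ℂ := fun τ₁ τ₂ => deriv (fun s => B τ₁ s) τ₂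

/-- Both partial derivatives of `B` exist at `(τ₁, τ₂)`. -/
def HasPartials (B : ℝ → ℝ → ℂ) (τ₁ τ₂ : ℝ) : Prop :=
  DifferentiableAt ℝ (fun s => B s τ₂) τ₁ ∧ DifferentiableAt ℝ (fun s => B τ₁ s) τ₂

/-- The bath correlation function is bounded by `b`, and off the two coordinate axes its first
and second order partial derivatives exist and are bounded by `b'` and `b''`.
Time zero is left out of the differentiability requirements because
bath correlation functions typically depend on `|τ₁| - |τ₂|` and the signs of `τ₁`, `τ₂`. -/
structure BathBounds (B : ℝ → ℝ → ℂ) (b b' b'' : ℝ) : Prop where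
  bound : ∀ τ₁ τ₂, ‖B τ₁ τ₂‖ ≤ b
  partials : ∀ τ₁ τ₂, τ₁ ≠ 0 → τ₂ ≠ 0 → HasPartials B τ₁ τ₂
  bound_partials : ∀ τ₁ τ₂, τ₁ ≠ 0 → τ₂ ≠ 0 → ‖pd₁ B τ₁ τ₂‖ + ‖pd₂ B τ₁ τ₂‖ ≤ b'
  partials₁ : ∀ τ₁ τ₂, τ₁ ≠ 0 → τ₂ ≠ 0 → HasPartials (pd₁ B) τ₁ τ₂
  partials₂ : ∀ τ₁ τ₂, τ₁ ≠ 0 → τ₂ ≠ 0 → HasPartials (pd₂ B) τ₁ τ₂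
  bound₁₁ : ∀ τ₁ τ₂, τ₁ ≠ 0 → τ₂ ≠ 0 → ‖pd₁ (pd₁ B) τ₁ τ₂‖ ≤ b''
  bound₂₁ : ∀ τ₁ τ₂, τ₁ ≠ 0 → τ₂ ≠ 0 → ‖pd₂ (pd₁ B) τ₁ τ₂‖ ≤ b''
  bound₁₂ : ∀ τ₁ τ₂, τ₁ ≠ 0 → τ₂ ≠ 0 → ‖pd₁ (pd₂ B) τ₁ τ₂‖ ≤ b''
  bound₂₂ : ∀ τ₁ τ₂, τ₁ ≠ 0 → τ₂ ≠ 0 → ‖pd₂ (pd₂ B) τ₁ τ₂‖ ≤ b''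

/-- The pairings of `N` points, as the involutions without fixed points. -/
def pairings (N : ℕ) : Finset (Equiv.Perm (Fin N)) :=
  Finset.univ.filter fun σ => ∀ i, σ (σ i) = i ∧ σ i ≠ i

/-- The bath influence functional of a sequence of time points: the sum over all pairings of the
product of `B (τ, τ')` over all pairs, `τ` being the earlier entry of the sequence.
It is `1` for the empty sequence and `0` for a sequence of odd length. -/
def influence (B : ℝ → ℝ → ℂ) {N : ℕ} (τ : Fin N → ℝ) : ℂ :=
  ∑ σ ∈ pairings N, ∏ i ∈ Finset.univ.filter (fun i => i < σ i), B (τ i) (τ (σ i))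

variable {E : Type*} [NormedAddCommGroup E] [InnerProductSpace ℂ E] [CompleteSpace E]

/-- The propagator `exp (-i t H)`. -/
def prop (H : E →L[ℂ] E) (t : ℝ) : E →L[ℂ] E :=
  NormedSpace.exp ((-Complex.I * (t : ℂ)) • H)

/-! ### The exact reduced density matrix -/

/-- For `ts = [t₁, …, t_m]`:
`exp (-i H (t - t_m)) W exp (-i H (t_m - t_{m-1})) W ⋯ W exp (-i H (t₁ - a))`. -/
def leftChain (H W : E →L[ℂ] E) (t : ℝ) : ℝ → List ℝ → (E →L[ℂ] E)
  | a, [] => prop H (t - a)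
  | a, s :: ts => leftChain H W t s ts * W * prop H (s - a)

/-- For `ts = [t₁, …, t_m]`:
`exp (i H (t₁ - a)) W exp (i H (t₂ - t₁)) W ⋯ W exp (i H (t - t_m))`. -/
def rightChain (H W : E →L[ℂ] E) (t : ℝ) : ℝ → List ℝ → (E →L[ℂ] E)
  | a, [] => prop H (-(t - a))
  | a, s :: ts => prop H (-(s - a)) * W * rightChain H W t s ts

/-- The time-ordered simplex `0 < t₁ < ⋯ < t_m < t`. -/
def simplex (m : ℕ) (t : ℝ) : Set (Fin m → ℝ) :=
  {s | StrictMono s ∧ ∀ i, s i ∈ Set.Ioo 0 t}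

/-- The integrand of the `(m, m')` term of the Dyson series; `p.1 = (t₁, …, t_m)` and
`p.2 = (t₁', …, t'_{m'})`, and the influence functional is taken at the sequence
`(-t_m, …, -t₁, t₁', …, t'_{m'})`. -/
def dysonIntegrand (H W ρ₀ : E →L[ℂ] E) (B : ℝ → ℝ → ℂ) (t : ℝ) (m m' : ℕ)
    (p : (Fin m → ℝ) × (Fin m' → ℝ)) : E →L[ℂ] E :=
  influence B (Fin.append (fun i : Fin m => -p.1 i.rev) p.2) •
    (leftChain H W t 0 (List.ofFn p.1) * ρ₀ * rightChain H W t 0 (List.ofFn p.2))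

/-- The `(m, m')` term of the Dyson series. -/
def dysonTerm (H W ρ₀ : E →L[ℂ] E) (B : ℝ → ℝ → ℂ) (t : ℝ) (q : ℕ × ℕ) : E →L[ℂ] E :=
  ((-Complex.I) ^ q.1 * Complex.I ^ q.2) •
    ∫ p in simplex q.1 t ×ˢ simplex q.2 t, dysonIntegrand H W ρ₀ B t q.1 q.2 p

/-- The reduced density matrix `ρ_s(t)`, the sum of the Dyson series. -/
def rhoExact (H W ρ₀ : E →L[ℂ] E) (B : ℝ → ℝ → ℂ) (t : ℝ) : E →L[ℂ] E :=
  ∑' q : ℕ × ℕ, dysonTerm H W ρ₀ B t q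

/-! ### The second-order iterative scheme -/

/-- The one-interval operator without coupling; `h` is the time step. -/
def P0 (H : E →L[ℂ] E) (h : ℝ) : E →L[ℂ] E := prop H h

/-- The one-interval operator with one coupling operator. -/
def P1 (H W : E →L[ℂ] E) (h : ℝ) : E →L[ℂ] E :=
  (-Complex.I * (h : ℂ)) • (prop H (h / 2) * W * prop H (h / 2))

/-- First-stage factor of the one-interval operator with two coupling operators. -/
def G1 (H W : E →L[ℂ] E) (h : ℝ) : E →L[ℂ] E :=
  (Complex.I / 2 * (h : ℂ)) • (W * prop H (h / 2))

/-- Second-stage factor: `G2 * G1 = -(h² / 2) exp (-i h H / 2) W² exp (-i h H / 2)`. -/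
def G2 (H W : E →L[ℂ] E) (h : ℝ) : E →L[ℂ] E :=
  (Complex.I * (h : ℂ)) • (prop H (h / 2) * W)

/-- The intervals of a diagram with `a` intervals on the left and `c` on the right:
`inl i` is the interval `(i+1)-` and `inr i` is the interval `(i+1)+`. -/
abbrev Interval (a c : ℕ) := Fin a ⊕ Fin c

/-- The numbers of circles on the intervals. -/
abbrev Marks (a c : ℕ) := Interval a c → Fin 3

/-- The midpoint of the interval `(i+1)-`. -/
def midL (h : ℝ) (i : ℕ) : ℝ := -((i : ℝ) + 1 / 2) * h

/-- The midpoint of the interval `(i+1)+`. -/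
def midR (h : ℝ) (i : ℕ) : ℝ := ((i : ℝ) + 1 / 2) * h

/-- The midpoint of an interval. -/
def mid (h : ℝ) {a c : ℕ} : Interval a c → ℝ
  | .inl i => midL h i
  | .inr i => midR h i

section Extensions

variable (H W : E →L[ℂ] E) (B : ℝ → ℝ → ℂ) (h : ℝ) {a c : ℕ}

/-- First stage of the left extension: the half-extended diagram `L(x, j)`, where `x` belongs to
the new interval `(a+1)-`. It is zero when one of the indices is `2`. -/
def leftHalf (Λ : Marks a c → (E →L[ℂ] E)) (x : Fin 3) (j : Marks a c) : E →L[ℂ] E :=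
  if x = 2 ∨ ∃ l, j l = 2 then 0
  else if x = 1 then G1 H W h * Λ j
  else ∑ l with j l = 0, B (midL h a) (mid h l) • (G1 H W h * Λ (Function.update j l 1))

/-- The left extension, written for the number `x` of circles on the new interval `(a+1)-` and
the numbers `j` of circles on the old intervals. -/
def leftStep (Λ : Marks a c → (E →L[ℂ] E)) (x : Fin 3) (j : Marks a c) : E →L[ℂ] E :=
  match x with
  | 0 => P0 H h * Λ j
      + ∑ l with j l ≠ 2,
          B (midL h a) (mid h l) • (P1 H W h * Λ (Function.update j l (j l + 1)))
      + B (midL h a) (midL h a) • (G2 H W h * leftHalf H W B h Λ 1 j)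
      + ∑ l with j l = 0, B (midL h a) (mid h l) •
          (G2 H W h * leftHalf H W B h Λ 0 (Function.update j l 1))
  | 1 => P1 H W h * Λ j
      + G2 H W h * leftHalf H W B h Λ 0 j
      + ∑ l with j l = 0, B (midL h a) (mid h l) •
          (G2 H W h * leftHalf H W B h Λ 1 (Function.update j l 1))
  | 2 => (2 : ℂ) • (G2 H W h * leftHalf H W B h Λ 1 j)

/-- The left extension. -/
def leftExt (Λ : Marks a c → (E →L[ℂ] E)) (J : Marks (a + 1) c) : E →L[ℂ] E :=
  leftStep H W B h Λ (J (.inl (Fin.last a))) (fun l => J (l.map Fin.castSucc id))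

/-- First stage of the right extension: the half-extended diagram `R(j, x)`, where `x` belongs to
the new interval `(c+1)+`. It is zero when one of the indices is `2`. -/
def rightHalf (Λ : Marks a c → (E →L[ℂ] E)) (x : Fin 3) (j : Marks a c) : E →L[ℂ] E :=
  if x = 2 ∨ ∃ l, j l = 2 then 0
  else if x = 1 then Λ j * star (G1 H W h)
  else ∑ l with j l = 0, B (mid h l) (midR h c) •
    (Λ (Function.update j l 1) * star (G1 H W h))

/-- The right extension, written for the number `x` of circles on the new interval `(c+1)+` and
the numbers `j` of circles on the old intervals. -/
def rightStep (Λ : Marks a c → (E →L[ℂ] E)) (x : Fin 3) (j : Marks a c) : E →L[ℂ] E :=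
  match x with
  | 0 => Λ j * star (P0 H h)
      + ∑ l with j l ≠ 2,
          B (mid h l) (midR h c) • (Λ (Function.update j l (j l + 1)) * star (P1 H W h))
      + B (midR h c) (midR h c) • (rightHalf H W B h Λ 1 j * star (G2 H W h))
      + ∑ l with j l = 0, B (mid h l) (midR h c) •
          (rightHalf H W B h Λ 0 (Function.update j l 1) * star (G2 H W h))
  | 1 => Λ j * star (P1 H W h)
      + rightHalf H W B h Λ 0 j * star (G2 H W h)
      + ∑ l with j l = 0, B (mid h l) (midR h c) •
          (rightHalf H W B h Λ 1 (Function.update j l 1) * star (G2 H W h))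
  | 2 => (2 : ℂ) • (rightHalf H W B h Λ 1 j * star (G2 H W h))

/-- The right extension. -/
def rightExt (Λ : Marks a c → (E →L[ℂ] E)) (J : Marks a (c + 1)) : E →L[ℂ] E :=
  rightStep H W B h Λ (J (.inr (Fin.last c))) (fun l => J (l.map id Fin.castSucc))

end Extensions

/-- The bold diagrams `Λ(j_{n-}, …, j_{1-}; j_{1+}, …, j_{n+})` after `n` time steps, each being
a left extension followed by a right extension. -/
def diagrams (H W ρ₀ : E →L[ℂ] E) (B : ℝ → ℝ → ℂ) (h : ℝ) : (n : ℕ) → Marks n n → (E →L[ℂ] E)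
  | 0 => fun _ => ρ₀
  | n + 1 => rightExt H W B h (leftExt H W B h (diagrams H W ρ₀ B h n))

/-- The output of the second-order iterative scheme after `n` steps of size `h`. -/
def rhoTilde (H W ρ₀ : E →L[ℂ] E) (B : ℝ → ℝ → ℂ) (h : ℝ) (n : ℕ) : E →L[ℂ] E :=
  diagrams H W ρ₀ B h n (fun _ => 0)

end

end FRODS

namespace FRODS

open MeasureTheory

noncomputable section

/-! ### Recursions for the bath influence functional -/

/-! Both the scheme and the Dyson series are sums over configurations of coupling operators, and
they are compared for each pair `(m, m')` of numbers of operators on the two sides of the initial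
state.

In the interaction picture a chain is a product of operators `coupling H W s` between two
propagators (`leftChain_eq`, `rightChain_eq`). Unrolling the scheme gives a finite sum over
assignments of 0, 1 or 2 operators to each interval, all placed at midpoints (`exists_rhoTilde_eq`).
The index `j l` counts the points of `l` still open for pairing with later ones. The scalar weight
is the number of ordered choices of the open points times the influence functional of the other
points. This follows by induction from the expansion of a hafnian along its smallest or largest
point (`hafM_cons_of_le`, `hafM_cons_of_ge`, `wStep_eq`), as long as at most one interval is doubly
occupied. For the other assignments the growth bound `norm_wStep_le` suffices.

On the Dyson side every time is replaced by the midpoint of its cell. Ordered times with `k l`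
points in cell `l` fill the volume `∏ h ^ k l / (k l)!`, which is also the modulus of the prefactors
in the scheme. The midpoint sum is thus the same sum over configurations, with arbitrary occupation
numbers (`smul_setIntegral_dysonFun_gridMid`). Two errors of order `h ^ 2` remain.

The midpoint rule is estimated one coordinate at a time. A line meets the simplex in an interval;
whole cells contribute `O(h ^ 3)` each because the linear Taylor term is odd, and the cut cells at
the two ends contribute `O(h ^ 2)` (`C2Bound.norm_setIntegral_le`,
`norm_setIntegral_simplex_sub_le`). The singularity of `B` at time zero does no harm, since all
times and midpoints are positive before the sign is attached.

The weights differ only if some interval carries three points or two intervals carry two each. Such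
configurations have total weight of order `n h ^ 3 + n ^ 2 h ^ 4`, that is `h ^ 2` for fixed `n h`
(`sum_cellWeight_crowded_le`).

Finally, `N` points have at most `√N!` pairings, while the two simplices supply `1 / (m! m'!)`. The
errors are therefore dominated by `R ^ m / √m! * (R ^ m' / √m'!)` (`errorTerm_le`), which is
summable. Since the scheme is a finite sum, the same comparison shows that the Dyson series is
summable. -/

theorem mem_pairings {N : ℕ} {σ : Equiv.Perm (Fin N)} :
    σ ∈ pairings N ↔ ∀ i, σ (σ i) = i ∧ σ i ≠ i := by
  simp [pairings]

/-- The pairing of `N + 2` points in which `0` is paired with `k.succ` and the other points are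
paired by `f`. -/
def insertPair {N : ℕ} (k : Fin (N + 1)) (f : Fin N → Fin N) : Fin (N + 2) → Fin (N + 2) :=
  Fin.cons k.succ (k.insertNth 0 fun i => (k.succAbove (f i)).succ)

theorem insertPair_zero {N : ℕ} (k : Fin (N + 1)) (f : Fin N → Fin N) :
    insertPair k f 0 = k.succ := rfl

theorem insertPair_partner {N : ℕ} (k : Fin (N + 1)) (f : Fin N → Fin N) :
    insertPair k f k.succ = 0 := by
  simp [insertPair]

theorem insertPair_other {N : ℕ} (k : Fin (N + 1)) (f : Fin N → Fin N) (i : Fin N) :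
    insertPair k f (k.succAbove i).succ = (k.succAbove (f i)).succ := by
  simp [insertPair]

theorem forall_fin_pair {N : ℕ} (k : Fin (N + 1)) {p : Fin (N + 2) → Prop} :
    (∀ i, p i) ↔ p 0 ∧ p k.succ ∧ ∀ i, p (k.succAbove i).succ := by
  rw [Fin.forall_fin_succ, Fin.forall_iff_succAbove k]

theorem insertPair_involutive {N : ℕ} (k : Fin (N + 1)) {f : Fin N → Fin N}
    (hf : Function.Involutive f) : Function.Involutive (insertPair k f) := by
  refine (forall_fin_pair k).2 ⟨?_, ?_, fun i => ?_⟩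
  · rw [insertPair_zero, insertPair_partner]
  · rw [insertPair_partner, insertPair_zero]
  · rw [insertPair_other, insertPair_other, hf]

/-- `σ` preserves the complement of `{0, k.succ}` and restricts to a fixed-point-free involution of
it; `succAbove` numbers the remaining points. -/
theorem exists_insertPair {N : ℕ} (k : Fin (N + 1)) {σ : Equiv.Perm (Fin (N + 2))}
    (hσ : σ ∈ pairings (N + 2)) (h0 : σ 0 = k.succ) :
    ∃ σ' ∈ pairings N, ⇑σ = insertPair k σ' := by
  rw [mem_pairings] at hσ
  have hk : σ k.succ = 0 := by rw [← h0, (hσ 0).1]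
  have hex : ∀ i : Fin N, ∃ i', (k.succAbove i').succ = σ (k.succAbove i).succ := by
    intro i
    have h1 : σ (k.succAbove i).succ ≠ 0 := by
      rw [← hk]; intro h
      exact Fin.succAbove_ne k i (Fin.succ_injective _ (σ.injective h))
    obtain ⟨j, hj⟩ := Fin.exists_succ_eq.2 h1
    have h2 : j ≠ k := by
      rintro rfl
      exact Fin.succ_ne_zero _ (σ.injective (hj.symm.trans h0.symm))
    obtain ⟨i', hi'⟩ := Fin.exists_succAbove_eq h2
    exact ⟨i', by rw [hi', hj]⟩
  choose f hf using hex
  have hinv : Function.Involutive f := by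
    intro i
    apply Fin.succAbove_right_injective (p := k)
    apply Fin.succ_injective
    rw [hf, hf, (hσ _).1]
  refine ⟨hinv.toPerm, mem_pairings.2 fun i => ⟨hinv i, fun h => ?_⟩, ?_⟩
  · apply (hσ (k.succAbove i).succ).2
    rw [← hf]
    exact congrArg (fun x => (k.succAbove x).succ) h
  · funext i
    revert i
    refine (forall_fin_pair k).2 ⟨?_, ?_, fun i => ?_⟩
    · rw [insertPair_zero, h0]
    · rw [insertPair_partner, hk]
    · rw [insertPair_other, ← hf]; rfl

/-- The pair of `0` is counted once, at its smaller end; relabelling by `succAbove` is increasing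
and keeps the smaller end of every other pair. -/
theorem prod_insertPair (B : ℝ → ℝ → ℂ) {N : ℕ} (τ : Fin (N + 2) → ℝ) (k : Fin (N + 1))
    (f : Fin N → Fin N) :
    ∏ i ∈ Finset.univ.filter (fun i => i < insertPair k f i), B (τ i) (τ (insertPair k f i)) =
      B (τ 0) (τ k.succ) * ∏ i ∈ Finset.univ.filter (fun i => i < f i),
        B (τ (k.succAbove i).succ) (τ (k.succAbove (f i)).succ) := by
  rw [Finset.prod_filter, Finset.prod_filter, Fin.prod_univ_succ, Fin.prod_univ_succAbove _ k,
    insertPair_zero, insertPair_partner, if_pos (Fin.succ_pos _), if_neg (by simp), one_mul]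
  simp only [insertPair_other, Fin.succ_lt_succ_iff, Fin.succAbove_lt_succAbove_iff]

/-- Hafnian expansion along the first point: pairings are sorted by the partner of `0`, and
`insertPair` parametrises each class. The class `σ 0 = 0` is empty. -/
theorem influence_succ_succ (B : ℝ → ℝ → ℂ) {N : ℕ} (τ : Fin (N + 2) → ℝ) :
    influence B τ = ∑ k : Fin (N + 1),
      B (τ 0) (τ k.succ) * influence B (fun i => τ (k.succAbove i).succ) := by
  simp only [influence, Finset.mul_sum]
  rw [← Finset.sum_fiberwise (pairings (N + 2)) (fun σ => σ 0), Fin.sum_univ_succ]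
  rw [Finset.sum_eq_zero, zero_add]
  · refine Finset.sum_congr rfl fun k _ => Eq.symm ?_
    refine Finset.sum_bij
      (fun σ' hσ' => (insertPair_involutive k (fun i => (mem_pairings.1 hσ' i).1)).toPerm)
      ?_ ?_ ?_ ?_
    · intro σ' hσ'
      rw [Finset.mem_filter, mem_pairings]
      refine ⟨fun i => ⟨insertPair_involutive k (fun i => (mem_pairings.1 hσ' i).1) i, ?_⟩, rfl⟩
      revert i
      refine (forall_fin_pair k).2 ⟨?_, ?_, fun i => ?_⟩
      · exact Fin.succ_ne_zero _
      · rw [Function.Involutive.coe_toPerm, insertPair_partner]; exact (Fin.succ_ne_zero _).symm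
      · rw [Function.Involutive.coe_toPerm, insertPair_other]
        intro h
        exact (mem_pairings.1 hσ' i).2
          (Fin.succAbove_right_injective (Fin.succ_injective _ h))
    · intro σ₁ h₁ σ₂ h₂ h
      ext1 i
      have := congrFun (congrArg (fun σ : Equiv.Perm (Fin (N + 2)) => (σ : Fin (N + 2) → _)) h)
        (k.succAbove i).succ
      simp only [Function.Involutive.coe_toPerm] at this
      rw [insertPair_other, insertPair_other] at this
      exact Fin.succAbove_right_injective (Fin.succ_injective _ this)
    · intro σ hσ
      rw [Finset.mem_filter] at hσ
      obtain ⟨σ', hσ', h⟩ := exists_insertPair k hσ.1 hσ.2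
      exact ⟨σ', hσ', by ext1 i; exact (congrFun h i).symm⟩
    · intro σ' hσ'
      exact (prod_insertPair B τ k σ').symm
  · intro σ hσ
    rw [Finset.mem_filter] at hσ
    exact absurd hσ.2 (mem_pairings.1 hσ.1 0).2

theorem influence_zero (B : ℝ → ℝ → ℂ) (τ : Fin 0 → ℝ) : influence B τ = 1 := by
  have : pairings 0 = Finset.univ := by
    ext σ; simp only [mem_pairings, Finset.mem_univ, iff_true]; exact fun i => i.elim0
  simp [influence, this]

theorem influence_one (B : ℝ → ℝ → ℂ) (τ : Fin 1 → ℝ) : influence B τ = 0 := by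
  refine Finset.sum_eq_zero fun σ hσ => ?_
  exact absurd (Subsingleton.elim _ _) (mem_pairings.1 hσ 0).2

/-- Conjugating by the order reversal permutes the pairings and exchanges the ends of each pair. It
turns an expansion along the first point into one along the last. -/
theorem influence_rev (B : ℝ → ℝ → ℂ) {N : ℕ} (τ : Fin N → ℝ) :
    influence (fun x y => B y x) (fun i => τ i.rev) = influence B τ := by
  unfold influence
  refine Finset.sum_bij' (fun σ _ => Fin.revPerm * σ * Fin.revPerm)
    (fun σ _ => Fin.revPerm * σ * Fin.revPerm) ?_ ?_ ?_ ?_ ?_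
  · intro σ hσ
    rw [mem_pairings] at hσ ⊢
    intro i
    simp [hσ, Fin.rev_eq_iff]
  · intro σ hσ
    rw [mem_pairings] at hσ ⊢
    intro i
    simp [hσ, Fin.rev_eq_iff]
  · intro σ _; ext i; simp
  · intro σ _; ext i; simp
  · intro σ hσ
    rw [mem_pairings] at hσ
    -- Products run over smaller ends of pairs, and reversal makes the larger end `σ i` the smaller
    -- one.
    refine Finset.prod_bij' (fun i _ => (σ i).rev) (fun i _ => σ i.rev) ?_ ?_ ?_ ?_ ?_
    · intro i hi; simpa [hσ] using hi
    · intro i hi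
      simp only [Finset.mem_filter, Finset.mem_univ, true_and] at hi ⊢
      simpa [hσ, Fin.lt_rev_iff] using hi
    · intro i _; simp [hσ]
    · intro i _; simp [hσ]
    · intro i _; simp [hσ]

/-- For `B = 1` the influence functional counts the pairings. -/
theorem card_pairings_succ_succ (N : ℕ) :
    (pairings (N + 2)).card = (N + 1) * (pairings N).card := by
  have h := influence_succ_succ (fun _ _ => 1) (N := N) (fun _ => 0)
  simp [influence] at h
  exact_mod_cast h

/-- For even `N` the count is `(N - 1)!!`, and `(N - 1)!! ^ 2 ≤ (N - 1)!! * N!! = N!`. The square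
root gained here leaves the error series summable. -/
theorem card_pairings_sq_le (N : ℕ) : (pairings N).card ^ 2 ≤ N.factorial := by
  induction N using Nat.twoStepInduction with
  | zero => decide
  | one => decide
  | more N ih _ =>
    rw [card_pairings_succ_succ, Nat.factorial_succ, Nat.factorial_succ, mul_pow]
    calc (N + 1) ^ 2 * (pairings N).card ^ 2 ≤ (N + 1) ^ 2 * N.factorial := by gcongr
      _ = (N + 1) * ((N + 1) * N.factorial) := by ring
      _ ≤ (N + 1 + 1) * ((N + 1) * N.factorial) := by gcongr; omega

theorem card_pairings_le_sqrt (N : ℕ) : ((pairings N).card : ℝ) ≤ √(N.factorial) := by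
  apply Real.le_sqrt_of_sq_le
  exact_mod_cast card_pairings_sq_le N

/-! ### The influence functional on lists and multisets -/

/-- The influence functional of a list of time points. -/
def inflL (B : ℝ → ℝ → ℂ) (l : List ℝ) : ℂ := influence B l.get

theorem influence_cast (B : ℝ → ℝ → ℂ) {N M : ℕ} (h : N = M) (τ : Fin M → ℝ) :
    influence B (fun i => τ (Fin.cast h i)) = influence B τ := by
  subst h; rfl

theorem inflL_ofFn (B : ℝ → ℝ → ℂ) {N : ℕ} (τ : Fin N → ℝ) :
    inflL B (List.ofFn τ) = influence B τ := by
  rw [inflL, ← influence_cast B (List.length_ofFn (f := τ))]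
  congr 1
  funext i
  simp only [List.get_eq_getElem, List.getElem_ofFn]
  rfl

theorem eraseIdx_eq_ofFn {N : ℕ} (τ : Fin (N + 1) → ℝ) (k : Fin (N + 1)) :
    (List.ofFn τ).eraseIdx k = List.ofFn fun i => τ (k.succAbove i) := by
  apply List.ext_getElem
  · rw [List.length_eraseIdx_of_lt (by simpa using k.is_le)]; simp
  · intro i h1 h2
    rw [List.getElem_eraseIdx]
    simp only [List.length_ofFn] at h2
    split_ifs with h
    · simp only [List.getElem_ofFn]
      simp [Fin.succAbove, Fin.lt_def, h]
    · simp only [List.getElem_ofFn]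
      simp [Fin.succAbove, Fin.lt_def, h]

theorem inflL_nil (B : ℝ → ℝ → ℂ) : inflL B [] = 1 := influence_zero B _

theorem inflL_cons (B : ℝ → ℝ → ℂ) (x : ℝ) (l : List ℝ) :
    inflL B (x :: l) = ∑ i : Fin l.length, B x (l.get i) * inflL B (l.eraseIdx i) := by
  obtain ⟨N, τ, rfl⟩ : ∃ N, ∃ τ : Fin N → ℝ, l = List.ofFn τ := ⟨_, _, (List.ofFn_get l).symm⟩
  rw [← List.ofFn_cons, inflL_ofFn]
  rw [← Equiv.sum_comp (finCongr (List.length_ofFn (f := τ))).symm]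
  cases N with
  | zero => simpa using influence_one B _
  | succ N =>
    rw [influence_succ_succ]
    refine Finset.sum_congr rfl fun k _ => ?_
    have h : ((finCongr (List.length_ofFn (f := τ))).symm k : ℕ) = k := rfl
    rw [h, eraseIdx_eq_ofFn, inflL_ofFn, List.get_eq_getElem, List.getElem_ofFn]
    rfl

theorem inflL_reverse (B : ℝ → ℝ → ℂ) (l : List ℝ) :
    inflL (fun x y => B y x) l.reverse = inflL B l := by
  obtain ⟨N, τ, rfl⟩ : ∃ N, ∃ τ : Fin N → ℝ, l = List.ofFn τ := ⟨_, _, (List.ofFn_get l).symm⟩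
  have : (List.ofFn τ).reverse = List.ofFn fun i => τ i.rev := by
    apply List.ext_getElem
    · simp
    · intro i h1 h2
      simp [List.getElem_reverse, Fin.rev]
      congr 2; simp at h2; omega
  rw [this, inflL_ofFn, inflL_ofFn, influence_rev]

/-- The influence functional of a multiset of time points, arranged in increasing order. -/
def hafM (B : ℝ → ℝ → ℂ) (M : Multiset ℝ) : ℂ := inflL B (M.sort (· ≤ ·))

theorem sort_eq_of_sorted {l : List ℝ} {M : Multiset ℝ} (hl : l.Pairwise (· ≤ ·))
    (h : (l : Multiset ℝ) = M) : M.sort (· ≤ ·) = l := by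
  subst h
  exact (Multiset.coe_eq_coe.1 (Multiset.sort_eq _ _)).eq_of_pairwise'
    (Multiset.pairwise_sort _ _) hl

/-- Deleting a position and erasing one copy of its value give the same multiset, so sums over
positions become sums over multisets, with repeated times counted by multiplicity. -/
theorem sum_get_eraseIdx (l : List ℝ) (F : ℝ → List ℝ → ℂ) (G : ℝ → Multiset ℝ → ℂ)
    (hF : ∀ i : Fin l.length, F (l.get i) (l.eraseIdx i) = G (l.get i) (l.eraseIdx i)) :
    ∑ i : Fin l.length, F (l.get i) (l.eraseIdx i) =
      ((l : Multiset ℝ).map fun y => G y ((l : Multiset ℝ).erase y)).sum := by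
  rw [Multiset.map_coe, Multiset.sum_coe, Finset.sum_congr rfl fun i _ => hF i, ← List.sum_ofFn]
  congr 1
  apply List.ext_getElem
  · simp
  · intro i h1 h2
    simp only [List.getElem_ofFn, List.getElem_map, List.get_eq_getElem]
    congr 1
    rw [Multiset.coe_erase, Multiset.coe_eq_coe]
    have hi : i < l.length := by simpa using h1
    have h4 : l.Perm (l[i] :: l.eraseIdx i) := (List.getElem_cons_eraseIdx_perm hi).symm
    have h5 := h4.erase l[i]
    rw [List.erase_cons_head] at h5
    exact h5.symm

theorem hafM_zero (B : ℝ → ℝ → ℂ) : hafM B 0 = 1 := by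
  simp [hafM, inflL_nil]

/-- The new point heads the increasing arrangement, so the expansion along the first entry applies.
This is the pairing performed by a left extension. -/
theorem hafM_cons_of_le (B : ℝ → ℝ → ℂ) {r : ℝ} {M : Multiset ℝ} (hr : ∀ y ∈ M, r ≤ y) :
    hafM B (r ::ₘ M) = (M.map fun y => B r y * hafM B (M.erase y)).sum := by
  have h1 : (r ::ₘ M).sort (· ≤ ·) = r :: M.sort (· ≤ ·) := Multiset.sort_cons _ _ _ hr
  rw [hafM, h1, inflL_cons,
    sum_get_eraseIdx _ (fun y l => B r y * inflL B l) (fun y M => B r y * hafM B M),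
    Multiset.sort_eq]
  intro i
  rw [hafM, sort_eq_of_sorted ((Multiset.pairwise_sort M _).sublist (List.eraseIdx_sublist _ _))
    rfl]

theorem inflL_flip (B : ℝ → ℝ → ℂ) {l : List ℝ} (hl : l.Pairwise fun x y => y ≤ x) :
    inflL (fun x y => B y x) l = hafM B l := by
  rw [hafM, sort_eq_of_sorted (l := l.reverse) (List.pairwise_reverse.2 hl)
    (Multiset.coe_reverse l), ← inflL_reverse]

/-- Here the new point comes last; reversing the list and exchanging the arguments of `B` reduces to
expansion along the first entry. -/
theorem hafM_cons_of_ge (B : ℝ → ℝ → ℂ) {r : ℝ} {M : Multiset ℝ} (hr : ∀ y ∈ M, y ≤ r) :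
    hafM B (r ::ₘ M) = (M.map fun y => B y r * hafM B (M.erase y)).sum := by
  have h1 : (r ::ₘ M).sort (· ≤ ·) = M.sort (· ≤ ·) ++ [r] := by
    apply sort_eq_of_sorted
    · rw [List.pairwise_append]
      refine ⟨Multiset.pairwise_sort _ _, List.pairwise_singleton _ _, ?_⟩
      intro a ha b hb
      simp only [List.mem_singleton] at hb
      subst hb
      exact hr a ((Multiset.mem_sort _).1 ha)
    · rw [← Multiset.coe_add, Multiset.sort_eq, Multiset.coe_singleton, add_comm,
        Multiset.singleton_add]
  rw [hafM, h1, ← inflL_reverse, List.reverse_append, List.reverse_singleton,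
    List.singleton_append, inflL_cons,
    sum_get_eraseIdx _ (fun y l => B y r * inflL (fun x y => B y x) l)
      (fun y M => B y r * hafM B M), Multiset.coe_reverse, Multiset.sort_eq]
  intro i
  rw [inflL_flip]
  exact (List.pairwise_reverse.2 (Multiset.pairwise_sort M _)).sublist
    (List.eraseIdx_sublist _ _)

/-! ### Scalar weights of the extensions -/

set_option linter.unusedSectionVars false

section Weights

variable {ι : Type*} [Fintype ι] [DecidableEq ι]

/-- Scalar counterpart of the first stage of an extension: `β l` is the bath correlation between
the new interval and the interval `l`. -/
def wHalf (β : ι → ℂ) (w : (ι → Fin 3) → ℂ) (x : Fin 3) (j : ι → Fin 3) : ℂ :=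
  if x = 2 ∨ ∃ l, j l = 2 then 0
  else if x = 1 then w j
  else ∑ l with j l = 0, β l * w (Function.update j l 1)

/-- Scalar counterpart of an extension by an interval with `y` coupling operators, of which `x`
remain unpaired. -/
def wStep (β : ι → ℂ) (β₀ : ℂ) (w : (ι → Fin 3) → ℂ) (y x : Fin 3) (j : ι → Fin 3) : ℂ :=
  match y, x with
  | 0, 0 => w j
  | 0, 1 => 0
  | 0, 2 => 0
  | 1, 0 => ∑ l with j l ≠ 2, β l * w (Function.update j l (j l + 1))
  | 1, 1 => w j
  | 1, 2 => 0
  | 2, 0 => β₀ * wHalf β w 1 j + ∑ l with j l = 0, β l * wHalf β w 0 (Function.update j l 1)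
  | 2, 1 => wHalf β w 0 j + ∑ l with j l = 0, β l * wHalf β w 1 (Function.update j l 1)
  | 2, 2 => 2 * wHalf β w 1 j

/-- The number of ways to choose `j l` of `k l` points in order, for each `l`. -/
def arrangements (k j : ι → ℕ) : ℕ := ∏ l, (k l).descFactorial (j l)

/-- The indices of a diagram as natural numbers. -/
def toNat (j : ι → Fin 3) : ι → ℕ := fun l => (j l : ℕ)

theorem toNat_update {j : ι → Fin 3} {l : ι} (h : j l ≠ 2) :
    toNat (Function.update j l (j l + 1)) = toNat j + Pi.single l 1 := by
  funext l'
  rcases eq_or_ne l' l with rfl | hl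
  · have : ((j l' + 1 : Fin 3) : ℕ) = (j l' : ℕ) + 1 := by
      generalize j l' = x at h
      revert h; revert x; decide
    simp [toNat, this]
  · simp [toNat, hl]

theorem toNat_update_one {j : ι → Fin 3} {l : ι} (h : j l = 0) :
    toNat (Function.update j l 1) = toNat j + Pi.single l 1 := by
  rw [← toNat_update (by rw [h]; decide), h, zero_add]

theorem arrangements_add_single (k j : ι → ℕ) (l : ι) :
    arrangements k (j + Pi.single l 1) = (k l - j l) * arrangements k j := by
  unfold arrangements
  rw [← Finset.mul_prod_erase _ _ (Finset.mem_univ l),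
    ← Finset.mul_prod_erase Finset.univ (fun l => (k l).descFactorial (j l)) (Finset.mem_univ l)]
  simp only [Pi.add_apply, Pi.single_eq_same, Nat.descFactorial_succ]
  rw [mul_assoc]
  congr 2
  refine Finset.prod_congr rfl fun l' hl' => ?_
  simp [Finset.ne_of_mem_erase hl']

theorem arrangements_eq_zero {k j : ι → ℕ} {l : ι} (h : k l < j l) : arrangements k j = 0 :=
  Finset.prod_eq_zero (Finset.mem_univ l) (Nat.descFactorial_of_lt h)

theorem toNat_two {j : ι → Fin 3} {l : ι} (h : j l = 2) : toNat j l = 2 := by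
  simp [toNat, h]

theorem toNat_pos {j : ι → Fin 3} {l : ι} (h : j l ≠ 0) : 1 ≤ toNat j l := by
  simp only [toNat]
  generalize j l = x at h
  revert h; revert x; decide

/-- The recursion satisfied by the influence functional as a function of the number of points
on the new interval (`F' y`) and on the old intervals. -/
structure HafRec (β : ι → ℂ) (β₀ : ℂ) (F : (ι → ℕ) → ℂ) (F' : ℕ → (ι → ℕ) → ℂ) : Prop where
  zero : ∀ k, F' 0 k = F k
  one : ∀ k, F' 1 k = ∑ l, (k l : ℂ) * (β l * F (k - Pi.single l 1))
  two : ∀ k, F' 2 k = β₀ * F k + ∑ l, (k l : ℂ) * (β l * F' 1 (k - Pi.single l 1))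

/-! ### Exact weights after an extension -/

section Exact

variable {β : ι → ℂ} {β₀ : ℂ} {F : (ι → ℕ) → ℂ} {F' : ℕ → (ι → ℕ) → ℂ} {k : ι → ℕ}
  {w : (ι → Fin 3) → ℂ}

/-- Opening one more point on `l` multiplies `arrangements` by `k l - j l`, which is the number of
partners that the hafnian recursion offers on `l`. Intervals outside `S` have no free point left. -/
theorem sum_eq_hafRec (Φ : (ι → ℕ) → ℂ) (v : (ι → Fin 3) → ℂ) (j : ι → Fin 3)
    (S : Finset ι) (u : ι → Fin 3)
    (hu : ∀ l ∈ S, toNat (Function.update j l (u l)) = toNat j + Pi.single l 1)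
    (hS : ∀ l ∉ S, k l ≤ toNat j l)
    (hv : ∀ l ∈ S, v (Function.update j l (u l)) =
      arrangements k (toNat (Function.update j l (u l))) *
        Φ (k - toNat (Function.update j l (u l)))) :
    ∑ l ∈ S, β l * v (Function.update j l (u l)) =
      arrangements k (toNat j) * ∑ l, ((k - toNat j) l : ℂ) *
        (β l * Φ (k - toNat j - Pi.single l 1)) := by
  rw [Finset.mul_sum, ← Finset.sum_subset (Finset.subset_univ S)]
  · refine Finset.sum_congr rfl fun l hl => ?_
    rw [hv l hl, hu l hl, arrangements_add_single, tsub_add_eq_tsub_tsub]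
    simp only [Pi.sub_apply]
    push_cast
    ring
  · intro l _ hl
    rw [Pi.sub_apply, Nat.sub_eq_zero_of_le (hS l hl)]
    simp

/-- The first stage discards every index `2`. With at most one point per old interval `arrangements`
vanishes there as well, so nothing is lost. -/
theorem wHalf_one_eq (hk : ∀ l, k l ≤ 1)
    (hw : ∀ j, w j = arrangements k (toNat j) * F (k - toNat j)) (j : ι → Fin 3) :
    wHalf β w 1 j = arrangements k (toNat j) * F (k - toNat j) := by
  unfold wHalf
  by_cases h : ∃ l, j l = 2
  · obtain ⟨l, hl⟩ := h
    rw [if_pos (Or.inr ⟨l, hl⟩), arrangements_eq_zero (l := l)]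
    · simp
    · rw [toNat_two hl]; exact Nat.lt_succ_of_le (hk l)
  · rw [if_neg (by simp only [h, or_false]; decide), if_pos rfl, hw]

theorem wHalf_zero_eq (hF : HafRec β β₀ F F') (hk : ∀ l, k l ≤ 1)
    (hw : ∀ j, w j = arrangements k (toNat j) * F (k - toNat j)) (j : ι → Fin 3) :
    wHalf β w 0 j = arrangements k (toNat j) * F' 1 (k - toNat j) := by
  unfold wHalf
  by_cases h : ∃ l, j l = 2
  · obtain ⟨l, hl⟩ := h
    rw [if_pos (Or.inr ⟨l, hl⟩), arrangements_eq_zero (l := l)]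
    · simp
    · rw [toNat_two hl]; exact Nat.lt_succ_of_le (hk l)
  · rw [if_neg (by simp only [h, or_false]; decide), if_neg (by decide), hF.one]
    refine sum_eq_hafRec F w j _ (fun _ => 1) ?_ ?_ (fun l _ => hw _)
    · intro l hl
      exact toNat_update_one (by simpa using hl)
    · intro l hl
      exact (hk l).trans (toNat_pos (by simpa using hl))

/-- The combinatorial factor counts ordered choices of open points on the new and old intervals.
Only `y = 2` passes through the truncated first stage, so only then must the old intervals be at
most singly occupied. -/
theorem wStep_eq (hF : HafRec β β₀ F F') (y x : Fin 3) (hk : y = 2 → ∀ l, k l ≤ 1)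
    (hk2 : ∀ l, k l ≤ 2)
    (hw : ∀ j, w j = arrangements k (toNat j) * F (k - toNat j)) (j : ι → Fin 3) :
    wStep β β₀ w y x j =
      (y : ℕ).descFactorial x * arrangements k (toNat j) * F' (y - x) (k - toNat j) := by
  match y, x with
  | 0, 0 => simpa [wStep, hF.zero] using hw j
  | 0, 1 => simp [wStep]
  | 0, 2 => simp [wStep]
  | 1, 0 =>
    simp only [wStep, Fin.val_one, Fin.val_zero, Nat.descFactorial_zero, Nat.cast_one, one_mul,
      tsub_zero, hF.one]
    refine sum_eq_hafRec F w j _ (fun l => j l + 1) ?_ ?_ (fun l _ => hw _)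
    · intro l hl
      exact toNat_update (by simpa using hl)
    · intro l hl
      rw [toNat_two (by simpa using hl)]
      exact hk2 l
  | 1, 1 => simpa [wStep, hF.zero] using hw j
  | 1, 2 => simp [wStep, Nat.descFactorial]
  | 2, 0 =>
    have hk := hk rfl
    simp only [wStep, Fin.val_two, Fin.val_zero, Nat.descFactorial_zero, Nat.cast_one, one_mul,
      tsub_zero, hF.two, mul_add, wHalf_one_eq hk hw]
    congr 1
    · ring
    · refine sum_eq_hafRec (F' 1) (wHalf β w 0) j _ (fun l => 1) ?_ ?_
        (fun l _ => wHalf_zero_eq hF hk hw _)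
      · intro l hl
        exact toNat_update_one (by simpa using hl)
      · intro l hl
        exact (hk l).trans (toNat_pos (by simpa using hl))
  | 2, 1 =>
    have hk := hk rfl
    -- Either of the two new points may be the one left open. Both cases give the same value, whence
    -- the factor `descFactorial 2 1 = 2`.
    have h1 := sum_eq_hafRec (β := β) (k := k) F (wHalf β w 1) j
      (Finset.univ.filter fun l => j l = 0) (fun l => 1)
      (fun l hl => toNat_update_one (by simpa using hl))
      (fun l hl => (hk l).trans (toNat_pos (by simpa using hl)))
      (fun l _ => wHalf_one_eq hk hw _)
    simp only [wStep, wHalf_zero_eq hF hk hw, h1, ← hF.one]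
    simp [Nat.descFactorial]
    ring
  | 2, 2 =>
    have hk := hk rfl
    simp only [wStep, wHalf_one_eq hk hw]
    simp [Nat.descFactorial, hF.zero]
    ring

end Exact

/-! ### Growth bounds for the weights -/

section Bound

variable {β : ι → ℂ} {β₀ : ℂ} {b : ℝ} {g : ℕ → ℝ} {k : ι → ℕ} {w : (ι → Fin 3) → ℂ}

theorem sum_sub_single (k : ι → ℕ) (l : ι) (hl : k l ≠ 0) :
    ∑ l', (k - Pi.single l 1 : ι → ℕ) l' = ∑ l', k l' - 1 := by
  have h : k = (k - Pi.single l 1) + Pi.single l 1 := by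
    funext l'
    rcases eq_or_ne l' l with rfl | h
    · simp; omega
    · simp [h]
  conv_rhs => rw [h]
  simp only [Pi.add_apply, Finset.sum_add_distrib, Finset.sum_pi_single', Finset.mem_univ, if_true]
  simp

/-- Each free old point is a possible partner at cost `b`, and leaves one free old point fewer. The
offset `c` accounts for a new point already paired inside `v`. -/
theorem norm_sum_le_arrangements (hβ : ∀ l, ‖β l‖ ≤ b) (hb : 0 ≤ b) (hg : ∀ N, 0 ≤ g N)
    (c : ℕ) (v : (ι → Fin 3) → ℂ) (j : ι → Fin 3) (S : Finset ι) (u : ι → Fin 3)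
    (hu : ∀ l ∈ S, toNat (Function.update j l (u l)) = toNat j + Pi.single l 1)
    (hv : ∀ l ∈ S, ‖v (Function.update j l (u l))‖ ≤
      arrangements k (toNat (Function.update j l (u l))) *
        g (c + ∑ l', (k - toNat (Function.update j l (u l))) l')) :
    ‖∑ l ∈ S, β l * v (Function.update j l (u l))‖ ≤
      arrangements k (toNat j) * (b * (∑ l, (k - toNat j) l : ℕ) *
        g (c + (∑ l, (k - toNat j) l - 1))) := by
  have h1 : ∀ l ∈ S, ‖β l * v (Function.update j l (u l))‖ ≤
      ((k - toNat j) l : ℕ) * (arrangements k (toNat j) * b *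
        g (c + (∑ l, (k - toNat j) l - 1))) := by
    intro l hl
    have h2 := hv l hl
    rw [hu l hl, arrangements_add_single, tsub_add_eq_tsub_tsub] at h2
    rw [norm_mul]
    -- Without a free point on `l` the bound in `hv` is zero; this disposes of the truncated
    -- subtraction.
    by_cases h0 : (k - toNat j) l = 0
    · have h3 : k l - toNat j l = 0 := h0
      rw [h3] at h2
      have h4 : ‖v (Function.update j l (u l))‖ = 0 :=
        le_antisymm (by simpa using h2) (norm_nonneg _)
      rw [h4, h0]; simp
    · rw [sum_sub_single _ _ h0] at h2
      calc _ ≤ b * _ := mul_le_mul (hβ l) h2 (norm_nonneg _) hb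
        _ = _ := by rw [Pi.sub_apply]; push_cast; ring
  calc _ ≤ ∑ l ∈ S, ((k - toNat j) l : ℕ) * (arrangements k (toNat j) * b *
        g (c + (∑ l, (k - toNat j) l - 1))) := norm_sum_le_of_le _ h1
    _ ≤ ∑ l, ((k - toNat j) l : ℕ) * (arrangements k (toNat j) * b *
        g (c + (∑ l, (k - toNat j) l - 1))) := by
      refine Finset.sum_le_sum_of_subset_of_nonneg (Finset.subset_univ S) fun l _ _ => ?_
      have := hg (c + (∑ l, (k - toNat j) l - 1))
      positivity
    _ = _ := by rw [← Finset.sum_mul]; push_cast; ring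

theorem norm_wHalf_one_le (hg : ∀ N, 0 ≤ g N)
    (hw : ∀ j, ‖w j‖ ≤ arrangements k (toNat j) * g (∑ l, (k - toNat j) l)) (j : ι → Fin 3) :
    ‖wHalf β w 1 j‖ ≤ arrangements k (toNat j) * g (∑ l, (k - toNat j) l) := by
  unfold wHalf
  by_cases h : (1 : Fin 3) = 2 ∨ ∃ l, j l = 2
  · rw [if_pos h, norm_zero]; have := hg (∑ l, (k - toNat j) l); positivity
  · rw [if_neg h, if_pos rfl]; exact hw j

theorem norm_wHalf_zero_le (hβ : ∀ l, ‖β l‖ ≤ b) (hb : 0 ≤ b) (hg : ∀ N, 0 ≤ g N)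
    (hrec : ∀ N : ℕ, b * N * g (N - 1) ≤ g (N + 1))
    (hw : ∀ j, ‖w j‖ ≤ arrangements k (toNat j) * g (∑ l, (k - toNat j) l)) (j : ι → Fin 3) :
    ‖wHalf β w 0 j‖ ≤ arrangements k (toNat j) * g (1 + ∑ l, (k - toNat j) l) := by
  unfold wHalf
  by_cases h : (0 : Fin 3) = 2 ∨ ∃ l, j l = 2
  · rw [if_pos h, norm_zero]; have := hg (1 + ∑ l, (k - toNat j) l); positivity
  · rw [if_neg h, if_neg (by decide)]
    refine (norm_sum_le_arrangements hβ hb hg 0 w j _ (fun _ => 1)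
      (fun l hl => toNat_update_one (by simpa using hl))
      (fun l _ => by rw [zero_add]; exact hw _)).trans ?_
    rw [zero_add, add_comm 1]
    exact mul_le_mul_of_nonneg_left (hrec _) (by positivity)

/-- No restriction on the occupation is needed, because the truncation only drops terms. `hrec`
bounds the pairing of one new point with `N` candidates. -/
theorem norm_wStep_le (hβ : ∀ l, ‖β l‖ ≤ b) (hβ₀ : ‖β₀‖ ≤ b) (hb : 0 ≤ b) (hg : ∀ N, 0 ≤ g N)
    (hrec : ∀ N : ℕ, b * N * g (N - 1) ≤ g (N + 1)) (y x : Fin 3)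
    (hw : ∀ j, ‖w j‖ ≤ arrangements k (toNat j) * g (∑ l, (k - toNat j) l)) (j : ι → Fin 3) :
    ‖wStep β β₀ w y x j‖ ≤ (y : ℕ).descFactorial x * arrangements k (toNat j) *
      g ((y - x) + ∑ l, (k - toNat j) l) := by
  match y, x with
  | 0, 0 => simpa [wStep] using hw j
  | 0, 1 => simp [wStep]
  | 0, 2 => simp [wStep]
  | 1, 0 =>
    simp only [wStep, Fin.val_one, Fin.val_zero, Nat.descFactorial_zero, Nat.cast_one, one_mul,
      tsub_zero]
    refine (norm_sum_le_arrangements hβ hb hg 0 w j _ (fun l => j l + 1)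
      (fun l hl => toNat_update (by simpa using hl))
      (fun l _ => by rw [zero_add]; exact hw _)).trans ?_
    rw [zero_add, add_comm 1]
    exact mul_le_mul_of_nonneg_left (hrec _) (by positivity)
  | 1, 1 => simpa [wStep] using hw j
  | 1, 2 => simp [wStep, Nat.descFactorial]
  | 2, 0 =>
    simp only [wStep, Fin.val_two, Fin.val_zero, Nat.descFactorial_zero, Nat.cast_one, one_mul,
      tsub_zero]
    have h1 : ‖β₀ * wHalf β w 1 j‖ ≤
        b * (arrangements k (toNat j) * g (∑ l, (k - toNat j) l)) := by
      rw [norm_mul]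
      exact mul_le_mul hβ₀ (norm_wHalf_one_le hg hw j) (norm_nonneg _) hb
    have h2 := norm_sum_le_arrangements (k := k) hβ hb hg 1 (wHalf β w 0) j
      (Finset.univ.filter fun l => j l = 0) (fun _ => 1)
      (fun l hl => toNat_update_one (by simpa using hl))
      (fun l _ => norm_wHalf_zero_le hβ hb hg hrec hw _)
    refine (norm_add_le_of_le h1 h2).trans ?_
    generalize ∑ l, (k - toNat j) l = M
    -- The second new point has `M + 1` candidates: the `M` free old points and the first new point.
    have h3 := hrec (M + 1)
    have h4 : b * M * g (1 + (M - 1)) = b * M * g M := by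
      rcases Nat.eq_zero_or_pos M with rfl | h
      · simp
      · rw [Nat.add_sub_cancel' h]
    rw [h4, add_comm 2]
    calc _ = arrangements k (toNat j) * (b * (M + 1 : ℕ) * g (M + 1 - 1)) := by
          rw [Nat.add_sub_cancel]; push_cast; ring
      _ ≤ _ := mul_le_mul_of_nonneg_left h3 (by positivity)
  | 2, 1 =>
    have h1 := norm_wHalf_zero_le hβ hb hg hrec hw j
    have h2 := norm_sum_le_arrangements (k := k) hβ hb hg 0 (wHalf β w 1) j
      (Finset.univ.filter fun l => j l = 0) (fun _ => 1)
      (fun l hl => toNat_update_one (by simpa using hl))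
      (fun l _ => by rw [zero_add]; exact norm_wHalf_one_le hg hw _)
    simp only [wStep]
    refine (norm_add_le_of_le h1 h2).trans ?_
    have h3 := mul_le_mul_of_nonneg_left (hrec (∑ l, (k - toNat j) l))
      (Nat.cast_nonneg (arrangements k (toNat j)) : (0 : ℝ) ≤ _)
    have h4 : (((2 : Fin 3) : ℕ).descFactorial ((1 : Fin 3) : ℕ) : ℝ) = 2 := by
      norm_num [Nat.descFactorial]
    have h5 : ((2 : Fin 3) : ℕ) - ((1 : Fin 3) : ℕ) = 1 := rfl
    rw [zero_add, h4, h5, add_comm 1]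
    linarith
  | 2, 2 =>
    have h1 := norm_wHalf_one_le (β := β) hg hw j
    simp only [wStep, norm_mul]
    have h4 : (((2 : Fin 3) : ℕ).descFactorial ((2 : Fin 3) : ℕ) : ℝ) = 2 := by
      norm_num [Nat.descFactorial]
    rw [h4, tsub_self, zero_add, Complex.norm_ofNat]
    linarith

end Bound

end Weights

/-! ### Propagators and the interaction picture -/

section Propagator

variable {E : Type*} [NormedAddCommGroup E] [InnerProductSpace ℂ E] [CompleteSpace E]

theorem prop_add (H : E →L[ℂ] E) (s t : ℝ) : prop H (s + t) = prop H s * prop H t := by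
  let _ : NormedAlgebra ℚ (E →L[ℂ] E) := NormedAlgebra.restrictScalars ℚ ℂ (E →L[ℂ] E)
  unfold prop
  rw [← NormedSpace.exp_add_of_commute, ← add_smul]
  · push_cast; ring_nf
  · exact ((Commute.refl H).smul_left _).smul_right _

theorem prop_zero (H : E →L[ℂ] E) : prop H 0 = 1 := by
  simp [prop]

theorem prop_mul_neg (H : E →L[ℂ] E) (s : ℝ) : prop H s * prop H (-s) = 1 := by
  rw [← prop_add, add_neg_cancel, prop_zero]

theorem prop_neg_mul (H : E →L[ℂ] E) (s : ℝ) : prop H (-s) * prop H s = 1 := by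
  rw [← prop_add, neg_add_cancel, prop_zero]

theorem star_prop {H : E →L[ℂ] E} (hH : IsSelfAdjoint H) (s : ℝ) :
    star (prop H s) = prop H (-s) := by
  unfold prop
  rw [NormedSpace.star_exp, star_smul, hH.star_eq]
  simp

/-- The propagator is unitary, and the C*-identity applies. Only an inequality is claimed, since `E`
may be trivial. -/
theorem norm_prop_le {H : E →L[ℂ] E} (hH : IsSelfAdjoint H) (s : ℝ) : ‖prop H s‖ ≤ 1 := by
  have h : ‖prop H s‖ * ‖prop H s‖ ≤ 1 := by
    rw [← CStarRing.norm_star_mul_self, star_prop hH, prop_neg_mul]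
    exact ContinuousLinearMap.norm_id_le
  nlinarith [norm_nonneg (prop H s)]

/-- The coupling operator in the interaction picture. -/
def coupling (H W : E →L[ℂ] E) (s : ℝ) : E →L[ℂ] E := prop H (-s) * W * prop H s

theorem norm_coupling_le {H : E →L[ℂ] E} (hH : IsSelfAdjoint H) (W : E →L[ℂ] E) (s : ℝ) :
    ‖coupling H W s‖ ≤ ‖W‖ :=
  calc ‖coupling H W s‖ ≤ ‖prop H (-s)‖ * ‖W‖ * ‖prop H s‖ := norm_mul₃_le
    _ ≤ 1 * ‖W‖ * 1 := by gcongr <;> exact norm_prop_le hH _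
    _ = ‖W‖ := by ring

theorem coupling_pow (H W : E →L[ℂ] E) (s : ℝ) (y : ℕ) :
    coupling H W s ^ y = prop H (-s) * W ^ y * prop H s := by
  induction y with
  | zero => simp [prop_neg_mul]
  | succ y ih =>
    rw [pow_succ, ih, coupling]
    calc prop H (-s) * W ^ y * prop H s * (prop H (-s) * W * prop H s)
        = prop H (-s) * W ^ y * (prop H s * prop H (-s)) * W * prop H s := by noncomm_ring
      _ = _ := by rw [prop_mul_neg, pow_succ]; noncomm_ring

/-- Each propagator between two couplings splits at time zero, and the halves are absorbed by the
neighbouring conjugated operators. -/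
theorem leftChain_eq (H W : E →L[ℂ] E) (t : ℝ) (l : List ℝ) (a : ℝ) :
    leftChain H W t a l = prop H t * (l.map (coupling H W)).reverse.prod * prop H (-a) := by
  induction l generalizing a with
  | nil => simp [leftChain, sub_eq_add_neg, prop_add]
  | cons s l ih =>
    rw [leftChain, ih, List.map_cons, List.reverse_cons, List.prod_append, List.prod_singleton,
      sub_eq_add_neg, prop_add, coupling]
    noncomm_ring

theorem rightChain_eq (H W : E →L[ℂ] E) (t : ℝ) (l : List ℝ) (a : ℝ) :
    rightChain H W t a l = prop H a * (l.map (coupling H W)).prod * prop H (-t) := by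
  induction l generalizing a with
  | nil => simp [rightChain, sub_eq_add_neg, prop_add]
  | cons s l ih =>
    rw [rightChain, ih, List.map_cons, List.prod_cons, neg_sub, sub_eq_add_neg, prop_add,
      coupling]
    noncomm_ring

/-- The product of the coupling operators at the times of the lists `l` (left of the initial
density matrix, in decreasing order) and `l'` (right of it), up to time `t`. -/
def sandwich (H W ρ₀ : E →L[ℂ] E) (t t' : ℝ) (l l' : List ℝ) : E →L[ℂ] E :=
  prop H t * (l.map (coupling H W)).reverse.prod * ρ₀ * (l'.map (coupling H W)).prod *
    prop H (-t')

theorem norm_prod_coupling_le {H : E →L[ℂ] E} (hH : IsSelfAdjoint H) (W : E →L[ℂ] E)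
    (l : List ℝ) : ‖(l.map (coupling H W)).prod‖ ≤ ‖W‖ ^ l.length := by
  induction l with
  | nil =>
    rw [List.map_nil, List.prod_nil, List.length_nil, pow_zero]
    exact ContinuousLinearMap.norm_id_le
  | cons s l ih =>
    rw [List.map_cons, List.prod_cons, List.length_cons, pow_succ']
    exact (norm_mul_le _ _).trans
      (mul_le_mul (norm_coupling_le hH W s) ih (norm_nonneg _) (norm_nonneg _))

theorem norm_sandwich_le {H : E →L[ℂ] E} (hH : IsSelfAdjoint H) (W ρ₀ : E →L[ℂ] E) (t t' : ℝ)
    (l l' : List ℝ) :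
    ‖sandwich H W ρ₀ t t' l l'‖ ≤ ‖ρ₀‖ * ‖W‖ ^ (l.length + l'.length) := by
  have h1 := norm_prod_coupling_le hH W l.reverse
  have h2 := norm_prod_coupling_le hH W l'
  rw [List.length_reverse, List.map_reverse] at h1
  calc _ ≤ ‖prop H t‖ * ‖(l.map (coupling H W)).reverse.prod‖ * ‖ρ₀‖ *
        ‖(l'.map (coupling H W)).prod‖ * ‖prop H (-t')‖ := by
        unfold sandwich
        refine (norm_mul_le _ _).trans (mul_le_mul_of_nonneg_right ?_ (norm_nonneg _))
        refine (norm_mul_le _ _).trans (mul_le_mul_of_nonneg_right ?_ (norm_nonneg _))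
        exact norm_mul₃_le
    _ ≤ 1 * ‖W‖ ^ l.length * ‖ρ₀‖ * ‖W‖ ^ l'.length * 1 := by
        gcongr <;> exact norm_prop_le hH _
    _ = _ := by rw [pow_add]; ring

theorem dysonIntegrand_eq (H W ρ₀ : E →L[ℂ] E) (B : ℝ → ℝ → ℂ) (t : ℝ) (m m' : ℕ)
    (p : (Fin m → ℝ) × (Fin m' → ℝ)) :
    dysonIntegrand H W ρ₀ B t m m' p =
      influence B (Fin.append (fun i : Fin m => -p.1 i.rev) p.2) •
        sandwich H W ρ₀ t t (List.ofFn p.1) (List.ofFn p.2) := by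
  rw [dysonIntegrand, leftChain_eq, rightChain_eq, sandwich, neg_zero, prop_zero]
  simp only [mul_one, one_mul, mul_assoc]

end Propagator

/-! ### Expansion of the scheme over the numbers of coupling operators -/

/-- The time points of a configuration with `k i` points at the midpoint of the `i`-th interval,
in increasing order. -/
def timeList (h : ℝ) : (a : ℕ) → (Fin a → ℕ) → List ℝ
  | 0, _ => []
  | a + 1, k => timeList h a (fun i => k i.castSucc) ++ List.replicate (k (Fin.last a)) (midR h a)

/-- The multiset of time points of a configuration. -/
def timeMultiset (h : ℝ) {a c : ℕ} (k : Interval a c → ℕ) : Multiset ℝ :=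
  ∑ l, k l • {mid h l}

theorem sum_map_timeMultiset (h : ℝ) {a c : ℕ} (k : Interval a c → ℕ) (f : ℝ → ℂ) :
    ((timeMultiset h k).map f).sum = ∑ l, (k l : ℂ) * f (mid h l) := by
  have h1 : (timeMultiset h k).map f = ∑ l, k l • {f (mid h l)} := by
    rw [timeMultiset, ← Multiset.coe_mapAddMonoidHom, map_sum]
    exact Finset.sum_congr rfl fun l _ => by
      rw [Multiset.coe_mapAddMonoidHom, Multiset.map_nsmul, Multiset.map_singleton]
  rw [h1, ← Multiset.coe_sumAddMonoidHom, map_sum]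
  exact Finset.sum_congr rfl fun l _ => by
    rw [Multiset.coe_sumAddMonoidHom, Multiset.sum_nsmul, Multiset.sum_singleton, nsmul_eq_mul]

theorem timeMultiset_erase (h : ℝ) {a c : ℕ} {k : Interval a c → ℕ} {l : Interval a c}
    (hl : k l ≠ 0) :
    timeMultiset h k = mid h l ::ₘ timeMultiset h (k - Pi.single l 1) := by
  have hk : k = Pi.single l 1 + (k - Pi.single l 1) := by
    funext l'
    rcases eq_or_ne l' l with rfl | h
    · simp; omega
    · simp [h]
  conv_lhs => rw [hk]
  simp only [timeMultiset, Pi.add_apply, add_smul, Finset.sum_add_distrib]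
  rw [← Multiset.singleton_add]
  congr 1
  rw [Finset.sum_eq_single l]
  · simp
  · intro l' _ h; simp [h]
  · simp

theorem mem_timeMultiset {h : ℝ} {a c : ℕ} {k : Interval a c → ℕ} {x : ℝ}
    (hx : x ∈ timeMultiset h k) : ∃ l : Interval a c, x = mid h l := by
  rw [timeMultiset, Multiset.mem_sum] at hx
  obtain ⟨l, _, hl⟩ := hx
  exact ⟨l, by simpa using Multiset.mem_of_mem_nsmul hl⟩

/-- Grouping equal times turns the expansion along `r` into a recursion with multiplicities `k l`.
`A` stands for `B r ·` on the left and `B · r` on the right; `y = r` is allowed in `hA` because two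
points may share the new midpoint. -/
theorem hafRec_of_hafM_cons (B : ℝ → ℝ → ℂ) (h : ℝ) {a c : ℕ} (A : ℝ → ℂ) (r : ℝ)
    (hA : ∀ M : Multiset ℝ, (∀ y ∈ M, y = r ∨ ∃ l : Interval a c, y = mid h l) →
      hafM B (r ::ₘ M) = (M.map fun y => A y * hafM B (M.erase y)).sum) :
    HafRec (fun l : Interval a c => A (mid h l)) (A r) (fun k => hafM B (timeMultiset h k))
      (fun y k => hafM B (Multiset.replicate y r + timeMultiset h k)) where
  zero k := by simp
  one k := by
    rw [Multiset.replicate_one, Multiset.singleton_add,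
      hA _ fun y hy => Or.inr (mem_timeMultiset hy), sum_map_timeMultiset]
    refine Finset.sum_congr rfl fun l _ => ?_
    by_cases hl : k l = 0
    · simp [hl]
    · rw [timeMultiset_erase h hl, Multiset.erase_cons_head]
  two k := by
    have h2 : Multiset.replicate 2 r + timeMultiset h k = r ::ₘ r ::ₘ timeMultiset h k := by
      rw [Multiset.replicate_succ, Multiset.replicate_one, Multiset.cons_add,
        Multiset.singleton_add]
    rw [h2, hA, Multiset.map_cons, Multiset.sum_cons, Multiset.erase_cons_head,
      sum_map_timeMultiset]
    · refine congrArg₂ (· + ·) rfl (Finset.sum_congr rfl fun l _ => ?_)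
      by_cases hl : k l = 0
      · simp [hl]
      · rw [Multiset.erase_cons_tail_of_mem (by rw [timeMultiset_erase h hl]; simp),
          Multiset.replicate_one, Multiset.singleton_add]
        rw [timeMultiset_erase h hl, Multiset.erase_cons_head]
    · intro y hy
      rcases Multiset.mem_cons.1 hy with rfl | hy
      · exact Or.inl rfl
      · exact Or.inr (mem_timeMultiset hy)

/-! ### Splitting off the interval added by an extension -/

section Extension

variable {a c : ℕ}

/-- Restriction of a multi-index to the intervals present before a left extension. -/
def restrictL {α : Type*} (K : Interval (a + 1) c → α) : Interval a c → α :=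
  fun l => K (l.map Fin.castSucc id)

/-- Restriction of a multi-index to the intervals present before a right extension. -/
def restrictR {α : Type*} (K : Interval a (c + 1) → α) : Interval a c → α :=
  fun l => K (l.map id Fin.castSucc)

theorem sum_marks_left {M : Type*} [AddCommMonoid M] (F : Fin 3 → Marks a c → M) :
    ∑ K : Marks (a + 1) c, F (K (.inl (Fin.last a))) (restrictL K) = ∑ k, ∑ y, F y k := by
  rw [Finset.sum_comm, ← Fintype.sum_prod_type' F]
  refine Fintype.sum_equiv
    { toFun := fun K => (K (.inl (Fin.last a)), restrictL K)
      invFun := fun p => Sum.elim (Fin.snoc (fun i => p.2 (.inl i)) p.1) (fun i => p.2 (.inr i))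
      left_inv := ?_
      right_inv := ?_ } _ _ fun K => rfl
  · intro K
    funext l
    rcases l with i | i
    · refine Fin.lastCases ?_ (fun i => ?_) i <;> simp [restrictL]
    · simp [restrictL]
  · intro p
    ext l
    · simp
    · rcases l with i | i <;> simp [restrictL]

theorem sum_marks_right {M : Type*} [AddCommMonoid M] (F : Fin 3 → Marks a c → M) :
    ∑ K : Marks a (c + 1), F (K (.inr (Fin.last c))) (restrictR K) = ∑ k, ∑ y, F y k := by
  rw [Finset.sum_comm, ← Fintype.sum_prod_type' F]
  refine Fintype.sum_equiv
    { toFun := fun K => (K (.inr (Fin.last c)), restrictR K)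
      invFun := fun p => Sum.elim (fun i => p.2 (.inl i)) (Fin.snoc (fun i => p.2 (.inr i)) p.1)
      left_inv := ?_
      right_inv := ?_ } _ _ fun K => rfl
  · intro K
    funext l
    rcases l with i | i
    · simp [restrictR]
    · refine Fin.lastCases ?_ (fun i => ?_) i <;> simp [restrictR]
  · intro p
    ext l
    · simp
    · rcases l with i | i <;> simp [restrictR]

theorem sum_restrictL {M : Type*} [AddCommMonoid M] (F : Interval (a + 1) c → M) :
    ∑ l, F l = F (.inl (Fin.last a)) + ∑ l, restrictL F l := by
  simp only [Fintype.sum_sum_type, Fin.sum_univ_castSucc, restrictL, Sum.map_inl, Sum.map_inr, id]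
  abel

theorem sum_restrictR {M : Type*} [AddCommMonoid M] (F : Interval a (c + 1) → M) :
    ∑ l, F l = F (.inr (Fin.last c)) + ∑ l, restrictR F l := by
  simp only [Fintype.sum_sum_type, Fin.sum_univ_castSucc, restrictR, Sum.map_inl, Sum.map_inr, id]
  abel

theorem arrangements_restrictL (K J : Interval (a + 1) c → ℕ) :
    arrangements K J = (K (.inl (Fin.last a))).descFactorial (J (.inl (Fin.last a))) *
      arrangements (restrictL K) (restrictL J) := by
  simp only [arrangements, Fintype.prod_sum_type, Fin.prod_univ_castSucc, restrictL, Sum.map_inl,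
    Sum.map_inr, id]
  ring

theorem arrangements_restrictR (K J : Interval a (c + 1) → ℕ) :
    arrangements K J = (K (.inr (Fin.last c))).descFactorial (J (.inr (Fin.last c))) *
      arrangements (restrictR K) (restrictR J) := by
  simp only [arrangements, Fintype.prod_sum_type, Fin.prod_univ_castSucc, restrictR, Sum.map_inl,
    Sum.map_inr, id]
  ring

theorem mid_map_left (h : ℝ) (l : Interval a c) :
    mid h (l.map (Fin.castSucc : Fin a → Fin (a + 1)) id) = mid h l := by
  rcases l with i | i <;> rfl

theorem mid_map_right (h : ℝ) (l : Interval a c) :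
    mid h (l.map id (Fin.castSucc : Fin c → Fin (c + 1))) = mid h l := by
  rcases l with i | i <;> rfl

theorem timeMultiset_restrictL (h : ℝ) (K : Interval (a + 1) c → ℕ) :
    timeMultiset h K = Multiset.replicate (K (.inl (Fin.last a))) (midL h a) +
      timeMultiset h (restrictL K) := by
  rw [timeMultiset, sum_restrictL, timeMultiset]
  congr 1
  · rw [Multiset.nsmul_singleton]; rfl
  · simp only [restrictL, mid_map_left]

theorem timeMultiset_restrictR (h : ℝ) (K : Interval a (c + 1) → ℕ) :
    timeMultiset h K = Multiset.replicate (K (.inr (Fin.last c))) (midR h c) +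
      timeMultiset h (restrictR K) := by
  rw [timeMultiset, sum_restrictR, timeMultiset]
  congr 1
  · rw [Multiset.nsmul_singleton]; rfl
  · simp only [restrictR, mid_map_right]

/-- A left extension adds the earliest point on the signed time axis, which is why it is an
expansion along an extreme point. -/
theorem midL_le_mid {h : ℝ} (hh : 0 < h) (l : Interval a c) : midL h a ≤ mid h l := by
  rcases l with i | i
  · have : (i : ℝ) ≤ a := by exact_mod_cast i.is_lt.le
    simp only [mid, midL]
    nlinarith
  · simp only [mid, midL, midR]
    have : (0 : ℝ) ≤ (i : ℕ) := by positivity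
    have : (0 : ℝ) ≤ a := by positivity
    nlinarith

theorem mid_le_midR {h : ℝ} (hh : 0 < h) (l : Interval a c) : mid h l ≤ midR h c := by
  rcases l with i | i
  · simp only [mid, midL, midR]
    have : (0 : ℝ) ≤ (i : ℕ) := by positivity
    have : (0 : ℝ) ≤ c := by positivity
    nlinarith
  · have : (i : ℝ) ≤ c := by exact_mod_cast i.is_lt.le
    simp only [mid, midR]
    nlinarith

theorem hafRec_left (B : ℝ → ℝ → ℂ) {h : ℝ} (hh : 0 < h) :
    HafRec (fun l : Interval a c => B (midL h a) (mid h l)) (B (midL h a) (midL h a))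
      (fun k => hafM B (timeMultiset h k))
      (fun y k => hafM B (Multiset.replicate y (midL h a) + timeMultiset h k)) := by
  refine hafRec_of_hafM_cons B h (fun y => B (midL h a) y) (midL h a) fun M hM =>
    hafM_cons_of_le B fun y hy => ?_
  rcases hM y hy with rfl | ⟨l, rfl⟩
  · exact le_rfl
  · exact midL_le_mid hh l

theorem hafRec_right (B : ℝ → ℝ → ℂ) {h : ℝ} (hh : 0 < h) :
    HafRec (fun l : Interval a c => B (mid h l) (midR h c)) (B (midR h c) (midR h c))
      (fun k => hafM B (timeMultiset h k))
      (fun y k => hafM B (Multiset.replicate y (midR h c) + timeMultiset h k)) := by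
  refine hafRec_of_hafM_cons B h (fun y => B y (midR h c)) (midR h c) fun M hM =>
    hafM_cons_of_ge B fun y hy => ?_
  rcases hM y hy with rfl | ⟨l, rfl⟩
  · exact le_rfl
  · exact mid_le_midR hh l

end Extension

/-! ### The scheme as a sum over configurations -/

section SchemeExpansion

set_option linter.unusedSectionVars false

variable {E : Type*} [NormedAddCommGroup E] [InnerProductSpace ℂ E] [CompleteSpace E]

/-- The one-interval operator with `y` coupling operators. -/
def stepOp (H W : E →L[ℂ] E) (h : ℝ) : Fin 3 → (E →L[ℂ] E)
  | 0 => P0 H h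
  | 1 => P1 H W h
  | 2 => G2 H W h * G1 H W h

/-- The constants in `G1` and `G2` multiply to `(-ih) ^ 2 / 2!`, so all three operators carry `z ^ y
/ y!`: up to a phase, the volume of `y` ordered times in one cell. -/
theorem stepOp_eq (H W : E →L[ℂ] E) (h : ℝ) (y : Fin 3) :
    stepOp H W h y = ((-Complex.I * (h : ℂ)) ^ (y : ℕ) / ((y : ℕ).factorial : ℂ)) •
      (prop H (h / 2) * W ^ (y : ℕ) * prop H (h / 2)) := by
  match y with
  | 0 => simp [stepOp, P0, ← prop_add]
  | 1 => simp [stepOp, P1]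
  | 2 =>
    simp only [stepOp, G1, G2, smul_mul_smul_comm, Fin.val_two, pow_two, Nat.factorial_two]
    congr 1
    · push_cast; ring

theorem star_stepOp {H W : E →L[ℂ] E} (hH : IsSelfAdjoint H) (hW : IsSelfAdjoint W) (h : ℝ)
    (y : Fin 3) :
    star (stepOp H W h y) = ((Complex.I * (h : ℂ)) ^ (y : ℕ) / ((y : ℕ).factorial : ℂ)) •
      (prop H (-(h / 2)) * W ^ (y : ℕ) * prop H (-(h / 2))) := by
  rw [stepOp_eq, star_smul, star_mul, star_mul, star_pow, hW.star_eq, star_prop hH, mul_assoc]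
  congr 1
  simp

section Linear

variable (H W : E →L[ℂ] E) (B : ℝ → ℝ → ℂ) (h : ℝ) {a c : ℕ} {κ : Type*} [Fintype κ]
  {w : κ → Marks a c → ℂ} {O : κ → (E →L[ℂ] E)} {Λ : Marks a c → (E →L[ℂ] E)}

theorem sum_mul_smul (S : Finset (Interval a c)) (β : Interval a c → ℂ) (X : E →L[ℂ] E)
    (v : κ → Interval a c → ℂ) :
    ∑ l ∈ S, β l • (X * ∑ k, v k l • O k) = ∑ k, (∑ l ∈ S, β l * v k l) • (X * O k) := by
  simp only [Finset.sum_smul, Finset.mul_sum, Finset.smul_sum]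
  rw [Finset.sum_comm]
  simp only [mul_smul_comm, smul_smul]

theorem sum_smul_mul (S : Finset (Interval a c)) (β : Interval a c → ℂ) (X : E →L[ℂ] E)
    (v : κ → Interval a c → ℂ) :
    ∑ l ∈ S, β l • ((∑ k, v k l • O k) * X) = ∑ k, (∑ l ∈ S, β l * v k l) • (O k * X) := by
  simp only [Finset.sum_smul, Finset.sum_mul, Finset.smul_sum]
  rw [Finset.sum_comm]
  simp only [smul_mul_assoc, smul_smul]

theorem leftHalf_expand (hΛ : ∀ j, Λ j = ∑ k, w k j • O k) (x : Fin 3) (j : Marks a c) :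
    leftHalf H W B h Λ x j =
      ∑ k, wHalf (fun l => B (midL h a) (mid h l)) (w k) x j • (G1 H W h * O k) := by
  unfold leftHalf wHalf
  split_ifs
  · simp
  · rw [hΛ, Finset.mul_sum]; simp only [mul_smul_comm]
  · simp only [hΛ]
    exact sum_mul_smul _ _ _ _

theorem rightHalf_expand (hΛ : ∀ j, Λ j = ∑ k, w k j • O k) (x : Fin 3) (j : Marks a c) :
    rightHalf H W B h Λ x j =
      ∑ k, wHalf (fun l => B (mid h l) (midR h c)) (w k) x j • (O k * star (G1 H W h)) := by
  unfold rightHalf wHalf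
  split_ifs
  · simp
  · rw [hΛ, Finset.sum_mul]; simp only [smul_mul_assoc]
  · simp only [hΛ]
    exact sum_smul_mul _ _ _ _

/-- The extension is linear in `Λ` and separates into operators and scalar weights; `y` records
whether `P0`, `P1` or `G2 * G1` acted. -/
theorem leftStep_expand (hΛ : ∀ j, Λ j = ∑ k, w k j • O k) (x : Fin 3) (j : Marks a c) :
    leftStep H W B h Λ x j = ∑ k, ∑ y,
      wStep (fun l => B (midL h a) (mid h l)) (B (midL h a) (midL h a)) (w k) y x j •
        (stepOp H W h y * O k) := by
  simp only [Fin.sum_univ_three, Finset.sum_add_distrib]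
  match x with
  | 0 =>
    have hP : ∑ l with j l ≠ 2, B (midL h a) (mid h l) •
        (P1 H W h * Λ (Function.update j l (j l + 1))) =
        ∑ k, (∑ l with j l ≠ 2, B (midL h a) (mid h l) *
          w k (Function.update j l (j l + 1))) • (P1 H W h * O k) := by
      simp only [hΛ]
      exact sum_mul_smul _ _ _ _
    simp only [leftStep, wStep, stepOp, leftHalf_expand H W B h hΛ, add_smul,
      Finset.sum_add_distrib, sum_mul_smul, hP]
    simp only [hΛ, Finset.mul_sum, Finset.smul_sum, mul_smul_comm, smul_smul,
      mul_assoc, add_assoc]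
  | 1 =>
    simp only [leftStep, wStep, stepOp, leftHalf_expand H W B h hΛ, add_smul,
      Finset.sum_add_distrib, sum_mul_smul]
    simp only [hΛ, Finset.mul_sum, mul_smul_comm, mul_assoc, add_assoc, zero_smul,
      Finset.sum_const_zero, zero_add]
  | 2 =>
    simp only [leftStep, wStep, stepOp, leftHalf_expand H W B h hΛ]
    simp only [Finset.mul_sum, Finset.smul_sum, mul_smul_comm, smul_smul, mul_assoc, zero_smul,
      Finset.sum_const_zero, zero_add]

theorem rightStep_expand (hΛ : ∀ j, Λ j = ∑ k, w k j • O k) (x : Fin 3) (j : Marks a c) :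
    rightStep H W B h Λ x j = ∑ k, ∑ y,
      wStep (fun l => B (mid h l) (midR h c)) (B (midR h c) (midR h c)) (w k) y x j •
        (O k * star (stepOp H W h y)) := by
  simp only [Fin.sum_univ_three, Finset.sum_add_distrib]
  match x with
  | 0 =>
    have hP : ∑ l with j l ≠ 2, B (mid h l) (midR h c) •
        (Λ (Function.update j l (j l + 1)) * star (P1 H W h)) =
        ∑ k, (∑ l with j l ≠ 2, B (mid h l) (midR h c) *
          w k (Function.update j l (j l + 1))) • (O k * star (P1 H W h)) := by
      simp only [hΛ]
      exact sum_smul_mul _ _ _ _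
    simp only [rightStep, wStep, stepOp, rightHalf_expand H W B h hΛ, add_smul,
      Finset.sum_add_distrib, sum_smul_mul, star_mul, hP]
    simp only [hΛ, Finset.sum_mul, Finset.smul_sum, smul_mul_assoc, smul_smul,
      mul_assoc, add_assoc]
  | 1 =>
    simp only [rightStep, wStep, stepOp, rightHalf_expand H W B h hΛ, add_smul,
      Finset.sum_add_distrib, sum_smul_mul, star_mul]
    simp only [hΛ, Finset.sum_mul, smul_mul_assoc, mul_assoc, add_assoc, zero_smul,
      Finset.sum_const_zero, zero_add]
  | 2 =>
    simp only [rightStep, wStep, stepOp, rightHalf_expand H W B h hΛ, star_mul]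
    simp only [Finset.sum_mul, Finset.smul_sum, smul_mul_assoc, smul_smul, mul_assoc, zero_smul,
      Finset.sum_const_zero, zero_add]

end Linear

/-- The product of the one-interval prefactors `z ^ k / k!`. -/
def prefactor (z : ℂ) {a : ℕ} (k : Fin a → ℕ) : ℂ := ∏ i, z ^ k i / ((k i).factorial : ℂ)

/-- The operator of the configuration with `k l` coupling operators at the midpoint of each
interval `l`. -/
def chainOp (H W ρ₀ : E →L[ℂ] E) (h : ℝ) {a c : ℕ} (k : Interval a c → ℕ) : E →L[ℂ] E :=
  (prefactor (-Complex.I * h) (fun i => k (.inl i)) *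
    prefactor (Complex.I * h) (fun i => k (.inr i))) •
    sandwich H W ρ₀ (a * h) (c * h) (timeList h a fun i => k (.inl i))
      (timeList h c fun i => k (.inr i))

/-- The new midpoint lies half a step from both ends of its interval, so the two half-step
propagators around `W ^ y` are those of the interaction picture. -/
theorem stepOp_mul_chainOp (H W ρ₀ : E →L[ℂ] E) (h : ℝ) {a c : ℕ} (K : Marks (a + 1) c) :
    stepOp H W h (K (.inl (Fin.last a))) * chainOp H W ρ₀ h (toNat (restrictL K)) =
      chainOp H W ρ₀ h (toNat K) := by
  simp only [chainOp, prefactor, Fin.prod_univ_castSucc, timeList, stepOp_eq, smul_mul_smul_comm]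
  congr 1
  · simp only [toNat, restrictL, Sum.map_inl, Sum.map_inr, id]
    ring
  · simp only [toNat, restrictL, Sum.map_inl, Sum.map_inr, id]
    simp only [sandwich, List.map_append, List.map_replicate, List.reverse_append,
      List.reverse_replicate, List.prod_append, List.prod_replicate, coupling_pow]
    have h1 : prop H (((a + 1 : ℕ) : ℝ) * h) * prop H (-midR h a) = prop H (h / 2) := by
      rw [← prop_add, midR]; congr 1; push_cast; ring
    have h2 : prop H (midR h a) = prop H (h / 2) * prop H (a * h) := by
      rw [← prop_add, midR]; congr 1; ring
    simp only [← mul_assoc]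
    rw [h1, h2]
    simp only [← mul_assoc]

theorem chainOp_mul_star_stepOp {H W : E →L[ℂ] E} (hH : IsSelfAdjoint H) (hW : IsSelfAdjoint W)
    (ρ₀ : E →L[ℂ] E) (h : ℝ) {a c : ℕ} (K : Marks a (c + 1)) :
    chainOp H W ρ₀ h (toNat (restrictR K)) * star (stepOp H W h (K (.inr (Fin.last c)))) =
      chainOp H W ρ₀ h (toNat K) := by
  simp only [chainOp, prefactor, Fin.prod_univ_castSucc, timeList, star_stepOp hH hW,
    smul_mul_smul_comm]
  congr 1
  · simp only [toNat, restrictR, Sum.map_inl, Sum.map_inr, id]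
    ring
  · simp only [toNat, restrictR, Sum.map_inl, Sum.map_inr, id]
    simp only [sandwich, List.map_append, List.map_replicate, List.prod_append,
      List.prod_replicate, coupling_pow]
    have h1 : prop H (midR h c) * prop H (-(((c + 1 : ℕ) : ℝ) * h)) = prop H (-(h / 2)) := by
      rw [← prop_add, midR]; congr 1; push_cast; ring
    have h2 : prop H (-midR h c) = prop H (-(c * h)) * prop H (-(h / 2)) := by
      rw [← prop_add, midR]; congr 1; ring
    simp only [mul_assoc]
    rw [h1, h2]
    simp only [mul_assoc]

/-- At most one interval carries two coupling operators. -/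
def AtMostOneDouble {ι : Type*} (K : ι → Fin 3) : Prop := ∀ i j, K i = 2 → K j = 2 → i = j

/-- The operators `Λ(J)` are combinations of the operators of the configurations. The weight of a
configuration is bounded by `g`, and it is given by the influence functional of the unpaired
points if at most one interval carries two coupling operators. -/
structure Expands (H W ρ₀ : E →L[ℂ] E) (B : ℝ → ℝ → ℂ) (h : ℝ) (g : ℕ → ℝ) {a c : ℕ}
    (Λ : Marks a c → (E →L[ℂ] E)) (w : Marks a c → Marks a c → ℂ) : Prop where
  expand : ∀ J, Λ J = ∑ K, w K J • chainOp H W ρ₀ h (toNat K)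
  bound : ∀ K J, ‖w K J‖ ≤ arrangements (toNat K) (toNat J) * g (∑ l, (toNat K - toNat J) l)
  exact : ∀ K, AtMostOneDouble K → ∀ J, w K J =
    arrangements (toNat K) (toNat J) * hafM B (timeMultiset h (toNat K - toNat J))

variable {H W ρ₀ : E →L[ℂ] E} {B : ℝ → ℝ → ℂ} {h b : ℝ} {g : ℕ → ℝ} {a c : ℕ}
  {Λ : Marks a c → (E →L[ℂ] E)} {w : Marks a c → Marks a c → ℂ}

theorem toNat_le_two {ι : Type*} (K : ι → Fin 3) (l : ι) : toNat K l ≤ 2 :=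
  Nat.le_of_lt_succ (K l).is_lt

theorem toNat_le_one {ι : Type*} {K : ι → Fin 3} {l : ι} (hl : K l ≠ 2) : toNat K l ≤ 1 := by
  simp only [toNat]
  generalize K l = x at hl
  revert hl; revert x; decide

/-- If the new interval is the doubly occupied one, every old interval carries at most one point, as
`wStep_eq` requires. Otherwise the condition is inherited by restriction. -/
theorem Expands.leftExt (hΛ : Expands H W ρ₀ B h g Λ w) (hh : 0 < h)
    (hB : ∀ x y, ‖B x y‖ ≤ b) (hg : ∀ N, 0 ≤ g N)
    (hrec : ∀ N : ℕ, b * N * g (N - 1) ≤ g (N + 1)) :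
    Expands H W ρ₀ B h g (leftExt H W B h Λ) fun K J =>
      wStep (fun l => B (midL h a) (mid h l)) (B (midL h a) (midL h a)) (w (restrictL K))
        (K (.inl (Fin.last a))) (J (.inl (Fin.last a))) (restrictL J) where
  expand J := by
    rw [FRODS.leftExt, leftStep_expand H W B h hΛ.expand, ← sum_marks_left]
    refine Finset.sum_congr rfl fun K _ => ?_
    rw [stepOp_mul_chainOp]
    rfl
  bound K J := by
    refine (norm_wStep_le (fun l => hB _ _) (hB _ _) ((norm_nonneg _).trans (hB 0 0)) hg hrec _ _
      (hΛ.bound (restrictL K)) _).trans (le_of_eq ?_)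
    rw [arrangements_restrictL, sum_restrictL]
    push_cast
    rfl
  exact K hK J := by
    rw [wStep_eq (hafRec_left B hh) _ _ ?_ (fun l => toNat_le_two _ l)
      (hΛ.exact (restrictL K) ?_), arrangements_restrictL, timeMultiset_restrictL]
    · push_cast
      rfl
    · intro hy l
      refine toNat_le_one fun hl => ?_
      have := hK _ _ hy hl
      rcases l with i | i
      · exact absurd (Sum.inl_injective this).symm (Fin.castSucc_lt_last i).ne
      · simp at this
    · intro l l' hl hl'
      have := hK _ _ hl hl'
      rcases l with i | i <;> rcases l' with i' | i' <;> simp_all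

theorem Expands.rightExt (hΛ : Expands H W ρ₀ B h g Λ w) (hH : IsSelfAdjoint H)
    (hW : IsSelfAdjoint W) (hh : 0 < h) (hB : ∀ x y, ‖B x y‖ ≤ b) (hg : ∀ N, 0 ≤ g N)
    (hrec : ∀ N : ℕ, b * N * g (N - 1) ≤ g (N + 1)) :
    Expands H W ρ₀ B h g (rightExt H W B h Λ) fun K J =>
      wStep (fun l => B (mid h l) (midR h c)) (B (midR h c) (midR h c)) (w (restrictR K))
        (K (.inr (Fin.last c))) (J (.inr (Fin.last c))) (restrictR J) where
  expand J := by
    rw [FRODS.rightExt, rightStep_expand H W B h hΛ.expand, ← sum_marks_right]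
    refine Finset.sum_congr rfl fun K _ => ?_
    rw [chainOp_mul_star_stepOp hH hW]
    rfl
  bound K J := by
    refine (norm_wStep_le (fun l => hB _ _) (hB _ _) ((norm_nonneg _).trans (hB 0 0)) hg hrec _ _
      (hΛ.bound (restrictR K)) _).trans (le_of_eq ?_)
    rw [arrangements_restrictR, sum_restrictR]
    push_cast
    rfl
  exact K hK J := by
    rw [wStep_eq (hafRec_right B hh) _ _ ?_ (fun l => toNat_le_two _ l)
      (hΛ.exact (restrictR K) ?_), arrangements_restrictR, timeMultiset_restrictR]
    · push_cast
      rfl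
    · intro hy l
      refine toNat_le_one fun hl => ?_
      have := hK _ _ hy hl
      rcases l with i | i
      · simp at this
      · exact absurd (Sum.inr_injective this).symm (Fin.castSucc_lt_last i).ne
    · intro l l' hl hl'
      have := hK _ _ hl hl'
      rcases l with i | i <;> rcases l' with i' | i' <;> simp_all

theorem exists_expands_diagrams (ρ₀ : E →L[ℂ] E) (hH : IsSelfAdjoint H) (hW : IsSelfAdjoint W)
    (hh : 0 < h) (hB : ∀ x y, ‖B x y‖ ≤ b) (hg : ∀ N, 0 ≤ g N) (hg0 : 1 ≤ g 0)
    (hrec : ∀ N : ℕ, b * N * g (N - 1) ≤ g (N + 1)) (n : ℕ) :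
    ∃ w, Expands H W ρ₀ B h g (diagrams H W ρ₀ B h n) w := by
  induction n with
  | zero =>
    refine ⟨fun _ _ => 1, fun J => ?_, fun K J => ?_, fun K _ J => ?_⟩
    · simp [diagrams, chainOp, prefactor, sandwich, timeList, prop_zero]
    · simpa [arrangements] using hg0
    · simp [arrangements, timeMultiset, hafM_zero]
  | succ n ih =>
    obtain ⟨w, hw⟩ := ih
    exact ⟨_, (hw.leftExt hh hB hg hrec).rightExt hH hW hh hB hg hrec⟩

theorem arrangements_zero {ι : Type*} [Fintype ι] (k : ι → ℕ) : arrangements k 0 = 1 := by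
  simp [arrangements]

theorem exists_rhoTilde_eq (ρ₀ : E →L[ℂ] E) (hH : IsSelfAdjoint H) (hW : IsSelfAdjoint W)
    (hh : 0 < h) (hB : ∀ x y, ‖B x y‖ ≤ b) (hg : ∀ N, 0 ≤ g N) (hg0 : 1 ≤ g 0)
    (hrec : ∀ N : ℕ, b * N * g (N - 1) ≤ g (N + 1)) (n : ℕ) :
    ∃ w : Marks n n → ℂ,
      rhoTilde H W ρ₀ B h n = ∑ K, w K • chainOp H W ρ₀ h (toNat K) ∧
      (∀ K, ‖w K‖ ≤ g (∑ l, toNat K l)) ∧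
      ∀ K, AtMostOneDouble K → w K = hafM B (timeMultiset h (toNat K)) := by
  obtain ⟨w, hw⟩ := exists_expands_diagrams ρ₀ hH hW hh hB hg hg0 hrec n
  have h0 : toNat (fun _ : Interval n n => (0 : Fin 3)) = 0 := rfl
  refine ⟨fun K => w K fun _ => 0, hw.expand _, fun K => ?_, fun K hK => ?_⟩
  · have := hw.bound K fun _ => 0
    rwa [h0, arrangements_zero, tsub_zero, Nat.cast_one, one_mul] at this
  · change w K _ = _
    rw [hw.exact K hK, h0, arrangements_zero, tsub_zero, Nat.cast_one, one_mul]

end SchemeExpansion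

/-! ### The composite midpoint rule in one variable -/

section OneVariable

set_option linter.unusedSectionVars false

variable {F : Type*} [NormedAddCommGroup F] [NormedSpace ℝ F]

/-- `φ` is twice differentiable on the positive half-line, and its derivatives of order `0`, `1`
and `2` are bounded by `K`, `K * L` and `K * L ^ 2`. -/
def C2Bound (φ : ℝ → F) (K L : ℝ) : Prop :=
  ∃ φ' φ'' : ℝ → F, ∀ x, 0 < x → HasDerivAt φ (φ' x) x ∧ HasDerivAt φ' (φ'' x) x ∧
    ‖φ x‖ ≤ K ∧ ‖φ' x‖ ≤ K * L ∧ ‖φ'' x‖ ≤ K * L ^ 2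

/-- The midpoint of the interval of the uniform grid with step `h` that contains `x`. -/
def gridMid (h x : ℝ) : ℝ := midR h ⌊x / h⌋₊

theorem measurable_gridMid (h : ℝ) : Measurable (gridMid h) := by
  unfold gridMid midR
  have : Measurable fun x : ℝ => ⌊x / h⌋₊ := Nat.measurable_floor.comp (measurable_id.div_const h)
  exact (((measurable_from_nat (f := fun n : ℕ => (n : ℝ))).comp this).add_const _).mul_const _

theorem midR_pos {h : ℝ} (hh : 0 < h) (i : ℕ) : 0 < midR h i := by
  unfold midR; positivity

theorem gridMid_pos {h : ℝ} (hh : 0 < h) (x : ℝ) : 0 < gridMid h x := midR_pos hh _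

theorem gridMid_eq {h x : ℝ} (hh : 0 < h) {i : ℕ} (h1 : i * h ≤ x) (h2 : x < (i + 1) * h) :
    gridMid h x = midR h i := by
  have : ⌊x / h⌋₊ = i := by
    rw [Nat.floor_eq_iff (div_nonneg (le_trans (by positivity) h1) hh.le)]
    exact ⟨(le_div_iff₀ hh).2 h1, (div_lt_iff₀ hh).2 h2⟩
  rw [gridMid, this]

theorem abs_sub_gridMid_le {h x : ℝ} (hh : 0 < h) (hx : 0 ≤ x) : |x - gridMid h x| ≤ h := by
  have h1 : (⌊x / h⌋₊ : ℝ) * h ≤ x := (le_div_iff₀ hh).1 (Nat.floor_le (by positivity))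
  have h2 : x < (⌊x / h⌋₊ + 1) * h := (div_lt_iff₀ hh).1 (Nat.lt_floor_add_one _)
  rw [gridMid, midR, abs_le]
  constructor <;> nlinarith

theorem gridMid_mono {h : ℝ} (hh : 0 < h) : Monotone (gridMid h) := by
  intro x y hxy
  unfold gridMid midR
  have : (⌊x / h⌋₊ : ℝ) ≤ ⌊y / h⌋₊ := by
    exact_mod_cast Nat.floor_le_floor (by gcongr)
  gcongr

/-- Nothing is known about `f` off `U`, so it is first replaced by zero there. This is how functions
regular only away from the coordinate axes are handled. -/
theorem aestronglyMeasurable_comp_of_continuousOn {X Y : Type*} [MeasurableSpace X]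
    [TopologicalSpace Y] [MeasurableSpace Y] [OpensMeasurableSpace Y]
    [SecondCountableTopology Y] {μ : Measure X} {f : Y → F} {g : X → Y} {U : Set Y} {S : Set X}
    (hf : ContinuousOn f U) (hU : MeasurableSet U) (hg : Measurable g) (hS : MeasurableSet S)
    (hSU : ∀ x ∈ S, g x ∈ U) : AEStronglyMeasurable (fun x => f (g x)) (μ.restrict S) := by
  have h1 : StronglyMeasurable (Function.extend ((↑) : U → Y) (U.domRestrict f) fun _ => 0) :=
    (MeasurableEmbedding.subtype_coe hU).stronglyMeasurable_extend
      (continuousOn_iff_continuous_domRestrict.1 hf).stronglyMeasurable stronglyMeasurable_const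
  refine ((h1.comp_measurable hg).aestronglyMeasurable (μ := μ.restrict S)).congr ?_
  filter_upwards [ae_restrict_mem hS] with x hx
  exact Subtype.val_injective.extend_apply (U.domRestrict f) _ (⟨g x, hSU x hx⟩ : U)

theorem C2Bound.continuousOn {φ : ℝ → F} {K L : ℝ} (hφ : C2Bound φ K L) :
    ContinuousOn φ (Set.Ioi 0) := by
  obtain ⟨φ', φ'', hφ⟩ := hφ
  exact fun x hx => (hφ x hx).1.continuousAt.continuousWithinAt

theorem C2Bound.norm_sub_le {φ : ℝ → F} {K L : ℝ} (hφ : C2Bound φ K L) {x y : ℝ} (hx : 0 < x)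
    (hy : 0 < y) : ‖φ x - φ y‖ ≤ K * L * |x - y| := by
  obtain ⟨φ', φ'', hφ⟩ := hφ
  exact Convex.norm_image_sub_le_of_norm_hasDerivWithin_le (s := Set.Ioi 0) (f' := φ')
    (fun z hz => (hφ z hz).1.hasDerivWithinAt) (fun z hz => (hφ z hz).2.2.2.1)
    (convex_Ioi 0) hy hx

theorem C2Bound.integrableOn_comp {φ : ℝ → F} {K L : ℝ} (hφ : C2Bound φ K L) {g : ℝ → ℝ}
    (hg : Measurable g) (hg0 : ∀ x, 0 < x → 0 < g x) {S : Set ℝ} (hS : MeasurableSet S)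
    (hS0 : S ⊆ Set.Ioi 0) (hfin : volume S ≠ ⊤) : IntegrableOn (fun x => φ (g x)) S := by
  have hm := aestronglyMeasurable_comp_of_continuousOn (μ := volume) hφ.continuousOn
    measurableSet_Ioi hg hS (fun x hx => hg0 x (hS0 hx))
  obtain ⟨φ', φ'', hφ⟩ := hφ
  refine IntegrableOn.of_bound (lt_top_iff_ne_top.2 hfin) hm K ?_
  filter_upwards [ae_restrict_mem hS] with x hx
  exact (hφ _ (hg0 x (hS0 hx))).2.2.1

theorem C2Bound.intervalIntegrable_comp {φ : ℝ → F} {K L : ℝ} (hφ : C2Bound φ K L) {g : ℝ → ℝ}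
    (hg : Measurable g) (hg0 : ∀ x, 0 < x → 0 < g x) {x y : ℝ} (hx : 0 ≤ x) (hxy : x ≤ y) :
    IntervalIntegrable (fun x => φ (g x)) volume x y := by
  rw [intervalIntegrable_iff_integrableOn_Ioc_of_le hxy]
  exact hφ.integrableOn_comp hg hg0 measurableSet_Ioc (fun z hz => lt_of_le_of_lt hx hz.1)
    (by simp)

/-- The linear Taylor term at the midpoint is odd and integrates to zero (`h2`); the remainder is of
order `h ^ 2` on a cell of length `h`. -/
theorem C2Bound.norm_integral_cell_le [CompleteSpace F] {φ : ℝ → F} {K L h : ℝ}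
    (hφ : C2Bound φ K L) (hh : 0 < h) (i : ℕ) :
    ‖∫ x in (i * h)..((i + 1) * h), (φ x - φ (gridMid h x))‖ ≤ K * L ^ 2 * h ^ 3 := by
  have hle : (i : ℝ) * h ≤ (i + 1) * h := by nlinarith
  have h0 : (0 : ℝ) ≤ i * h := by positivity
  have hInt := hφ.intervalIntegrable_comp measurable_id (fun x hx => hx) h0 hle
  obtain ⟨φ', φ'', hφ⟩ := hφ
  set c := midR h i with hc
  have hcpos : 0 < c := midR_pos hh i
  have h1 : ∫ x in (i * h)..((i + 1) * h), (φ x - φ (gridMid h x)) =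
      ∫ x in (i * h)..((i + 1) * h), (φ x - φ c) := by
    apply intervalIntegral.integral_congr_ae
    -- `gridMid` assigns the right end to the next cell.
    have : ∀ᵐ x : ℝ, x ≠ (i + 1) * h := by simp [ae_iff]
    filter_upwards [this] with x hx hx'
    rw [Set.uIoc_of_le hle] at hx'
    rw [gridMid_eq hh hx'.1.le (lt_of_le_of_ne hx'.2 hx)]
  have h2 : ∫ x in (i * h)..((i + 1) * h), (x - c) • φ' c = 0 := by
    rw [intervalIntegral.integral_smul_const, intervalIntegral.integral_sub (by simp) (by simp),
      integral_id, intervalIntegral.integral_const, hc, midR, smul_eq_mul]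
    convert zero_smul ℝ _ using 2
    ring
  have h3 : ∫ x in (i * h)..((i + 1) * h), (φ x - φ (gridMid h x)) =
      ∫ x in (i * h)..((i + 1) * h), (φ x - φ c - (x - c) • φ' c) := by
    rw [h1, intervalIntegral.integral_sub (f := fun x => φ x - φ c), h2, sub_zero]
    · exact hInt.sub (by simp)
    · exact Continuous.intervalIntegrable (by fun_prop) _ _
  rw [h3]
  have h4 : ∀ x ∈ Set.uIoc (i * h) ((i + 1) * h), ‖φ x - φ c - (x - c) • φ' c‖ ≤
      K * L ^ 2 * h ^ 2 := by
    intro x hx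
    rw [Set.uIoc_of_le hle] at hx
    have hsub : ∀ z ∈ Set.Ioc (i * h) ((i + 1) * h), 0 < z ∧ |z - c| ≤ h := by
      intro z hz
      refine ⟨lt_of_le_of_lt h0 hz.1, ?_⟩
      rw [hc, midR, abs_le]
      constructor <;> nlinarith [hz.1, hz.2]
    have hcm : c ∈ Set.Ioc (i * h) ((i + 1) * h) := by
      rw [hc, midR]; constructor <;> nlinarith
    have hK : 0 ≤ K * L ^ 2 := (norm_nonneg _).trans (hφ c hcpos).2.2.2.2
    -- The mean value inequality is used twice: for `φ'`, and for `φ` minus its linear part, whose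
    -- derivative vanishes at `c`.
    have h5 := Convex.norm_image_sub_le_of_norm_hasDerivWithin_le
      (s := Set.Ioc ((i : ℝ) * h) ((i + 1) * h)) (f := fun z => φ z - z • φ' c)
      (f' := fun z => φ' z - (1 : ℝ) • φ' c) (C := K * L ^ 2 * h)
      (fun z hz => ((hφ z (hsub z hz).1).1.sub
        ((hasDerivAt_id z).smul_const (φ' c))).hasDerivWithinAt)
      (fun z hz => ?_) (convex_Ioc _ _) hcm hx
    · calc ‖φ x - φ c - (x - c) • φ' c‖ = ‖φ x - x • φ' c - (φ c - c • φ' c)‖ := by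
            congr 1; rw [sub_smul]; abel
        _ ≤ K * L ^ 2 * h * ‖x - c‖ := h5
        _ ≤ K * L ^ 2 * h * h := by
            gcongr
            exact (hsub x hx).2
        _ = K * L ^ 2 * h ^ 2 := by ring
    · rw [one_smul]
      refine (Convex.norm_image_sub_le_of_norm_hasDerivWithin_le (s := Set.Ioi 0) (f' := φ'')
        (fun z hz => (hφ z hz).2.1.hasDerivWithinAt) (fun z hz => (hφ z hz).2.2.2.2)
        (convex_Ioi 0) hcpos (hsub z hz).1).trans ?_
      gcongr
      exact (hsub z hz).2
  refine (intervalIntegral.norm_integral_le_of_norm_le_const h4).trans (le_of_eq ?_)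
  rw [show (i + 1) * h - i * h = h by ring, abs_of_pos hh]
  ring

/-- At most `x / h` full cells contribute `h ^ 3` each. The cut cell has no cancellation, but its
length and its integrand are both of order `h`. -/
theorem C2Bound.norm_integral_zero_le [CompleteSpace F] {φ : ℝ → F} {K L h x : ℝ}
    (hφ : C2Bound φ K L) (hh : 0 < h) (hx : 0 ≤ x) :
    ‖∫ z in (0 : ℝ)..x, (φ z - φ (gridMid h z))‖ ≤ (K * L ^ 2 * x + K * L) * h ^ 2 := by
  have hInt : ∀ x y : ℝ, 0 ≤ x → x ≤ y →
      IntervalIntegrable (fun z => φ z - φ (gridMid h z)) volume x y := fun x y h1 h2 =>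
    (hφ.intervalIntegrable_comp measurable_id (fun x hx => hx) h1 h2).sub
      (hφ.intervalIntegrable_comp (measurable_gridMid h) (fun x _ => gridMid_pos hh x) h1 h2)
  have hKL : 0 ≤ K * L ∧ 0 ≤ K * L ^ 2 := by
    obtain ⟨φ', φ'', hφ⟩ := hφ
    exact ⟨(norm_nonneg _).trans (hφ 1 one_pos).2.2.2.1,
      (norm_nonneg _).trans (hφ 1 one_pos).2.2.2.2⟩
  have hgrid : ∀ i : ℕ, ‖∫ z in (0 : ℝ)..(i * h), (φ z - φ (gridMid h z))‖ ≤
      i * (K * L ^ 2 * h ^ 3) := by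
    intro i
    induction i with
    | zero => simp
    | succ i ih =>
      have h1 : (0 : ℝ) ≤ i * h := by positivity
      have h2 : (i : ℝ) * h ≤ (i + 1) * h := by nlinarith
      push_cast
      rw [← intervalIntegral.integral_add_adjacent_intervals (hInt 0 (i * h) le_rfl h1)
        (hInt (i * h) ((i + 1) * h) h1 h2)]
      refine (norm_add_le_of_le ih (hφ.norm_integral_cell_le hh i)).trans (le_of_eq ?_)
      ring
  set i := ⌊x / h⌋₊ with hi
  have h1 : (i : ℝ) * h ≤ x := (le_div_iff₀ hh).1 (Nat.floor_le (by positivity))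
  have h2 : x < (i + 1) * h := (div_lt_iff₀ hh).1 (Nat.lt_floor_add_one _)
  have h0 : (0 : ℝ) ≤ i * h := by positivity
  rw [← intervalIntegral.integral_add_adjacent_intervals (hInt 0 (i * h) le_rfl h0)
    (hInt (i * h) x h0 h1)]
  have h3 : ‖∫ z in (i * h)..x, (φ z - φ (gridMid h z))‖ ≤ K * L * h * |x - i * h| := by
    apply intervalIntegral.norm_integral_le_of_norm_le_const
    intro z hz
    rw [Set.uIoc_of_le h1] at hz
    have hz0 : 0 < z := lt_of_le_of_lt h0 hz.1
    exact (hφ.norm_sub_le hz0 (gridMid_pos hh z)).trans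
      (mul_le_mul_of_nonneg_left (abs_sub_gridMid_le hh hz0.le) hKL.1)
  have h4 : |x - i * h| ≤ h := by rw [abs_of_nonneg (by linarith)]; linarith
  refine (norm_add_le_of_le (hgrid i) h3).trans ?_
  calc (i : ℝ) * (K * L ^ 2 * h ^ 3) + K * L * h * |x - i * h|
      ≤ K * L ^ 2 * (i * h) * h ^ 2 + K * L * h * h := by
        have := mul_le_mul_of_nonneg_left h4 (mul_nonneg hKL.1 hh.le)
        linarith
    _ ≤ K * L ^ 2 * x * h ^ 2 + K * L * h * h := by
        gcongr
        exact hKL.2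
    _ = _ := by ring

/-- Up to its endpoints an order-connected set is an interval, and its integral is a difference of
two integrals from `0`; hence the factor `2`. -/
theorem C2Bound.norm_setIntegral_le [CompleteSpace F] {φ : ℝ → F} {K L h T : ℝ}
    (hφ : C2Bound φ K L) (hh : 0 < h) (hT : 0 ≤ T) {S : Set ℝ} (hS : S.OrdConnected)
    (hST : S ⊆ Set.Ioo 0 T) :
    ‖∫ z in S, (φ z - φ (gridMid h z))‖ ≤ 2 * (K * L ^ 2 * T + K * L) * h ^ 2 := by
  have hKL : 0 ≤ K * L ∧ 0 ≤ K * L ^ 2 := by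
    obtain ⟨φ', φ'', hφ⟩ := hφ
    exact ⟨(norm_nonneg _).trans (hφ 1 one_pos).2.2.2.1,
      (norm_nonneg _).trans (hφ 1 one_pos).2.2.2.2⟩
  rcases S.eq_empty_or_nonempty with rfl | hne
  · simp only [Measure.restrict_empty, integral_zero_measure, norm_zero]
    have := hKL.1; have := hKL.2
    positivity
  have hbb : BddBelow S := ⟨0, fun z hz => (hST hz).1.le⟩
  have hba : BddAbove S := ⟨T, fun z hz => (hST hz).2.le⟩
  set α := sInf S
  set β := sSup S
  have hα : 0 ≤ α := le_csInf hne fun z hz => (hST hz).1.le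
  have hβ : β ≤ T := csSup_le hne fun z hz => (hST hz).2.le
  have hαβ : α ≤ β := csInf_le_csSup hne hbb hba
  have h1 : S ⊆ Set.Icc α β := fun z hz => ⟨csInf_le hbb hz, le_csSup hba hz⟩
  have h2 : Set.Ioo α β ⊆ S := by
    intro z hz
    obtain ⟨u, hu, huz⟩ := exists_lt_of_csInf_lt hne hz.1
    obtain ⟨v, hv, hvz⟩ := exists_lt_of_lt_csSup hne hz.2
    exact hS.out hu hv ⟨huz.le, hvz.le⟩
  have h3 : S =ᵐ[volume] Set.Ioc α β := by
    refine Filter.EventuallyLE.antisymm ?_ ?_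
    · exact (LE.le.eventuallyLE h1).trans Ioc_ae_eq_Icc.symm.le
    · exact Ioo_ae_eq_Ioc.symm.le.trans (LE.le.eventuallyLE h2)
  have hInt : ∀ y : ℝ, 0 ≤ y →
      IntervalIntegrable (fun z => φ z - φ (gridMid h z)) volume 0 y := fun y h2 =>
    (hφ.intervalIntegrable_comp measurable_id (fun x hx => hx) le_rfl h2).sub
      (hφ.intervalIntegrable_comp (measurable_gridMid h) (fun x _ => gridMid_pos hh x) le_rfl h2)
  rw [setIntegral_congr_set h3, ← intervalIntegral.integral_of_le hαβ,
    ← intervalIntegral.integral_interval_sub_left (hInt β (hα.trans hαβ)) (hInt α hα)]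
  refine (norm_sub_le_of_le (hφ.norm_integral_zero_le hh (hα.trans hαβ))
    (hφ.norm_integral_zero_le hh hα)).trans ?_
  have h5 : (K * L ^ 2 * β + K * L) * h ^ 2 ≤ (K * L ^ 2 * T + K * L) * h ^ 2 := by
    have := hKL.2
    gcongr
  have h6 : (K * L ^ 2 * α + K * L) * h ^ 2 ≤ (K * L ^ 2 * T + K * L) * h ^ 2 := by
    have := hKL.2
    gcongr
    exact hαβ.trans hβ
  linarith

end OneVariable

/-! ### Integrals over time-ordered simplices -/

section Simplex

variable {F : Type*} [NormedAddCommGroup F] [NormedSpace ℝ F]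

theorem measurableSet_simplex (m : ℕ) (T : ℝ) : MeasurableSet (simplex m T) := by
  have h : simplex m T = (⋂ i : Fin m, ⋂ j : Fin m, {s | i < j → s i < s j}) ∩
      ⋂ i : Fin m, {s | s i ∈ Set.Ioo 0 T} := by
    ext s
    simp only [simplex, StrictMono, Set.mem_inter_iff, Set.mem_iInter, Set.mem_ofPred_eq]
  rw [h]
  refine MeasurableSet.inter (MeasurableSet.iInter fun i => MeasurableSet.iInter fun j => ?_)
    (MeasurableSet.iInter fun i => measurableSet_Ioo.preimage (measurable_pi_apply i))
  by_cases hij : i < j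
  · simpa [hij] using measurableSet_lt (measurable_pi_apply i) (measurable_pi_apply j)
  · simp [hij]

/-- The open cube `(0, T) ^ m`. -/
def cube (m : ℕ) (T : ℝ) : Set (Fin m → ℝ) := Set.univ.pi fun _ => Set.Ioo 0 T

theorem simplex_subset_cube (m : ℕ) (T : ℝ) : simplex m T ⊆ cube m T :=
  fun _ hs i _ => hs.2 i

theorem volume_cube (m : ℕ) {T : ℝ} : volume (cube m T) = ENNReal.ofReal T ^ m := by
  simp [cube, Real.volume_pi_Ioo]

/-- The exceptional set is a finite union of hyperplanes `s i = s j`. -/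
theorem ae_injective (m : ℕ) : ∀ᵐ s : Fin m → ℝ, Function.Injective s := by
  have h : ∀ i j : Fin m, i ≠ j → ∀ᵐ s : Fin m → ℝ, s i ≠ s j := by
    intro i j hij
    let p : Submodule ℝ (Fin m → ℝ) :=
      LinearMap.ker (LinearMap.proj (R := ℝ) (φ := fun _ : Fin m => ℝ) i - LinearMap.proj j)
    have hp : p ≠ ⊤ := by
      intro h
      have : (Pi.single i 1 : Fin m → ℝ) ∈ p := h ▸ Submodule.mem_top
      simp [p, LinearMap.mem_ker, hij.symm] at this
    have h0 := Measure.addHaar_submodule volume p hp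
    rw [ae_iff]
    convert h0 using 2
    ext s
    simp [p, LinearMap.mem_ker, sub_eq_zero]
  have h' : ∀ᵐ s : Fin m → ℝ, ∀ i j : Fin m, i ≠ j → s i ≠ s j := by
    simp only [ae_all_iff]
    exact h
  filter_upwards [h'] with s hs i j hij
  by_contra hne
  exact hs i j hne hij

theorem cube_ae_eq (m : ℕ) (T : ℝ) :
    cube m T =ᵐ[volume] ⋃ σ : Equiv.Perm (Fin m), {s : Fin m → ℝ | s ∘ σ ∈ simplex m T} := by
  filter_upwards [ae_injective m] with s hs
  apply propext
  change s ∈ cube m T ↔ s ∈ ⋃ σ : Equiv.Perm (Fin m), {s : Fin m → ℝ | s ∘ σ ∈ simplex m T}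
  rw [Set.mem_iUnion]
  constructor
  · intro h
    exact ⟨Tuple.sort s, (Tuple.monotone_sort s).strictMono_of_injective
      (hs.comp (Tuple.sort s).injective), fun i => h _ (Set.mem_univ _)⟩
  · rintro ⟨σ, hσ⟩ i _
    simpa using hσ.2 (σ.symm i)

theorem measurePreserving_comp_perm {m : ℕ} (σ : Equiv.Perm (Fin m)) :
    MeasurePreserving (MeasurableEquiv.piCongrLeft (fun _ : Fin m => ℝ) σ.symm) volume volume :=
  volume_measurePreserving_piCongrLeft (fun _ : Fin m => ℝ) σ.symm

theorem piCongrLeft_symm_eq {m : ℕ} (σ : Equiv.Perm (Fin m)) (s : Fin m → ℝ) :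
    MeasurableEquiv.piCongrLeft (fun _ : Fin m => ℝ) σ.symm s = s ∘ σ := by
  funext i
  have := Equiv.piCongrLeft_apply_apply (fun _ : Fin m => ℝ) σ.symm s (σ i)
  simpa [MeasurableEquiv.coe_piCongrLeft] using this

/-- Sorting splits the cube, up to a null set, into `m!` disjoint permuted simplices, over which a
symmetric function has equal integrals. -/
theorem setIntegral_cube {m : ℕ} {T : ℝ} {g : (Fin m → ℝ) → F}
    (hg : ∀ (σ : Equiv.Perm (Fin m)) s, g (s ∘ σ) = g s) (hInt : IntegrableOn g (cube m T)) :
    ∫ s in cube m T, g s = (m.factorial : ℝ) • ∫ s in simplex m T, g s := by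
  have hmeas : ∀ σ : Equiv.Perm (Fin m),
      MeasurableSet {s : Fin m → ℝ | s ∘ σ ∈ simplex m T} := fun σ =>
    (measurableSet_simplex m T).preimage (measurable_pi_lambda _ fun i => measurable_pi_apply _)
  rw [setIntegral_congr_set (cube_ae_eq m T), integral_iUnion_fintype hmeas]
  · have h1 : ∀ σ : Equiv.Perm (Fin m), ∫ s in {s : Fin m → ℝ | s ∘ σ ∈ simplex m T}, g s =
        ∫ s in simplex m T, g s := by
      intro σ
      have h2 := (measurePreserving_comp_perm σ).setIntegral_preimage_emb
        (MeasurableEquiv.measurableEmbedding _) g (simplex m T)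
      simp only [piCongrLeft_symm_eq, hg] at h2
      rw [← h2]
      congr 2
      ext s
      simp [piCongrLeft_symm_eq]
    simp only [h1, Finset.sum_const, Finset.card_univ, Fintype.card_perm, Fintype.card_fin]
    rw [← Nat.cast_smul_eq_nsmul ℝ]
  · intro σ τ hστ
    refine Set.disjoint_left.2 fun s hs hs' => hστ ?_
    have h1 : s ∘ σ = s ∘ τ := by
      refine (StrictMono.range_inj hs.1 hs'.1).1 ?_
      rw [σ.surjective.range_comp, τ.surjective.range_comp]
    have hinj : Function.Injective s := by
      have := hs.1.injective.comp σ.symm.injective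
      rwa [Function.comp_assoc, Equiv.self_comp_symm, Function.comp_id] at this
    ext1 i
    exact hinj (congrFun h1 i)
  · intro σ
    refine hInt.mono_set fun s hs i _ => ?_
    simpa using hs.2 (σ.symm i)

theorem volume_simplex (m : ℕ) {T : ℝ} (hT : 0 ≤ T) :
    volume.real (simplex m T) = T ^ m / m.factorial := by
  have h := setIntegral_cube (m := m) (T := T) (g := fun _ => (1 : ℝ)) (fun _ _ => rfl) (by
    rw [integrableOn_const_iff, volume_cube]
    right; exact ENNReal.pow_lt_top ENNReal.ofReal_lt_top)
  simp only [setIntegral_const, smul_eq_mul, mul_one] at h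
  rw [measureReal_def, volume_cube, ENNReal.toReal_pow, ENNReal.toReal_ofReal hT] at h
  rw [h]
  field_simp

theorem volume_simplex_lt_top (m : ℕ) (T : ℝ) : volume (simplex m T) < ⊤ :=
  (measure_mono (simplex_subset_cube m T)).trans_lt
    (by rw [volume_cube]; exact ENNReal.pow_lt_top ENNReal.ofReal_lt_top)

/-! ### Functions that are constant on the cells of the grid -/

theorem prod_single {κ M : Type*} [AddCommMonoid M] (s : Finset κ) (y : κ → M) :
    ∏ i ∈ s, (AddMonoidAlgebra.single (y i) 1 : AddMonoidAlgebra ℝ M) =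
      AddMonoidAlgebra.single (∑ i ∈ s, y i) 1 := by
  classical
  induction s using Finset.induction_on with
  | empty => rfl
  | insert i s hi ih =>
    rw [Finset.prod_insert hi, Finset.sum_insert hi, ih, AddMonoidAlgebra.single_mul_single,
      one_mul]

/-- This is the multinomial theorem in the monoid algebra of `M`, where a word becomes the basis
vector at its sum. The linear functional `ℓ` extending `G` carries it over to `F`. -/
theorem sum_words {ι M : Type*} [Fintype ι] [DecidableEq ι] [AddCommMonoid M] (m : ℕ)
    (x : ι → M) (G : M → F) :
    ∑ c : Fin m → ι, G (∑ i, x (c i)) = ∑ k ∈ Finset.univ.piAntidiag m,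
      (Nat.multinomial Finset.univ k : ℝ) • G (∑ l, k l • x l) := by
  let X : ι → AddMonoidAlgebra ℝ M := fun l => AddMonoidAlgebra.single (x l) 1
  have h1 : ∀ c : Fin m → ι, ∏ i, X (c i) = AddMonoidAlgebra.single (∑ i, x (c i)) 1 :=
    fun c => prod_single _ _
  have h2 : ∀ k : ι → ℕ, ∏ l, X l ^ k l = AddMonoidAlgebra.single (∑ l, k l • x l) 1 := by
    intro k
    simp only [X, AddMonoidAlgebra.single_pow, one_pow]
    exact prod_single _ _
  have h := (Fintype.sum_pow X m).symm.trans (Finset.sum_pow_eq_sum_piAntidiag Finset.univ X m)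
  simp only [h1, h2] at h
  let ℓ : AddMonoidAlgebra ℝ M →ₗ[ℝ] F :=
    (Finsupp.linearCombination ℝ G).comp (AddMonoidAlgebra.coeffLinearEquiv ℝ).toLinearMap
  have hℓ : ∀ y : M, ℓ (AddMonoidAlgebra.single y 1) = G y := by
    intro y
    simp [ℓ]
  have h3 := congrArg ℓ h
  simp only [map_sum, hℓ, ← nsmul_eq_mul, map_nsmul] at h3
  rw [h3]
  simp only [Nat.cast_smul_eq_nsmul]

/-- The cell of the grid of `(0, n * h) ^ m` with index `c`. -/
def gridCell (h : ℝ) {m n : ℕ} (c : Fin m → Fin n) : Set (Fin m → ℝ) :=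
  Set.univ.pi fun i => Set.Ico ((c i : ℕ) * h) (((c i : ℕ) + 1) * h)

theorem cube_ae_eq_iUnion_gridCell {h : ℝ} (hh : 0 < h) (m n : ℕ) :
    cube m (n * h) =ᵐ[volume] ⋃ c : Fin m → Fin n, gridCell h c := by
  have h1 : ⋃ c : Fin m → Fin n, gridCell h c = Set.univ.pi fun _ => Set.Ico (0 : ℝ) (n * h) := by
    ext s
    simp only [gridCell, Set.mem_iUnion, Set.mem_pi, Set.mem_univ, true_implies, Set.mem_Ico]
    constructor
    · rintro ⟨c, hc⟩ i
      have h2 : ((c i : ℕ) : ℝ) + 1 ≤ n := by exact_mod_cast (c i).is_lt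
      refine ⟨le_trans (by positivity) (hc i).1, lt_of_lt_of_le (hc i).2 ?_⟩
      gcongr
    · intro hs
      have h2 : ∀ i, ⌊s i / h⌋₊ < n := by
        intro i
        have h3 : (⌊s i / h⌋₊ : ℝ) * h ≤ s i :=
          (le_div_iff₀ hh).1 (Nat.floor_le (div_nonneg (hs i).1 hh.le))
        have h4 : (⌊s i / h⌋₊ : ℝ) < n := by
          by_contra hcon
          nlinarith [(hs i).2]
        exact_mod_cast h4
      exact ⟨fun i => ⟨⌊s i / h⌋₊, h2 i⟩, fun i =>
        ⟨(le_div_iff₀ hh).1 (Nat.floor_le (div_nonneg (hs i).1 hh.le)),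
          (div_lt_iff₀ hh).1 (Nat.lt_floor_add_one _)⟩⟩
  rw [h1]
  exact Measure.univ_pi_Ioo_ae_eq_Icc.trans Measure.univ_pi_Ico_ae_eq_Icc.symm

theorem measurableSet_gridCell (h : ℝ) {m n : ℕ} (c : Fin m → Fin n) :
    MeasurableSet (gridCell h c) :=
  MeasurableSet.univ_pi fun _ => measurableSet_Ico

theorem volume_gridCell {h : ℝ} (hh : 0 < h) {m n : ℕ} (c : Fin m → Fin n) :
    volume (gridCell h c) = ENNReal.ofReal (h ^ m) := by
  rw [gridCell, Real.volume_pi_Ico]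
  simp only [add_mul, one_mul, add_sub_cancel_left, Finset.prod_const, Finset.card_univ,
    Fintype.card_fin]
  rw [ENNReal.ofReal_pow hh.le]

theorem disjoint_gridCell {h : ℝ} (hh : 0 < h) {m n : ℕ} :
    Pairwise (Function.onFun Disjoint (gridCell (m := m) (n := n) h)) := by
  intro c c' hcc
  refine Set.disjoint_left.2 fun s hs hs' => hcc ?_
  funext i
  have h1 := gridMid_eq hh (hs i (Set.mem_univ _)).1 (hs i (Set.mem_univ _)).2
  have h2 := gridMid_eq hh (hs' i (Set.mem_univ _)).1 (hs' i (Set.mem_univ _)).2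
  rw [h1, midR, midR] at h2
  have h3 := mul_right_cancel₀ hh.ne' h2
  have h4 : ((c i : ℕ) : ℝ) = (c' i : ℕ) := by linarith
  exact Fin.ext (by exact_mod_cast h4)

/-- On the symmetrised cube the integrand is constant on grid cells. The multinomial number of cells
with occupation `k`, divided by the `m!` of the symmetrisation, leaves `1 / ∏ (k i)!`. -/
theorem setIntegral_simplex_gridMid [CompleteSpace F] {h : ℝ} (hh : 0 < h) (m n : ℕ)
    (G : Multiset ℝ → F) :
    ∫ s in simplex m (n * h), G (∑ i, {gridMid h (s i)}) =
      ∑ k ∈ (Finset.univ : Finset (Fin n)).piAntidiag m,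
        (∏ i, h ^ k i / ((k i).factorial : ℝ)) • G (∑ i, k i • {midR h i}) := by
  have hconst : ∀ c : Fin m → Fin n, ∀ s ∈ gridCell h c,
      G (∑ i, {gridMid h (s i)}) = G (∑ i, {midR h (c i)}) := by
    intro c s hs
    congr 1
    refine Finset.sum_congr rfl fun i _ => ?_
    rw [gridMid_eq hh (hs i (Set.mem_univ _)).1 (hs i (Set.mem_univ _)).2]
  have hInt : ∀ c : Fin m → Fin n,
      IntegrableOn (fun s : Fin m → ℝ => G (∑ i, {gridMid h (s i)})) (gridCell h c) := by
    intro c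
    refine IntegrableOn.congr_fun (f := fun _ => G (∑ i, {midR h (c i)})) ?_
      (fun s hs => (hconst c s hs).symm) (measurableSet_gridCell h c)
    rw [integrableOn_const_iff, volume_gridCell hh]
    right; exact ENNReal.ofReal_lt_top
  have hcube : IntegrableOn (fun s : Fin m → ℝ => G (∑ i, {gridMid h (s i)}))
      (cube m (n * h)) := by
    rw [integrableOn_congr_set_ae (cube_ae_eq_iUnion_gridCell hh m n),
      integrableOn_finite_iUnion]
    exact hInt
  have hsym := setIntegral_cube (g := fun s : Fin m → ℝ => G (∑ i, {gridMid h (s i)}))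
    (fun σ s => by
      have := Equiv.sum_comp σ fun i => ({gridMid h (s i)} : Multiset ℝ)
      exact congrArg G this) hcube
  have hcells : ∫ s in cube m (n * h), G (∑ i, {gridMid h (s i)}) =
      h ^ m • ∑ c : Fin m → Fin n, G (∑ i, {midR h (c i)}) := by
    rw [setIntegral_congr_set (cube_ae_eq_iUnion_gridCell hh m n),
      integral_iUnion_fintype (measurableSet_gridCell h) (disjoint_gridCell hh) hInt,
      Finset.smul_sum]
    refine Finset.sum_congr rfl fun c _ => ?_
    rw [setIntegral_congr_fun (measurableSet_gridCell h c) (hconst c), setIntegral_const,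
      measureReal_def, volume_gridCell hh, ENNReal.toReal_ofReal (by positivity)]
  have hm : (m.factorial : ℝ) ≠ 0 := by positivity
  have hfin : ∫ s in simplex m (n * h), G (∑ i, {gridMid h (s i)}) =
      (m.factorial : ℝ)⁻¹ • h ^ m • ∑ c : Fin m → Fin n, G (∑ i, {midR h (c i)}) := by
    rw [← hcells, hsym, smul_smul, inv_mul_cancel₀ hm, one_smul]
  rw [hfin, sum_words m (fun l : Fin n => ({midR h l} : Multiset ℝ)) G, Finset.smul_sum,
    Finset.smul_sum]
  refine Finset.sum_congr rfl fun k hk => ?_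
  rw [smul_smul, smul_smul]
  congr 1
  rw [Finset.mem_piAntidiag] at hk
  have h1 := Nat.multinomial_spec Finset.univ k
  rw [hk.1] at h1
  have h2 : ((∏ i, (k i).factorial : ℕ) : ℝ) ≠ 0 := by
    exact_mod_cast (Finset.prod_pos fun i _ => Nat.factorial_pos _).ne'
  rw [Finset.prod_div_distrib, Finset.prod_pow_eq_pow_sum, hk.1, ← Nat.cast_prod, ← h1]
  push_cast at h2 ⊢
  have h3 : (Nat.multinomial Finset.univ k : ℝ) ≠ 0 := by
    exact_mod_cast (Nat.multinomial_pos _ _).ne'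
  field_simp

end Simplex

/-! ### The midpoint rule on time-ordered simplices -/

section SimplexMidpoint

variable {F : Type*} [NormedAddCommGroup F] [NormedSpace ℝ F]

/-- The open positive orthant. -/
def orthant (m : ℕ) : Set (Fin m → ℝ) := {s | ∀ i, 0 < s i}

theorem measurableSet_orthant (m : ℕ) : MeasurableSet (orthant m) := by
  have h : orthant m = Set.univ.pi fun _ => Set.Ioi 0 := by ext s; simp [orthant]
  rw [h]
  exact MeasurableSet.univ_pi fun _ => measurableSet_Ioi

theorem simplex_subset_orthant (m : ℕ) (T : ℝ) : simplex m T ⊆ orthant m :=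
  fun _ hs i => (hs.2 i).1

/-- The point whose first `i` coordinates are those of `s`, moved to the midpoints of the grid. -/
def partialGrid (h : ℝ) {m : ℕ} (i : ℕ) (s : Fin m → ℝ) : Fin m → ℝ :=
  fun j => if (j : ℕ) < i then gridMid h (s j) else s j

theorem partialGrid_mem_orthant {h : ℝ} (hh : 0 < h) {m : ℕ} (i : ℕ) {s : Fin m → ℝ}
    (hs : s ∈ orthant m) : partialGrid h i s ∈ orthant m := by
  intro j
  unfold partialGrid
  split_ifs
  · exact gridMid_pos hh _
  · exact hs j

theorem measurable_partialGrid (h : ℝ) {m : ℕ} (i : ℕ) :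
    Measurable (partialGrid h i : (Fin m → ℝ) → Fin m → ℝ) := by
  refine measurable_pi_lambda _ fun j => ?_
  unfold partialGrid
  split_ifs
  · exact (measurable_gridMid h).comp (measurable_pi_apply j)
  · exact measurable_pi_apply j

theorem integrableOn_simplex_comp {m : ℕ} {T K : ℝ} {f : (Fin m → ℝ) → F}
    (hf : ContinuousOn f (orthant m)) (hK : ∀ s ∈ orthant m, ‖f s‖ ≤ K)
    {g : (Fin m → ℝ) → Fin m → ℝ} (hg : Measurable g)
    (hgo : ∀ s ∈ orthant m, g s ∈ orthant m) :
    IntegrableOn (fun s => f (g s)) (simplex m T) := by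
  refine IntegrableOn.of_bound (volume_simplex_lt_top m T)
    (aestronglyMeasurable_comp_of_continuousOn hf (measurableSet_orthant m) hg
      (measurableSet_simplex m T) fun s hs => hgo s (simplex_subset_orthant m T hs)) K ?_
  filter_upwards [ae_restrict_mem (measurableSet_simplex m T)] with s hs
  exact hK _ (hgo s (simplex_subset_orthant m T hs))

/-- A moving coordinate is constrained only by its neighbours and by the ends of `(0, T)`. -/
theorem ordConnected_section {m : ℕ} (i : Fin (m + 1)) (s : Fin m → ℝ) (T : ℝ) :
    {x | i.insertNth x s ∈ simplex (m + 1) T}.OrdConnected := by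
  refine ⟨fun x hx y hy z hz => ⟨?_, ?_⟩⟩
  · intro j k hjk
    rcases Fin.eq_self_or_eq_succAbove i j with rfl | ⟨j', rfl⟩
    · rcases Fin.eq_self_or_eq_succAbove j k with rfl | ⟨k', rfl⟩
      · exact absurd hjk (lt_irrefl _)
      · have := hy.1 hjk
        rw [Fin.insertNth_apply_same, Fin.insertNth_apply_succAbove] at this ⊢
        exact hz.2.trans_lt this
    · rcases Fin.eq_self_or_eq_succAbove i k with rfl | ⟨k', rfl⟩
      · have := hx.1 hjk
        rw [Fin.insertNth_apply_same, Fin.insertNth_apply_succAbove] at this ⊢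
        exact this.trans_le hz.1
      · have := hx.1 hjk
        rwa [Fin.insertNth_apply_succAbove, Fin.insertNth_apply_succAbove] at this ⊢
  · intro j
    rcases Fin.eq_self_or_eq_succAbove i j with rfl | ⟨j', rfl⟩
    · have h1 := hx.2 j
      have h2 := hy.2 j
      rw [Fin.insertNth_apply_same] at h1 h2 ⊢
      exact ⟨h1.1.trans_le hz.1, hz.2.trans_lt h2.2⟩
    · have h1 := hx.2 (i.succAbove j')
      rwa [Fin.insertNth_apply_succAbove] at h1 ⊢

theorem mem_simplex_of_insertNth {m : ℕ} {i : Fin (m + 1)} {s : Fin m → ℝ} {T x : ℝ}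
    (h : i.insertNth x s ∈ simplex (m + 1) T) : s ∈ simplex m T ∧ x ∈ Set.Ioo 0 T := by
  refine ⟨⟨fun j k hjk => ?_, fun j => ?_⟩, ?_⟩
  · have := h.1 (Fin.succAbove_lt_succAbove_iff (p := i) |>.2 hjk)
    rwa [Fin.insertNth_apply_succAbove, Fin.insertNth_apply_succAbove] at this
  · have := h.2 (i.succAbove j)
    rwa [Fin.insertNth_apply_succAbove] at this
  · have := h.2 i
    rwa [Fin.insertNth_apply_same] at this

/-- Fubini isolates coordinate `i`; the other coordinates, some already on the grid, are frozen and
the one-variable estimate applies on each line. Lines meeting the simplex are indexed by a simplex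
of dimension `m`. Partly gridded points need not be ordered, so `f` must be controlled on the whole
orthant. -/
theorem norm_setIntegral_coordinate_le [CompleteSpace F] {m : ℕ} {T K L M h : ℝ} (hh : 0 < h)
    (hT : 0 ≤ T) {f : (Fin (m + 1) → ℝ) → F} (hf : ContinuousOn f (orthant (m + 1)))
    (hM : ∀ s ∈ orthant (m + 1), ‖f s‖ ≤ M)
    (hC : ∀ i, ∀ s ∈ orthant (m + 1), C2Bound (fun x => f (Function.update s i x)) K L)
    (i : Fin (m + 1)) :
    ‖∫ s in simplex (m + 1) T, (f (partialGrid h i s) - f (partialGrid h (i + 1) s))‖ ≤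
      2 * (K * L ^ 2 * T + K * L) * h ^ 2 * (T ^ m / m.factorial) := by
  set u : (Fin (m + 1) → ℝ) → F := fun s => f (partialGrid h i s) - f (partialGrid h (i + 1) s)
  set S := simplex (m + 1) T with hS
  have hSm : MeasurableSet S := measurableSet_simplex _ _
  have hu : IntegrableOn u S :=
    (integrableOn_simplex_comp hf hM (measurable_partialGrid h i)
      fun s hs => partialGrid_mem_orthant hh i hs).sub
    (integrableOn_simplex_comp hf hM (measurable_partialGrid h (i + 1))
      fun s hs => partialGrid_mem_orthant hh (i + 1) hs)
  let e := MeasurableEquiv.piFinSuccAbove (fun _ : Fin (m + 1) => ℝ) i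
  have he : MeasurePreserving e.symm volume volume :=
    (volume_preserving_piFinSuccAbove (fun _ : Fin (m + 1) => ℝ) i).symm e
  have hes : ∀ p : ℝ × (Fin m → ℝ), e.symm p = i.insertNth p.1 p.2 := fun p => rfl
  have hInt : Integrable (fun p : ℝ × (Fin m → ℝ) => S.indicator u (i.insertNth p.1 p.2))
      (volume.prod volume) := by
    have := (he.integrable_comp_emb e.symm.measurableEmbedding).2
      ((integrable_indicator_iff hSm).2 hu)
    exact this
  have h1 : ∫ s in S, u s =
      ∫ s' : Fin m → ℝ, ∫ x : ℝ, S.indicator u (i.insertNth x s') := by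
    rw [← integral_indicator hSm, ← he.integral_comp e.symm.measurableEmbedding]
    exact integral_prod_symm _ hInt
  rw [h1]
  set κ := 2 * (K * L ^ 2 * T + K * L) * h ^ 2
  have hbound : ∀ s' : Fin m → ℝ, ‖∫ x : ℝ, S.indicator u (i.insertNth x s')‖ ≤
      (simplex m T).indicator (fun _ => κ) s' := by
    intro s'
    by_cases hs' : s' ∈ simplex m T
    · rw [Set.indicator_of_mem hs']
      let hyb : Fin m → ℝ := fun j =>
        if ((i.succAbove j : Fin (m + 1)) : ℕ) < i then gridMid h (s' j) else s' j
      have hyb_pos : ∀ j, 0 < hyb j := by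
        intro j
        simp only [hyb]
        split_ifs
        · exact gridMid_pos hh _
        · exact (hs'.2 j).1
      have hφ : C2Bound (fun x => f (i.insertNth x hyb)) K L := by
        have h2 := hC i (i.insertNth 1 hyb) (fun j => by
          rcases Fin.eq_self_or_eq_succAbove i j with rfl | ⟨j', rfl⟩
          · rw [Fin.insertNth_apply_same]; exact one_pos
          · rw [Fin.insertNth_apply_succAbove]; exact hyb_pos j')
        simpa only [Fin.update_insertNth] using h2
      have h3 : ∀ x, partialGrid h i (i.insertNth x s' : Fin (m + 1) → ℝ) =
          i.insertNth x hyb := by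
        intro x
        funext j
        rcases Fin.eq_self_or_eq_succAbove i j with rfl | ⟨j', rfl⟩
        · simp [partialGrid]
        · simp [partialGrid, hyb]
      have h4 : ∀ x, partialGrid h (i + 1) (i.insertNth x s' : Fin (m + 1) → ℝ) =
          i.insertNth (gridMid h x) hyb := by
        intro x
        funext j
        rcases Fin.eq_self_or_eq_succAbove i j with rfl | ⟨j', rfl⟩
        · simp [partialGrid]
        · have h5 : ((i.succAbove j' : Fin (m + 1)) : ℕ) < i + 1 ↔
              ((i.succAbove j' : Fin (m + 1)) : ℕ) < i := by
            have : ((i.succAbove j' : Fin (m + 1)) : ℕ) ≠ i :=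
              fun h => Fin.succAbove_ne i j' (Fin.ext h)
            omega
          simp only [partialGrid, Fin.insertNth_apply_succAbove, hyb, h5]
      have h6 : (fun x => S.indicator u (i.insertNth x s')) =
          {x | i.insertNth x s' ∈ S}.indicator
            (fun x => f (i.insertNth x hyb) - f (i.insertNth (gridMid h x) hyb)) := by
        funext x
        by_cases hx : i.insertNth x s' ∈ S
        · rw [Set.indicator_of_mem hx, Set.indicator_of_mem (by exact hx)]
          simp only [u, h3, h4]
        · rw [Set.indicator_of_notMem hx, Set.indicator_of_notMem (by exact hx)]
      have hmeas : MeasurableSet {x | i.insertNth x s' ∈ S} :=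
        (ordConnected_section i s' T).measurableSet
      rw [h6, integral_indicator hmeas]
      exact hφ.norm_setIntegral_le hh hT (ordConnected_section i s' T)
        fun x hx => (mem_simplex_of_insertNth hx).2
    · rw [Set.indicator_of_notMem hs']
      have h2 : ∀ x, S.indicator u (i.insertNth x s') = 0 := fun x =>
        Set.indicator_of_notMem (fun hx => hs' (mem_simplex_of_insertNth hx).1) _
      simp [h2]
  refine (norm_integral_le_of_norm_le ?_ (Filter.Eventually.of_forall hbound)).trans ?_
  · rw [integrable_indicator_iff (measurableSet_simplex m T), integrableOn_const_iff]
    exact Or.inr (volume_simplex_lt_top m T)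
  · rw [integral_indicator (measurableSet_simplex m T), setIntegral_const, volume_simplex m hT,
      smul_eq_mul, mul_comm]

/-- Coordinates are moved to the grid one by one and the differences telescope. For `m = 0` the
leading factor makes the truncated `m - 1` harmless. -/
theorem norm_setIntegral_simplex_sub_le [CompleteSpace F] {m : ℕ} {T K L M h : ℝ} (hh : 0 < h)
    (hT : 0 ≤ T) {f : (Fin m → ℝ) → F} (hf : ContinuousOn f (orthant m))
    (hM : ∀ s ∈ orthant m, ‖f s‖ ≤ M)
    (hC : ∀ i, ∀ s ∈ orthant m, C2Bound (fun x => f (Function.update s i x)) K L) :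
    ‖(∫ s in simplex m T, f s) - ∫ s in simplex m T, f (fun i => gridMid h (s i))‖ ≤
      m * (2 * (K * L ^ 2 * T + K * L) * h ^ 2 * (T ^ (m - 1) / (m - 1).factorial)) := by
  have h0 : ∀ s : Fin m → ℝ, partialGrid h 0 s = s := fun s => by
    funext i; simp [partialGrid]
  have hm : ∀ s : Fin m → ℝ, partialGrid h m s = fun i => gridMid h (s i) := fun s => by
    funext i; simp [partialGrid]
  have hInt : ∀ i, IntegrableOn (fun s => f (partialGrid h i s)) (simplex m T) := fun i =>
    integrableOn_simplex_comp hf hM (measurable_partialGrid h i)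
      fun s hs => partialGrid_mem_orthant hh i hs
  have h1 := Finset.sum_range_sub' (fun i => ∫ s in simplex m T, f (partialGrid h i s)) m
  simp only [h0, hm] at h1
  rw [← h1]
  refine (norm_sum_le_of_le _ (fun i hi => ?_ : ∀ i ∈ Finset.range m, _ ≤
    2 * (K * L ^ 2 * T + K * L) * h ^ 2 * (T ^ (m - 1) / (m - 1).factorial))).trans
    (le_of_eq (by simp))
  rw [← integral_sub (hInt i) (hInt (i + 1))]
  rw [Finset.mem_range] at hi
  obtain ⟨m, rfl⟩ : ∃ m', m = m' + 1 := ⟨m - 1, by omega⟩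
  exact norm_setIntegral_coordinate_le hh hT hf hM hC ⟨i, hi⟩

end SimplexMidpoint

/-! ### Products of functions with bounded derivatives -/

section C2

variable {A : Type*} [NormedRing A] [NormedAlgebra ℝ A] {V : Type*} [NormedAddCommGroup V]
  [NormedSpace ℝ V]

theorem C2Bound.const {c : V} {K L : ℝ} (hc : ‖c‖ ≤ K) (hL : 0 ≤ L) :
    C2Bound (fun _ => c) K L := by
  have hK : 0 ≤ K := (norm_nonneg c).trans hc
  exact ⟨fun _ => 0, fun _ => 0, fun x _ => ⟨hasDerivAt_const _ _, hasDerivAt_const _ _, hc,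
    by rw [norm_zero]; positivity, by rw [norm_zero]; positivity⟩⟩

theorem C2Bound.congr {φ ψ : ℝ → V} {K L K' L' : ℝ} (h : C2Bound φ K L) (hφ : ∀ x, φ x = ψ x)
    (hK : K = K') (hL : L = L') : C2Bound ψ K' L' := by
  rw [← hK, ← hL, ← funext hφ]
  exact h

theorem C2Bound.nonneg {φ : ℝ → V} {K L : ℝ} (hφ : C2Bound φ K L) : 0 ≤ K := by
  obtain ⟨φ', φ'', h⟩ := hφ
  exact (norm_nonneg _).trans (h 1 one_pos).2.2.1

theorem C2Bound.mono {φ : ℝ → V} {K L K' L' : ℝ} (hφ : C2Bound φ K L) (hK : K ≤ K')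
    (hL0 : 0 ≤ L) (hL : L ≤ L') : C2Bound φ K' L' := by
  have hK0 := hφ.nonneg
  obtain ⟨φ', φ'', h⟩ := hφ
  refine ⟨φ', φ'', fun x hx => ⟨(h x hx).1, (h x hx).2.1, (h x hx).2.2.1.trans hK,
    (h x hx).2.2.2.1.trans ?_, (h x hx).2.2.2.2.trans ?_⟩⟩ <;> gcongr <;> linarith

/-- The pattern `K, K L, K L ^ 2` is stable under the Leibniz rule: the `K` multiply and the `L`
add, so long products cost only a polynomial factor in derivatives. -/
theorem leibniz_bound {K₁ L₁ K₂ L₂ a₀ a₁ a₂ c₀ c₁ c₂ : ℝ} (ha₀ : 0 ≤ a₀) (ha₁ : 0 ≤ a₁)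
    (ha₂ : 0 ≤ a₂) (hc₀ : 0 ≤ c₀) (hc₁ : 0 ≤ c₁) (hc₂ : 0 ≤ c₂) (h₀ : a₀ ≤ K₁) (h₁ : a₁ ≤ K₁ * L₁)
    (h₂ : a₂ ≤ K₁ * L₁ ^ 2) (k₀ : c₀ ≤ K₂) (k₁ : c₁ ≤ K₂ * L₂) (k₂ : c₂ ≤ K₂ * L₂ ^ 2) :
    a₀ * c₀ ≤ K₁ * K₂ ∧ a₁ * c₀ + a₀ * c₁ ≤ K₁ * K₂ * (L₁ + L₂) ∧
      a₂ * c₀ + a₁ * c₁ + (a₁ * c₁ + a₀ * c₂) ≤ K₁ * K₂ * (L₁ + L₂) ^ 2 := by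
  have e1 := mul_le_mul h₀ k₀ hc₀ (ha₀.trans h₀)
  have e2 := mul_le_mul h₁ k₀ hc₀ (ha₁.trans h₁)
  have e3 := mul_le_mul h₀ k₁ hc₁ (ha₀.trans h₀)
  have e4 := mul_le_mul h₂ k₀ hc₀ (ha₂.trans h₂)
  have e5 := mul_le_mul h₁ k₁ hc₁ (ha₁.trans h₁)
  have e6 := mul_le_mul h₀ k₂ hc₂ (ha₀.trans h₀)
  refine ⟨e1, ?_, ?_⟩ <;> linarith

theorem C2Bound.mul {φ ψ : ℝ → A} {K₁ L₁ K₂ L₂ : ℝ} (hφ : C2Bound φ K₁ L₁)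
    (hψ : C2Bound ψ K₂ L₂) : C2Bound (fun x => φ x * ψ x) (K₁ * K₂) (L₁ + L₂) := by
  obtain ⟨φ', φ'', h⟩ := hφ
  obtain ⟨ψ', ψ'', k⟩ := hψ
  refine ⟨fun x => φ' x * ψ x + φ x * ψ' x,
    fun x => φ'' x * ψ x + φ' x * ψ' x + (φ' x * ψ' x + φ x * ψ'' x), fun x hx => ?_⟩
  obtain ⟨h1, h2, h3, h4, h5⟩ := h x hx
  obtain ⟨k1, k2, k3, k4, k5⟩ := k x hx
  obtain ⟨e1, e2, e3⟩ := leibniz_bound (norm_nonneg _) (norm_nonneg _) (norm_nonneg _)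
    (norm_nonneg _) (norm_nonneg _) (norm_nonneg _) h3 h4 h5 k3 k4 k5
  refine ⟨h1.mul k1, (h2.mul k1).add (h1.mul k2), (norm_mul_le _ _).trans e1, ?_, ?_⟩
  · exact (norm_add_le_of_le (norm_mul_le _ _) (norm_mul_le _ _)).trans e2
  · exact (norm_add_le_of_le (norm_add_le_of_le (norm_mul_le _ _) (norm_mul_le _ _))
      (norm_add_le_of_le (norm_mul_le _ _) (norm_mul_le _ _))).trans e3

theorem C2Bound.smul [NormedSpace ℂ V] [IsScalarTower ℝ ℂ V] {φ : ℝ → ℂ} {ψ : ℝ → V}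
    {K₁ L₁ K₂ L₂ : ℝ} (hφ : C2Bound φ K₁ L₁) (hψ : C2Bound ψ K₂ L₂) :
    C2Bound (fun x => φ x • ψ x) (K₁ * K₂) (L₁ + L₂) := by
  obtain ⟨φ', φ'', h⟩ := hφ
  obtain ⟨ψ', ψ'', k⟩ := hψ
  refine ⟨fun x => φ' x • ψ x + φ x • ψ' x,
    fun x => φ'' x • ψ x + φ' x • ψ' x + (φ' x • ψ' x + φ x • ψ'' x), fun x hx => ?_⟩
  obtain ⟨h1, h2, h3, h4, h5⟩ := h x hx
  obtain ⟨k1, k2, k3, k4, k5⟩ := k x hx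
  obtain ⟨e1, e2, e3⟩ := leibniz_bound (norm_nonneg _) (norm_nonneg _) (norm_nonneg _)
    (norm_nonneg _) (norm_nonneg _) (norm_nonneg _) h3 h4 h5 k3 k4 k5
  refine ⟨?_, ?_, (norm_smul_le _ _).trans e1, ?_, ?_⟩
  · simpa only [add_comm] using h1.fun_smul k1
  · refine ((h2.fun_smul k1).fun_add (h1.fun_smul k2)).congr_deriv ?_
    simp only [add_comm]
  · exact (norm_add_le_of_le (norm_smul_le _ _) (norm_smul_le _ _)).trans e2
  · exact (norm_add_le_of_le (norm_add_le_of_le (norm_smul_le _ _) (norm_smul_le _ _))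
      (norm_add_le_of_le (norm_smul_le _ _) (norm_smul_le _ _))).trans e3

theorem C2Bound.add {φ ψ : ℝ → V} {K₁ K₂ L : ℝ} (hφ : C2Bound φ K₁ L) (hψ : C2Bound ψ K₂ L) :
    C2Bound (fun x => φ x + ψ x) (K₁ + K₂) L := by
  obtain ⟨φ', φ'', h⟩ := hφ
  obtain ⟨ψ', ψ'', k⟩ := hψ
  refine ⟨fun x => φ' x + ψ' x, fun x => φ'' x + ψ'' x, fun x hx => ?_⟩
  obtain ⟨h1, h2, h3, h4, h5⟩ := h x hx
  obtain ⟨k1, k2, k3, k4, k5⟩ := k x hx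
  refine ⟨h1.add k1, h2.add k2, norm_add_le_of_le h3 k3, ?_, ?_⟩
  · rw [add_mul]; exact norm_add_le_of_le h4 k4
  · rw [add_mul]; exact norm_add_le_of_le h5 k5

theorem C2Bound.finset_sum {ι : Type*} (s : Finset ι) {φ : ι → ℝ → V} {K L : ℝ} (hL : 0 ≤ L)
    (h : ∀ i ∈ s, C2Bound (φ i) K L) : C2Bound (fun x => ∑ i ∈ s, φ i x) (s.card * K) L := by
  classical
  induction s using Finset.induction_on with
  | empty => simpa using C2Bound.const (c := (0 : V)) (K := 0) (by simp) hL
  | insert i s hi ih =>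
    simp only [Finset.sum_insert hi, Finset.card_insert_of_notMem hi]
    have := (h i (Finset.mem_insert_self i s)).add
      (ih fun j hj => h j (Finset.mem_insert_of_mem hj))
    convert this using 1
    push_cast; ring

theorem C2Bound.finset_prod {ι : Type*} (s : Finset ι) {φ : ι → ℝ → ℂ} {K L : ℝ}
    (h : ∀ i ∈ s, C2Bound (φ i) K L) :
    C2Bound (fun x => ∏ i ∈ s, φ i x) (K ^ s.card) (s.card * L) := by
  classical
  induction s using Finset.induction_on with
  | empty => simpa using C2Bound.const (c := (1 : ℂ)) (K := 1) (L := 0) (by simp) le_rfl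
  | insert i s hi ih =>
    simp only [Finset.prod_insert hi, Finset.card_insert_of_notMem hi]
    have := (h i (Finset.mem_insert_self i s)).mul
      (ih fun j hj => h j (Finset.mem_insert_of_mem hj))
    exact this.congr (fun _ => rfl) (by ring) (by push_cast; ring)

theorem C2Bound.list_prod {ι : Type*} (l : List ι) {φ : ι → ℝ → A} {K L : ℝ}
    (h1 : ‖(1 : A)‖ ≤ 1) (h : ∀ i ∈ l, C2Bound (φ i) K L) :
    C2Bound (fun x => (l.map fun i => φ i x).prod) (K ^ l.length) (l.length * L) := by
  induction l with
  | nil => simpa using C2Bound.const (c := (1 : A)) (K := 1) (L := 0) h1 le_rfl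
  | cons i l ih =>
    simp only [List.map_cons, List.prod_cons, List.length_cons]
    have := (h i List.mem_cons_self).mul (ih fun j hj => h j (List.mem_cons_of_mem i hj))
    exact this.congr (fun _ => rfl) (by ring) (by push_cast; ring)

end C2

/-! ### Regularity of the Dyson integrand -/

section Regularity

variable {E : Type*} [NormedAddCommGroup E] [InnerProductSpace ℂ E] [CompleteSpace E]

theorem hasDerivAt_prop (H : E →L[ℂ] E) (t : ℝ) :
    HasDerivAt (prop H) (prop H t * (-Complex.I • H)) t := by
  have h1 : ∀ t : ℝ, prop H t = NormedSpace.exp (t • (-Complex.I • H)) := by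
    intro t
    rw [prop, mul_comm, mul_smul, Complex.coe_smul]
  have h2 := hasDerivAt_exp_smul_const (𝕂 := ℝ) (-Complex.I • H) t
  rw [h1, funext h1]
  exact h2

theorem norm_negI_smul (H : E →L[ℂ] E) : ‖-Complex.I • H‖ = ‖H‖ := by
  rw [norm_smul]; simp

theorem c2Bound_prop {H : E →L[ℂ] E} (hH : IsSelfAdjoint H) : C2Bound (prop H) 1 ‖H‖ := by
  set X : E →L[ℂ] E := -Complex.I • H with hX
  refine ⟨fun t => prop H t * X, fun t => prop H t * X * X, fun t _ =>
    ⟨hasDerivAt_prop H t, (hasDerivAt_prop H t).mul_const X, norm_prop_le hH t, ?_, ?_⟩⟩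
  · refine (norm_mul_le _ _).trans ?_
    rw [hX, norm_negI_smul]
    gcongr
    exact norm_prop_le hH t
  · refine norm_mul₃_le.trans ?_
    rw [hX, norm_negI_smul, mul_assoc, ← pow_two]
    gcongr
    exact norm_prop_le hH t

theorem c2Bound_prop_neg {H : E →L[ℂ] E} (hH : IsSelfAdjoint H) :
    C2Bound (fun t => prop H (-t)) 1 ‖H‖ := by
  have h := c2Bound_prop hH.neg
  rw [norm_neg] at h
  exact h.congr (fun t => by simp [prop]) rfl rfl

theorem c2Bound_coupling {H : E →L[ℂ] E} (hH : IsSelfAdjoint H) (W : E →L[ℂ] E) :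
    C2Bound (coupling H W) ‖W‖ (2 * ‖H‖) := by
  have h := ((c2Bound_prop_neg hH).mul (C2Bound.const (c := W) le_rfl le_rfl)).mul
    (c2Bound_prop hH)
  exact h.congr (fun _ => rfl) (by ring) (by ring)

theorem c2Bound_sandwich {H : E →L[ℂ] E} (hH : IsSelfAdjoint H) (W ρ₀ : E →L[ℂ] E) (t : ℝ)
    {m m' : ℕ} {s : ℝ → Fin m → ℝ} {s' : ℝ → Fin m' → ℝ}
    (hs : ∀ i, C2Bound (fun x => coupling H W (s x i)) ‖W‖ (2 * ‖H‖))
    (hs' : ∀ i, C2Bound (fun x => coupling H W (s' x i)) ‖W‖ (2 * ‖H‖)) :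
    C2Bound (fun x => sandwich H W ρ₀ t t (List.ofFn (s x)) (List.ofFn (s' x)))
      (‖ρ₀‖ * ‖W‖ ^ (m + m')) ((m + m' : ℕ) * (2 * ‖H‖)) := by
  have h1 := C2Bound.list_prod (List.finRange m).reverse
    (φ := fun i x => coupling H W (s x i)) ContinuousLinearMap.norm_id_le fun i _ => hs i
  have h2 := C2Bound.list_prod (List.finRange m')
    (φ := fun i x => coupling H W (s' x i)) ContinuousLinearMap.norm_id_le fun i _ => hs' i
  rw [List.length_reverse, List.length_finRange] at h1
  rw [List.length_finRange] at h2
  have h3 := ((((C2Bound.const (c := prop H t) (norm_prop_le hH t) le_rfl).mul h1).mul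
    (C2Bound.const (c := ρ₀) le_rfl le_rfl)).mul h2).mul
      (C2Bound.const (c := prop H (-t)) (norm_prop_le hH _) le_rfl)
  refine h3.congr (fun x => ?_) ?_ ?_
  · rw [sandwich, List.map_ofFn, List.map_ofFn, List.ofFn_eq_map, List.ofFn_eq_map,
      ← List.map_reverse]
    rfl
  · rw [pow_add]; ring
  · push_cast; ring

theorem continuous_prop (H : E →L[ℂ] E) : Continuous (prop H) :=
  continuous_iff_continuousAt.2 fun t => (hasDerivAt_prop H t).continuousAt

theorem continuous_coupling (H W : E →L[ℂ] E) : Continuous (coupling H W) :=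
  (((continuous_prop H).comp continuous_neg).mul continuous_const).mul (continuous_prop H)

theorem continuous_sandwich (H W ρ₀ : E →L[ℂ] E) (t : ℝ) (m m' : ℕ) :
    Continuous fun p : (Fin m → ℝ) × (Fin m' → ℝ) =>
      sandwich H W ρ₀ t t (List.ofFn p.1) (List.ofFn p.2) := by
  have h1 : Continuous fun p : (Fin m → ℝ) × (Fin m' → ℝ) =>
      ((List.finRange m).reverse.map fun i => coupling H W (p.1 i)).prod :=
    continuous_list_prod _ fun i _ => (continuous_coupling H W).comp (by fun_prop)
  have h2 : Continuous fun p : (Fin m → ℝ) × (Fin m' → ℝ) =>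
      ((List.finRange m').map fun i => coupling H W (p.2 i)).prod :=
    continuous_list_prod _ fun i _ => (continuous_coupling H W).comp (by fun_prop)
  have h3 := (((continuous_const (y := prop H t)).mul h1).mul (continuous_const (y := ρ₀))).mul h2
    |>.mul (continuous_const (y := prop H (-t)))
  refine h3.congr fun p => ?_
  rw [sandwich, List.map_ofFn, List.map_ofFn, List.ofFn_eq_map, List.ofFn_eq_map,
    ← List.map_reverse]
  rfl

end Regularity

/-! ### Regularity of the bath correlation and of the influence functional -/

section Bath

variable {B : ℝ → ℝ → ℂ} {b b' b'' : ℝ}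

theorem BathBounds.nonneg (hB : BathBounds B b b' b'') : 0 ≤ b ∧ 0 ≤ b' ∧ 0 ≤ b'' :=
  ⟨(norm_nonneg _).trans (hB.bound 0 0),
    (add_nonneg (norm_nonneg _) (norm_nonneg _)).trans
      (hB.bound_partials 1 1 one_ne_zero one_ne_zero),
    (norm_nonneg _).trans (hB.bound₁₁ 1 1 one_ne_zero one_ne_zero)⟩

theorem BathBounds.flip (hB : BathBounds B b b' b'') :
    BathBounds (fun x y => B y x) b b' b'' where
  bound x y := hB.bound y x
  partials x y hx hy := (hB.partials y x hy hx).symm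
  bound_partials x y hx hy := by rw [add_comm]; exact hB.bound_partials y x hy hx
  partials₁ x y hx hy := (hB.partials₂ y x hy hx).symm
  partials₂ x y hx hy := (hB.partials₁ y x hy hx).symm
  bound₁₁ x y hx hy := hB.bound₂₂ y x hy hx
  bound₂₁ x y hx hy := hB.bound₁₂ y x hy hx
  bound₁₂ x y hx hy := hB.bound₂₁ y x hy hx
  bound₂₂ x y hx hy := hB.bound₁₁ y x hy hx

theorem BathBounds.hasDerivAt (hB : BathBounds B b b' b'') {x y : ℝ} (hx : x ≠ 0) (hy : y ≠ 0) :
    HasDerivAt (fun s => B s y) (pd₁ B x y) x ∧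
      HasDerivAt (fun s => pd₁ B s y) (pd₁ (pd₁ B) x y) x :=
  ⟨(hB.partials x y hx hy).1.hasDerivAt, (hB.partials₁ x y hx hy).1.hasDerivAt⟩

/-- The added ones let a single pair `K, L` serve both orders even when `b = 0`, and give `K ≥ 1`,
so that powers of `K` are monotone. -/
theorem BathBounds.norm_pd₁_le (hB : BathBounds B b b' b'') {x y : ℝ} (hx : x ≠ 0) (hy : y ≠ 0) :
    ‖pd₁ B x y‖ ≤ (1 + b) * (1 + b' + b'') ∧
      ‖pd₁ (pd₁ B) x y‖ ≤ (1 + b) * (1 + b' + b'') ^ 2 := by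
  obtain ⟨hb, hb', hb''⟩ := hB.nonneg
  constructor
  · have h1 := hB.bound_partials x y hx hy
    have h2 := norm_nonneg (pd₂ B x y)
    nlinarith [mul_nonneg hb (add_nonneg hb' hb'')]
  · have h1 := hB.bound₁₁ x y hx hy
    have h2 : b'' ≤ (1 + b' + b'') ^ 2 := by nlinarith [mul_nonneg hb' hb'']
    nlinarith [mul_nonneg hb (sq_nonneg (1 + b' + b''))]

/-- `ε = -1` serves the left times, which enter the influence functional with a minus sign. -/
theorem BathBounds.c2Bound_fst (hB : BathBounds B b b' b'') {y ε : ℝ} (hy : y ≠ 0)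
    (hε : ε = 1 ∨ ε = -1) : C2Bound (fun x => B (ε * x) y) (1 + b) (1 + b' + b'') := by
  refine ⟨fun x => ε • pd₁ B (ε * x) y, fun x => ε • ε • pd₁ (pd₁ B) (ε * x) y, fun x hx => ?_⟩
  have hx' : ε * x ≠ 0 := by rcases hε with rfl | rfl <;> simp [hx.ne']
  have hε' : ‖ε‖ = 1 := by rcases hε with rfl | rfl <;> simp
  have hd : HasDerivAt (fun x : ℝ => ε * x) ε x := by
    simpa using (hasDerivAt_id x).const_mul ε
  obtain ⟨h1, h2⟩ := hB.hasDerivAt hx' hy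
  obtain ⟨h3, h4⟩ := hB.norm_pd₁_le hx' hy
  refine ⟨h1.scomp x hd, (h2.scomp x hd).const_smul ε, ?_, ?_, ?_⟩
  · exact (hB.bound _ _).trans (by linarith)
  · rwa [norm_smul, hε', one_mul]
  · rwa [norm_smul, norm_smul, hε', one_mul, one_mul]

theorem BathBounds.c2Bound_snd (hB : BathBounds B b b' b'') {y ε : ℝ} (hy : y ≠ 0)
    (hε : ε = 1 ∨ ε = -1) : C2Bound (fun x => B y (ε * x)) (1 + b) (1 + b' + b'') :=
  hB.flip.c2Bound_fst hy hε

theorem BathBounds.norm_sub_le (hB : BathBounds B b b' b'') {x x' y : ℝ} (hx : 0 < x * x')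
    (hy : y ≠ 0) : ‖B x y - B x' y‖ ≤ (1 + b) * (1 + b' + b'') * |x - x'| := by
  rcases pos_and_pos_or_neg_and_neg_of_mul_pos hx with ⟨h1, h2⟩ | ⟨h1, h2⟩
  · simpa using (hB.c2Bound_fst hy (Or.inl rfl)).norm_sub_le h1 h2
  · have := (hB.c2Bound_fst hy (Or.inr rfl)).norm_sub_le (neg_pos.2 h1) (neg_pos.2 h2)
    simp only [mul_neg, neg_mul, one_mul, neg_neg] at this
    rwa [show -x - -x' = -(x - x') by ring, abs_neg] at this

/-- Bounded partial derivatives make `B` Lipschitz in each variable on an open quadrant, with a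
constant uniform in the other variable; this gives joint continuity. -/
theorem BathBounds.continuousOn (hB : BathBounds B b b' b'') :
    ContinuousOn (fun p : ℝ × ℝ => B p.1 p.2) {p | p.1 ≠ 0 ∧ p.2 ≠ 0} := by
  rintro ⟨x, y⟩ ⟨hx, hy⟩
  apply ContinuousAt.continuousWithinAt
  simp only at hx hy
  set c := (1 + b) * (1 + b' + b'')
  have h0 : Filter.Tendsto (fun p : ℝ × ℝ => c * |p.1 - x| + c * |p.2 - y|) (nhds (x, y))
      (nhds 0) := by
    have : Continuous fun p : ℝ × ℝ => c * |p.1 - x| + c * |p.2 - y| := by fun_prop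
    simpa using this.tendsto (x, y)
  rw [ContinuousAt, tendsto_iff_norm_sub_tendsto_zero]
  refine squeeze_zero' (Filter.Eventually.of_forall fun _ => norm_nonneg _) ?_ h0
  have e1 : ∀ᶠ p : ℝ × ℝ in nhds (x, y), 0 < p.1 * x :=
    (by fun_prop : Continuous fun p : ℝ × ℝ => p.1 * x).continuousAt.eventually_const_lt
      (by simpa using mul_self_pos.2 hx)
  have e2 : ∀ᶠ p : ℝ × ℝ in nhds (x, y), 0 < p.2 * y :=
    (by fun_prop : Continuous fun p : ℝ × ℝ => p.2 * y).continuousAt.eventually_const_lt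
      (by simpa using mul_self_pos.2 hy)
  filter_upwards [e1, e2] with p h1 h2
  calc ‖B p.1 p.2 - B x y‖ = ‖(B p.1 p.2 - B x p.2) + (B x p.2 - B x y)‖ := by
        congr 1; ring
    _ ≤ _ := norm_add_le_of_le (hB.norm_sub_le h1 (left_ne_zero_of_mul h2.ne'))
        (hB.flip.norm_sub_le h2 hx)

theorem norm_influence_le (hb : ∀ x y, ‖B x y‖ ≤ b) {N : ℕ} (τ : Fin N → ℝ) :
    ‖influence B τ‖ ≤ (1 + b) ^ N * √N.factorial := by
  have hb0 : 0 ≤ b := (norm_nonneg _).trans (hb 0 0)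
  calc ‖influence B τ‖ ≤ ∑ σ ∈ pairings N, (1 + b) ^ N := by
        refine norm_sum_le_of_le _ fun σ _ => ?_
        rw [norm_prod]
        calc _ ≤ ∏ i ∈ Finset.univ.filter (fun i => i < σ i), (1 + b) :=
              Finset.prod_le_prod (fun _ _ => norm_nonneg _)
                fun _ _ => (hb _ _).trans (by linarith)
          _ = (1 + b) ^ (Finset.univ.filter (fun i => i < σ i)).card := by simp
          _ ≤ (1 + b) ^ N := by
              refine pow_le_pow_right₀ (by linarith) ?_
              simpa using Finset.card_le_univ (Finset.univ.filter (fun i => i < σ i))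
    _ = (pairings N).card * (1 + b) ^ N := by simp
    _ ≤ √N.factorial * (1 + b) ^ N := by
        gcongr
        exact card_pairings_le_sqrt N
    _ = _ := mul_comm _ _

theorem c2Bound_influence {K L : ℝ} (hK : 1 ≤ K) (hL : 0 ≤ L) {N : ℕ} {τ : ℝ → Fin N → ℝ}
    (h : ∀ i k, i ≠ k → C2Bound (fun x => B (τ x i) (τ x k)) K L) :
    C2Bound (fun x => influence B (τ x)) (K ^ N * √N.factorial) (N * L) := by
  have h1 : ∀ σ ∈ pairings N, C2Bound
      (fun x => ∏ i ∈ Finset.univ.filter (fun i => i < σ i), B (τ x i) (τ x (σ i)))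
      (K ^ N) (N * L) := by
    intro σ hσ
    have hcard : (Finset.univ.filter (fun i => i < σ i)).card ≤ N := by
      simpa using Finset.card_le_univ (Finset.univ.filter (fun i => i < σ i))
    refine (C2Bound.finset_prod (Finset.univ.filter (fun i => i < σ i))
      (φ := fun i x => B (τ x i) (τ x (σ i)))
      fun i _ => h i (σ i) (mem_pairings.1 hσ i).2.symm).mono ?_ (by positivity) ?_
    · exact pow_le_pow_right₀ hK hcard
    · gcongr
  refine (C2Bound.finset_sum _ (by positivity) h1).mono ?_ (by positivity) le_rfl
  rw [mul_comm]
  gcongr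
  exact card_pairings_le_sqrt N

/-- Only one time moves and a pairing has no fixed points, so no factor has both arguments moving
and mixed derivatives never enter. -/
theorem BathBounds.c2Bound_influence_path (hB : BathBounds B b b' b'') {N : ℕ}
    {τ : ℝ → Fin N → ℝ} (j : Fin N) {ε : ℝ} (hε : ε = 1 ∨ ε = -1) (hj : ∀ x, τ x j = ε * x)
    (hτ : ∀ i, i ≠ j → ∃ c, c ≠ 0 ∧ ∀ x, τ x i = c) :
    C2Bound (fun x => influence B (τ x)) ((1 + b) ^ N * √N.factorial)
      (N * (1 + b' + b'')) := by
  obtain ⟨hb, hb', hb''⟩ := hB.nonneg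
  refine c2Bound_influence (by linarith) (by positivity) fun i k hik => ?_
  by_cases hi : i = j
  · subst hi
    obtain ⟨c, hc, hc'⟩ := hτ k hik.symm
    simp only [hj, hc']
    exact hB.c2Bound_fst hc hε
  · obtain ⟨c, hc, hc'⟩ := hτ i hi
    by_cases hk : k = j
    · subst hk
      simp only [hj, hc']
      exact hB.c2Bound_snd hc hε
    · obtain ⟨d, hd, hd'⟩ := hτ k hk
      simp only [hc', hd']
      exact C2Bound.const ((hB.bound _ _).trans (by linarith)) (by positivity)

theorem BathBounds.continuousOn_influence (hB : BathBounds B b b' b'') (N : ℕ) :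
    ContinuousOn (fun τ : Fin N → ℝ => influence B τ) {τ | ∀ i, τ i ≠ 0} := by
  unfold influence
  refine continuousOn_finsetSum _ fun σ _ => continuousOn_finsetProd _ fun i _ => ?_
  exact hB.continuousOn.comp (f := fun τ : Fin N → ℝ => (τ i, τ (σ i)))
    (by fun_prop) fun τ hτ => ⟨hτ _, hτ _⟩

end Bath

/-! ### The midpoint rule on products of two simplices -/

section ProductMidpoint

variable {F : Type*} [NormedAddCommGroup F] [NormedSpace ℝ F]

theorem measurable_gridMid_pi (h : ℝ) (m : ℕ) :
    Measurable fun (s : Fin m → ℝ) i => gridMid h (s i) :=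
  measurable_pi_lambda _ fun i => (measurable_gridMid h).comp (measurable_pi_apply i)

theorem integrableOn_prod_simplex_comp {m m' : ℕ} {T K : ℝ}
    {f : (Fin m → ℝ) → (Fin m' → ℝ) → F}
    (hf : ContinuousOn (fun p : (Fin m → ℝ) × (Fin m' → ℝ) => f p.1 p.2)
      (orthant m ×ˢ orthant m')) (hK : ∀ s s', ‖f s s'‖ ≤ K)
    {g : (Fin m → ℝ) → Fin m → ℝ} {g' : (Fin m' → ℝ) → Fin m' → ℝ} (hg : Measurable g)
    (hg' : Measurable g') (hgo : ∀ s ∈ orthant m, g s ∈ orthant m)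
    (hgo' : ∀ s ∈ orthant m', g' s ∈ orthant m') :
    IntegrableOn (fun p : (Fin m → ℝ) × (Fin m' → ℝ) => f (g p.1) (g' p.2))
      (simplex m T ×ˢ simplex m' T) := by
  have hS := (measurableSet_simplex m T).prod (measurableSet_simplex m' T)
  have hU := (measurableSet_orthant m).prod (measurableSet_orthant m')
  have hG : Measurable fun p : (Fin m → ℝ) × (Fin m' → ℝ) => (g p.1, g' p.2) :=
    (hg.comp measurable_fst).prodMk (hg'.comp measurable_snd)
  have hae : AEStronglyMeasurable
      (fun p : (Fin m → ℝ) × (Fin m' → ℝ) => f (g p.1) (g' p.2))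
      (volume.restrict (simplex m T ×ˢ simplex m' T)) :=
    aestronglyMeasurable_comp_of_continuousOn hf hU hG hS fun p hp =>
      ⟨hgo _ (simplex_subset_orthant m T hp.1), hgo' _ (simplex_subset_orthant m' T hp.2)⟩
  refine IntegrableOn.of_bound ?_ hae K (Filter.Eventually.of_forall fun p => hK _ _)
  rw [Measure.volume_eq_prod, Measure.prod_prod]
  exact ENNReal.mul_lt_top (volume_simplex_lt_top m T) (volume_simplex_lt_top m' T)

theorem setIntegral_prod_simplex {m m' : ℕ} {T : ℝ} {f : (Fin m → ℝ) → (Fin m' → ℝ) → F}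
    (hf : IntegrableOn (fun p : (Fin m → ℝ) × (Fin m' → ℝ) => f p.1 p.2)
      (simplex m T ×ˢ simplex m' T)) :
    ∫ p in simplex m T ×ˢ simplex m' T, f p.1 p.2 =
      ∫ s in simplex m T, ∫ s' in simplex m' T, f s s' := by
  rw [IntegrableOn, Measure.volume_eq_prod, ← Measure.prod_restrict] at hf
  rw [Measure.volume_eq_prod, ← Measure.prod_restrict]
  exact integral_prod _ hf

theorem setIntegral_prod_simplex_symm {m m' : ℕ} {T : ℝ}
    {f : (Fin m → ℝ) → (Fin m' → ℝ) → F}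
    (hf : IntegrableOn (fun p : (Fin m → ℝ) × (Fin m' → ℝ) => f p.1 p.2)
      (simplex m T ×ˢ simplex m' T)) :
    ∫ p in simplex m T ×ˢ simplex m' T, f p.1 p.2 =
      ∫ s' in simplex m' T, ∫ s in simplex m T, f s s' := by
  rw [IntegrableOn, Measure.volume_eq_prod, ← Measure.prod_restrict] at hf
  rw [Measure.volume_eq_prod, ← Measure.prod_restrict]
  exact integral_prod_symm _ hf

/-- The left times are moved to the grid first, then the right times with the left ones already
there; each step is integrated over the other simplex. -/
theorem norm_setIntegral_prod_simplex_sub_le [CompleteSpace F] {m m' : ℕ} {h T K L : ℝ}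
    (hh : 0 < h) (hT : 0 ≤ T) {f : (Fin m → ℝ) → (Fin m' → ℝ) → F}
    (hf : ContinuousOn (fun p : (Fin m → ℝ) × (Fin m' → ℝ) => f p.1 p.2)
      (orthant m ×ˢ orthant m')) (hK : ∀ s s', ‖f s s'‖ ≤ K)
    (hl : ∀ s ∈ orthant m, ∀ s' ∈ orthant m', ∀ i,
      C2Bound (fun x => f (Function.update s i x) s') K L)
    (hr : ∀ s ∈ orthant m, ∀ s' ∈ orthant m', ∀ i,
      C2Bound (fun x => f s (Function.update s' i x)) K L) :
    ‖(∫ p in simplex m T ×ˢ simplex m' T, f p.1 p.2) -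
      ∫ p in simplex m T ×ˢ simplex m' T, f (fun i => gridMid h (p.1 i))
        (fun i => gridMid h (p.2 i))‖ ≤
      m * (2 * (K * L ^ 2 * T + K * L) * h ^ 2 * (T ^ (m - 1) / (m - 1).factorial)) *
          (T ^ m' / m'.factorial) +
        m' * (2 * (K * L ^ 2 * T + K * L) * h ^ 2 * (T ^ (m' - 1) / (m' - 1).factorial)) *
          (T ^ m / m.factorial) := by
  have hgo : ∀ {m : ℕ} (s : Fin m → ℝ), (fun i => gridMid h (s i)) ∈ orthant m :=
    fun s i => gridMid_pos hh _
  have i0 : IntegrableOn (fun p : (Fin m → ℝ) × (Fin m' → ℝ) => f p.1 p.2)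
      (simplex m T ×ˢ simplex m' T) :=
    integrableOn_prod_simplex_comp hf hK measurable_id measurable_id (fun s hs => hs)
      (fun s hs => hs)
  have i1 : IntegrableOn (fun p : (Fin m → ℝ) × (Fin m' → ℝ) =>
      f (fun i => gridMid h (p.1 i)) p.2) (simplex m T ×ˢ simplex m' T) :=
    integrableOn_prod_simplex_comp hf hK (measurable_gridMid_pi h m) measurable_id
      (fun s _ => hgo s) (fun s hs => hs)
  have i2 : IntegrableOn (fun p : (Fin m → ℝ) × (Fin m' → ℝ) =>
      f (fun i => gridMid h (p.1 i)) (fun i => gridMid h (p.2 i)))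
      (simplex m T ×ˢ simplex m' T) :=
    integrableOn_prod_simplex_comp hf hK (measurable_gridMid_pi h m)
      (measurable_gridMid_pi h m') (fun s _ => hgo s) (fun s _ => hgo s)
  have hcl : ∀ s' ∈ orthant m', ContinuousOn (fun s => f s s') (orthant m) :=
    fun s' hs' => hf.comp (f := fun s => (s, s')) (by fun_prop) fun s hs => ⟨hs, hs'⟩
  have hcr : ∀ s ∈ orthant m, ContinuousOn (fun s' => f s s') (orthant m') :=
    fun s hs => hf.comp (f := fun s' => (s, s')) (by fun_prop) fun s' hs' => ⟨hs, hs'⟩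
  have e1 : ‖(∫ p in simplex m T ×ˢ simplex m' T, f p.1 p.2) -
      ∫ p in simplex m T ×ˢ simplex m' T, f (fun i => gridMid h (p.1 i)) p.2‖ ≤
      m * (2 * (K * L ^ 2 * T + K * L) * h ^ 2 * (T ^ (m - 1) / (m - 1).factorial)) *
          (T ^ m' / m'.factorial) := by
    rw [← integral_sub i0 i1, setIntegral_prod_simplex_symm
      (f := fun s s' => f s s' - f (fun i => gridMid h (s i)) s') (i0.sub i1),
      ← volume_simplex m' hT]
    refine norm_setIntegral_le_of_norm_le_const (volume_simplex_lt_top m' T) fun s' hs' => ?_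
    have hs'o := simplex_subset_orthant m' T hs'
    rw [integral_sub
      (integrableOn_simplex_comp (hcl s' hs'o) (fun s _ => hK s s')
        (g := fun s => s) measurable_id fun s hs => hs)
      (integrableOn_simplex_comp (hcl s' hs'o) (fun s _ => hK s s')
        (measurable_gridMid_pi h m) fun s _ => hgo s)]
    exact norm_setIntegral_simplex_sub_le hh hT (hcl s' hs'o) (fun s _ => hK s s')
      fun i s hs => hl s hs s' hs'o i
  have e2 : ‖(∫ p in simplex m T ×ˢ simplex m' T, f (fun i => gridMid h (p.1 i)) p.2) -
      ∫ p in simplex m T ×ˢ simplex m' T, f (fun i => gridMid h (p.1 i))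
        (fun i => gridMid h (p.2 i))‖ ≤
      m' * (2 * (K * L ^ 2 * T + K * L) * h ^ 2 * (T ^ (m' - 1) / (m' - 1).factorial)) *
          (T ^ m / m.factorial) := by
    rw [← integral_sub i1 i2, setIntegral_prod_simplex
      (f := fun s s' => f (fun i => gridMid h (s i)) s' -
        f (fun i => gridMid h (s i)) (fun i => gridMid h (s' i))) (i1.sub i2),
      ← volume_simplex m hT]
    refine norm_setIntegral_le_of_norm_le_const (volume_simplex_lt_top m T) fun s hs => ?_
    rw [integral_sub
      (integrableOn_simplex_comp (hcr _ (hgo s)) (fun s' _ => hK _ s')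
        (g := fun s => s) measurable_id fun s hs => hs)
      (integrableOn_simplex_comp (hcr _ (hgo s)) (fun s' _ => hK _ s')
        (measurable_gridMid_pi h m') fun s _ => hgo s)]
    exact norm_setIntegral_simplex_sub_le hh hT (hcr _ (hgo s)) (fun s' _ => hK _ s')
      fun i s' hs' => hr _ (hgo s) s' hs' i
  refine le_trans (le_of_eq ?_) (norm_add_le_of_le e1 e2)
  congr 1
  abel

/-- `gridMid` is monotone, so ordered times stay weakly ordered and `hfG` is needed only for
monotone arguments. -/
theorem setIntegral_prod_simplex_gridMid [CompleteSpace F] {h : ℝ} (hh : 0 < h) {m m' : ℕ}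
    (n : ℕ) {f : (Fin m → ℝ) → (Fin m' → ℝ) → F} {G : Multiset ℝ → Multiset ℝ → F}
    (hfG : ∀ s s', Monotone s → Monotone s' → f s s' = G (∑ i, {s i}) (∑ i, {s' i}))
    (hInt : IntegrableOn (fun p : (Fin m → ℝ) × (Fin m' → ℝ) =>
      f (fun i => gridMid h (p.1 i)) (fun i => gridMid h (p.2 i)))
      (simplex m (n * h) ×ˢ simplex m' (n * h))) :
    ∫ p in simplex m (n * h) ×ˢ simplex m' (n * h),
      f (fun i => gridMid h (p.1 i)) (fun i => gridMid h (p.2 i)) =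
    ∑ k ∈ (Finset.univ : Finset (Fin n)).piAntidiag m,
      ∑ k' ∈ (Finset.univ : Finset (Fin n)).piAntidiag m',
        ((∏ i, h ^ k i / ((k i).factorial : ℝ)) * ∏ i, h ^ k' i / ((k' i).factorial : ℝ)) •
          G (∑ i, k i • {midR h i}) (∑ i, k' i • {midR h i}) := by
  rw [setIntegral_prod_simplex
    (f := fun s s' => f (fun i => gridMid h (s i)) (fun i => gridMid h (s' i))) hInt]
  have hmono : ∀ {m : ℕ} (s : Fin m → ℝ), s ∈ simplex m (n * h) →
      Monotone fun i => gridMid h (s i) := fun s hs => (gridMid_mono hh).comp hs.1.monotone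
  have h1 : ∀ s ∈ simplex m (n * h), ∫ s' in simplex m' (n * h),
      f (fun i => gridMid h (s i)) (fun i => gridMid h (s' i)) =
      ∑ k' ∈ (Finset.univ : Finset (Fin n)).piAntidiag m',
        (∏ i, h ^ k' i / ((k' i).factorial : ℝ)) •
          G (∑ i, {gridMid h (s i)}) (∑ i, k' i • {midR h i}) := by
    intro s hs
    rw [← setIntegral_simplex_gridMid hh m' n]
    exact setIntegral_congr_fun (measurableSet_simplex m' _) fun s' hs' =>
      hfG _ _ (hmono s hs) (hmono s' hs')
  rw [setIntegral_congr_fun (measurableSet_simplex m _) h1,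
    setIntegral_simplex_gridMid hh m n (fun M =>
      ∑ k' ∈ (Finset.univ : Finset (Fin n)).piAntidiag m',
        (∏ i, h ^ k' i / ((k' i).factorial : ℝ)) • G M (∑ i, k' i • {midR h i}))]
  simp only [Finset.smul_sum, smul_smul]

end ProductMidpoint

/-! ### The midpoint rule for the Dyson series -/

section DysonMidpoint

variable {E : Type*} [NormedAddCommGroup E] [InnerProductSpace ℂ E] [CompleteSpace E]

/-- The integrand of the Dyson series in the interaction picture, without the factors `±i`. -/
def dysonFun (H W ρ₀ : E →L[ℂ] E) (B : ℝ → ℝ → ℂ) (t : ℝ) {m m' : ℕ} (s : Fin m → ℝ)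
    (s' : Fin m' → ℝ) : E →L[ℂ] E :=
  influence B (Fin.append (fun i : Fin m => -s i.rev) s') •
    sandwich H W ρ₀ t t (List.ofFn s) (List.ofFn s')

variable {H W : E →L[ℂ] E} {B : ℝ → ℝ → ℂ} {b b' b'' : ℝ}

theorem norm_dysonFun_le (hH : IsSelfAdjoint H) (W ρ₀ : E →L[ℂ] E) (hB : ∀ x y, ‖B x y‖ ≤ b)
    (t : ℝ) {m m' : ℕ} (s : Fin m → ℝ) (s' : Fin m' → ℝ) :
    ‖dysonFun H W ρ₀ B t s s'‖ ≤
      (1 + b) ^ (m + m') * √(m + m').factorial * (‖ρ₀‖ * ‖W‖ ^ (m + m')) := by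
  have hb : 0 ≤ b := (norm_nonneg _).trans (hB 0 0)
  refine (norm_smul_le _ _).trans (mul_le_mul (norm_influence_le hB _) ?_ (norm_nonneg _)
    (by positivity))
  simpa using norm_sandwich_le hH W ρ₀ t t (List.ofFn s) (List.ofFn s')

theorem continuousOn_dysonFun (hB : BathBounds B b b' b'') (ρ₀ : E →L[ℂ] E) (t : ℝ) (m m' : ℕ) :
    ContinuousOn (fun p : (Fin m → ℝ) × (Fin m' → ℝ) => dysonFun H W ρ₀ B t p.1 p.2)
      (orthant m ×ˢ orthant m') := by
  refine ContinuousOn.smul (f := fun p : (Fin m → ℝ) × (Fin m' → ℝ) =>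
    influence B (Fin.append (fun i : Fin m => -p.1 i.rev) p.2)) ?_
    (continuous_sandwich H W ρ₀ t m m').continuousOn
  refine (hB.continuousOn_influence (m + m')).comp
    (f := fun p : (Fin m → ℝ) × (Fin m' → ℝ) => Fin.append (fun i : Fin m => -p.1 i.rev) p.2)
    ?_ ?_
  · refine Continuous.continuousOn (continuous_pi fun i => ?_)
    refine Fin.addCases (fun i => ?_) (fun i => ?_) i
    · simp only [Fin.append_left]; fun_prop
    · simp only [Fin.append_right]; fun_prop
  · intro p hp i
    refine Fin.addCases (fun i => ?_) (fun i => ?_) i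
    · simp only [Fin.append_left]
      exact neg_ne_zero.2 (hp.1 _).ne'
    · simp only [Fin.append_right]
      exact (hp.2 _).ne'

theorem c2Bound_coupling_update (hH : IsSelfAdjoint H) (W : E →L[ℂ] E) {m : ℕ} (s : Fin m → ℝ)
    (i j : Fin m) :
    C2Bound (fun x => coupling H W (Function.update s i x j)) ‖W‖ (2 * ‖H‖) := by
  rcases eq_or_ne j i with rfl | hj
  · simpa using c2Bound_coupling hH W
  · simp only [Function.update_of_ne hj]
    exact C2Bound.const (norm_coupling_le hH W _) (by positivity)

theorem c2Bound_dysonFun_left (hH : IsSelfAdjoint H) (hB : BathBounds B b b' b'')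
    (ρ₀ : E →L[ℂ] E) (t : ℝ) {m m' : ℕ} {s : Fin m → ℝ} {s' : Fin m' → ℝ} (hs : s ∈ orthant m)
    (hs' : s' ∈ orthant m') (i : Fin m) :
    C2Bound (fun x => dysonFun H W ρ₀ B t (Function.update s i x) s')
      ((1 + b) ^ (m + m') * √(m + m').factorial * (‖ρ₀‖ * ‖W‖ ^ (m + m')))
      ((m + m' : ℕ) * (1 + b' + b'' + 2 * ‖H‖)) := by
  -- The left block is reversed and negated, so coordinate `i` moves at position `i.rev` with sign
  -- `-1`.
  have h1 := hB.c2Bound_influence_path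
    (τ := fun x => Fin.append (fun k : Fin m => -Function.update s i x k.rev) s')
    (Fin.castAdd m' i.rev) (ε := -1) (Or.inr rfl) (by intro x; simp) (by
      intro k
      refine Fin.addCases (fun k hk => ?_) (fun k _ => ?_) k
      · have hk' : k.rev ≠ i := by
          rintro rfl
          exact hk (by rw [Fin.rev_rev])
        refine ⟨-s k.rev, neg_ne_zero.2 (hs _).ne', fun x => ?_⟩
        rw [Fin.append_left, Function.update_of_ne hk']
      · exact ⟨s' k, (hs' k).ne', fun x => by rw [Fin.append_right]⟩)
  have h2 := c2Bound_sandwich hH W ρ₀ t (s := fun x => Function.update s i x)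
    (s' := fun _ => s') (c2Bound_coupling_update hH W s i)
    (fun j => C2Bound.const (norm_coupling_le hH W _) (by positivity))
  exact (h1.smul h2).congr (fun _ => rfl) rfl (by ring)

theorem c2Bound_dysonFun_right (hH : IsSelfAdjoint H) (hB : BathBounds B b b' b'')
    (ρ₀ : E →L[ℂ] E) (t : ℝ) {m m' : ℕ} {s : Fin m → ℝ} {s' : Fin m' → ℝ} (hs : s ∈ orthant m)
    (hs' : s' ∈ orthant m') (i : Fin m') :
    C2Bound (fun x => dysonFun H W ρ₀ B t s (Function.update s' i x))
      ((1 + b) ^ (m + m') * √(m + m').factorial * (‖ρ₀‖ * ‖W‖ ^ (m + m')))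
      ((m + m' : ℕ) * (1 + b' + b'' + 2 * ‖H‖)) := by
  have h1 := hB.c2Bound_influence_path
    (τ := fun x => Fin.append (fun k : Fin m => -s k.rev) (Function.update s' i x))
    (Fin.natAdd m i) (ε := 1) (Or.inl rfl) (by intro x; simp) (by
      intro k
      refine Fin.addCases (fun k _ => ?_) (fun k hk => ?_) k
      · exact ⟨-s k.rev, neg_ne_zero.2 (hs _).ne', fun x => by rw [Fin.append_left]⟩
      · have hk' : k ≠ i := by
          rintro rfl
          exact hk rfl
        refine ⟨s' k, (hs' k).ne', fun x => ?_⟩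
        rw [Fin.append_right, Function.update_of_ne hk'])
  have h2 := c2Bound_sandwich hH W ρ₀ t (s := fun _ => s)
    (s' := fun x => Function.update s' i x)
    (fun j => C2Bound.const (norm_coupling_le hH W _) (by positivity))
    (c2Bound_coupling_update hH W s' i)
  exact (h1.smul h2).congr (fun _ => rfl) rfl (by ring)

theorem integrableOn_dysonFun (hH : IsSelfAdjoint H) (W ρ₀ : E →L[ℂ] E)
    (hB : BathBounds B b b' b'') (t T : ℝ) (m m' : ℕ) :
    IntegrableOn (fun p : (Fin m → ℝ) × (Fin m' → ℝ) => dysonFun H W ρ₀ B t p.1 p.2)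
      (simplex m T ×ˢ simplex m' T) :=
  integrableOn_prod_simplex_comp (f := dysonFun H W ρ₀ B t) (g := fun s => s)
    (g' := fun s' => s') (continuousOn_dysonFun hB ρ₀ t m m')
    (norm_dysonFun_le hH W ρ₀ hB.bound t) measurable_id measurable_id (fun _ hs => hs)
    (fun _ hs => hs)

theorem norm_setIntegral_dysonFun_sub_le (hH : IsSelfAdjoint H) (W ρ₀ : E →L[ℂ] E)
    (hB : BathBounds B b b' b'') {h T : ℝ} (hh : 0 < h) (hT : 0 ≤ T) (t : ℝ) (m m' : ℕ)
    {K L : ℝ} (hK : K = (1 + b) ^ (m + m') * √(m + m').factorial * (‖ρ₀‖ * ‖W‖ ^ (m + m')))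
    (hL : L = (m + m' : ℕ) * (1 + b' + b'' + 2 * ‖H‖)) :
    ‖(∫ p in simplex m T ×ˢ simplex m' T, dysonFun H W ρ₀ B t p.1 p.2) -
      ∫ p in simplex m T ×ˢ simplex m' T, dysonFun H W ρ₀ B t (fun i => gridMid h (p.1 i))
        (fun i => gridMid h (p.2 i))‖ ≤
      m * (2 * (K * L ^ 2 * T + K * L) * h ^ 2 * (T ^ (m - 1) / (m - 1).factorial)) *
          (T ^ m' / m'.factorial) +
        m' * (2 * (K * L ^ 2 * T + K * L) * h ^ 2 * (T ^ (m' - 1) / (m' - 1).factorial)) *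
          (T ^ m / m.factorial) := by
  subst hK hL
  exact norm_setIntegral_prod_simplex_sub_le (f := dysonFun H W ρ₀ B t) hh hT
    (continuousOn_dysonFun hB ρ₀ t m m')
    (norm_dysonFun_le hH W ρ₀ hB.bound t)
    (fun _ hs _ hs' => c2Bound_dysonFun_left hH hB ρ₀ t hs hs')
    (fun _ hs _ hr => c2Bound_dysonFun_right hH hB ρ₀ t hs hr)

/-! ### The midpoint sum as a sum over configurations -/

/-- The integrand of the Dyson series as a function of the multisets of time points. -/
def dysonMultiset (H W ρ₀ : E →L[ℂ] E) (B : ℝ → ℝ → ℂ) (t : ℝ) (M M' : Multiset ℝ) :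
    E →L[ℂ] E :=
  inflL B (((M.sort (· ≤ ·)).map Neg.neg).reverse ++ M'.sort (· ≤ ·)) •
    sandwich H W ρ₀ t t (M.sort (· ≤ ·)) (M'.sort (· ≤ ·))

theorem coe_ofFn_eq_sum {m : ℕ} (s : Fin m → ℝ) :
    ((List.ofFn s : List ℝ) : Multiset ℝ) = ∑ i, {s i} := by
  rw [List.ofFn_eq_map, ← Multiset.map_coe]
  have h : ((List.finRange m : List (Fin m)) : Multiset (Fin m)) = Finset.univ.val := by
    rfl
  rw [h, ← Multiset.sum_map_singleton (Multiset.map s Finset.univ.val), Multiset.map_map]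
  rfl

theorem sort_sum_singleton {m : ℕ} {s : Fin m → ℝ} (hs : Monotone s) :
    (∑ i, {s i} : Multiset ℝ).sort (· ≤ ·) = List.ofFn s :=
  sort_eq_of_sorted (List.pairwise_ofFn.2 fun _ _ hij => hs hij.le) (coe_ofFn_eq_sum s)

theorem dysonFun_eq_dysonMultiset (H W ρ₀ : E →L[ℂ] E) (B : ℝ → ℝ → ℂ) (t : ℝ) {m m' : ℕ}
    {s : Fin m → ℝ} {s' : Fin m' → ℝ} (hs : Monotone s) (hs' : Monotone s') :
    dysonFun H W ρ₀ B t s s' = dysonMultiset H W ρ₀ B t (∑ i, {s i}) (∑ i, {s' i}) := by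
  rw [dysonFun, dysonMultiset, sort_sum_singleton hs, sort_sum_singleton hs', ← inflL_ofFn,
    List.ofFn_fin_append]
  congr 3
  rw [List.map_ofFn]
  apply List.ext_getElem
  · simp
  · intro i h1 h2
    simp only [List.getElem_ofFn, List.getElem_reverse, Function.comp_apply]
    congr 2
    ext
    simp only [List.length_ofFn, Fin.val_rev]
    omega

theorem setIntegral_dysonFun_gridMid (hH : IsSelfAdjoint H) (W ρ₀ : E →L[ℂ] E)
    (hB : BathBounds B b b' b'') {h : ℝ} (hh : 0 < h) (t : ℝ) (m m' n : ℕ) :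
    ∫ p in simplex m (n * h) ×ˢ simplex m' (n * h),
      dysonFun H W ρ₀ B t (fun i => gridMid h (p.1 i)) (fun i => gridMid h (p.2 i)) =
    ∑ k ∈ (Finset.univ : Finset (Fin n)).piAntidiag m,
      ∑ k' ∈ (Finset.univ : Finset (Fin n)).piAntidiag m',
        ((∏ i, h ^ k i / ((k i).factorial : ℝ)) * ∏ i, h ^ k' i / ((k' i).factorial : ℝ)) •
          dysonMultiset H W ρ₀ B t (∑ i, k i • {midR h i}) (∑ i, k' i • {midR h i}) :=
  setIntegral_prod_simplex_gridMid (f := dysonFun H W ρ₀ B t) hh n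
    (fun _ _ hs hs' => dysonFun_eq_dysonMultiset H W ρ₀ B t hs hs')
    (integrableOn_prod_simplex_comp (f := dysonFun H W ρ₀ B t)
      (g := fun s i => gridMid h (s i)) (g' := fun s i => gridMid h (s i))
      (continuousOn_dysonFun hB ρ₀ t m m')
      (norm_dysonFun_le hH W ρ₀ hB.bound t) (measurable_gridMid_pi h m)
      (measurable_gridMid_pi h m') (fun _ _ _ => gridMid_pos hh _)
      (fun _ _ _ => gridMid_pos hh _))

end DysonMidpoint

/-! ### Weights of configurations -/

section Weights

variable {ι : Type*} [Fintype ι]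

/-- The volume of the set of ordered time points with `k l` points in the `l`-th interval. -/
def cellWeight (h : ℝ) (k : ι → ℕ) : ℝ := ∏ l, h ^ k l / ((k l).factorial : ℝ)

theorem cellWeight_nonneg {h : ℝ} (hh : 0 ≤ h) (k : ι → ℕ) : 0 ≤ cellWeight h k :=
  Finset.prod_nonneg fun _ _ => by positivity

theorem cellWeight_le_of_le {h : ℝ} (hh : 0 ≤ h) {k v : ι → ℕ} (hv : v ≤ k) :
    cellWeight h k ≤ h ^ (∑ l, v l) * cellWeight h (k - v) := by
  rw [cellWeight, cellWeight, ← Finset.prod_pow_eq_pow_sum, ← Finset.prod_mul_distrib]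
  refine Finset.prod_le_prod (fun l _ => by positivity) fun l _ => ?_
  rw [← mul_div_assoc, Pi.sub_apply, ← pow_add, Nat.add_sub_cancel' (hv l)]
  have : ((k l - v l).factorial : ℝ) ≤ (k l).factorial := by
    exact_mod_cast Nat.factorial_le (Nat.sub_le _ _)
  gcongr

variable [DecidableEq ι]

theorem sum_cellWeight (h : ℝ) (N : ℕ) :
    ∑ k ∈ (Finset.univ : Finset ι).piAntidiag N, cellWeight h k =
      (Fintype.card ι * h) ^ N / N.factorial := by
  have h1 := Finset.sum_pow_eq_sum_piAntidiag (Finset.univ : Finset ι) (fun _ => h) N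
  rw [Finset.sum_const, Finset.card_univ, nsmul_eq_mul] at h1
  rw [h1, Finset.sum_div]
  refine Finset.sum_congr rfl fun k hk => ?_
  have h2 := Nat.multinomial_spec (Finset.univ : Finset ι) k
  rw [(Finset.mem_piAntidiag.1 hk).1] at h2
  have h3 : (∏ l, ((k l).factorial : ℝ)) * Nat.multinomial Finset.univ k = N.factorial := by
    exact_mod_cast h2
  have h4 : (∏ l, ((k l).factorial : ℝ)) ≠ 0 :=
    Finset.prod_ne_zero_iff.2 fun l _ => by positivity
  have h5 : (N.factorial : ℝ) ≠ 0 := by positivity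
  rw [cellWeight, Finset.prod_div_distrib, div_eq_div_iff h4 h5, ← h3]
  ring

-- Removing `v` from `k` is injective and frees `V` factors `h`. The rest is bounded by the
-- multinomial sum, and `N! ≤ (N - V)! * N ^ V`.
open scoped Classical in
theorem sum_cellWeight_ge_le {h : ℝ} (hh : 0 ≤ h) (N : ℕ) (v : ι → ℕ) :
    ∑ k ∈ (Finset.univ : Finset ι).piAntidiag N with v ≤ k, cellWeight h k ≤
      h ^ (∑ l, v l) * ((Fintype.card ι * h) ^ (N - ∑ l, v l) *
        (N : ℝ) ^ (∑ l, v l) / N.factorial) := by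
  set V := ∑ l, v l with hV
  by_cases hN : V ≤ N
  · have h1 : ∑ k ∈ (Finset.univ : Finset ι).piAntidiag N with v ≤ k, cellWeight h k ≤
        ∑ k ∈ (Finset.univ : Finset ι).piAntidiag (N - V), h ^ V * cellWeight h k := by
      calc _ ≤ ∑ k ∈ (Finset.univ : Finset ι).piAntidiag N with v ≤ k,
            h ^ V * cellWeight h (k - v) :=
            Finset.sum_le_sum fun k hk => cellWeight_le_of_le hh (Finset.mem_filter.1 hk).2
        _ = ∑ k ∈ (((Finset.univ : Finset ι).piAntidiag N).filter (v ≤ ·)).image (· - v),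
            h ^ V * cellWeight h k := by
            rw [Finset.sum_image]
            intro k hk k' hk' hkk
            have e1 := tsub_add_cancel_of_le (Finset.mem_filter.1 hk).2
            have e2 := tsub_add_cancel_of_le (Finset.mem_filter.1 hk').2
            simp only at hkk
            rw [← e1, ← e2, hkk]
        _ ≤ _ := by
            refine Finset.sum_le_sum_of_subset_of_nonneg ?_ fun k _ _ =>
              mul_nonneg (by positivity) (cellWeight_nonneg hh k)
            intro k hk
            obtain ⟨k', hk', rfl⟩ := Finset.mem_image.1 hk
            obtain ⟨hk1, hk2⟩ := Finset.mem_filter.1 hk'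
            refine Finset.mem_piAntidiag.2 ⟨?_, fun _ _ => Finset.mem_univ _⟩
            simp only [Pi.sub_apply]
            rw [Finset.sum_tsub_distrib _ fun l _ => hk2 l, (Finset.mem_piAntidiag.1 hk1).1]
    refine h1.trans ?_
    rw [← Finset.mul_sum, sum_cellWeight]
    gcongr ?_ * ?_
    have h2 : (N.factorial : ℝ) ≤ (N - V).factorial * (N : ℝ) ^ V := by
      rw [← Nat.factorial_mul_descFactorial hN]
      exact_mod_cast Nat.mul_le_mul_left _ (Nat.descFactorial_le_pow _ _)
    rw [div_le_div_iff₀ (by positivity) (by positivity)]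
    calc _ ≤ (Fintype.card ι * h) ^ (N - V) * ((N - V).factorial * (N : ℝ) ^ V) := by gcongr
      _ = _ := by ring
  · rw [Finset.sum_eq_zero]
    · positivity
    · intro k hk
      obtain ⟨hk1, hk2⟩ := Finset.mem_filter.1 hk
      refine absurd ?_ hN
      rw [hV, ← (Finset.mem_piAntidiag.1 hk1).1]
      exact Finset.sum_le_sum fun l _ => hk2 l

/-- A configuration which the scheme does not treat exactly: three points in one interval, or two
points in each of two intervals. -/
def Crowded (k : ι → ℕ) : Prop := (∃ l, 3 ≤ k l) ∨ ∃ l l', l ≠ l' ∧ 2 ≤ k l ∧ 2 ≤ k l'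

-- Each choice of an interval costs `card ι`, absorbed by one `h` into `X = card ι * h`. One triple
-- gives `card ι * h ^ 3` and two pairs give `(card ι) ^ 2 * h ^ 4`; both retain `h ^ 2`.
open scoped Classical in
theorem sum_cellWeight_crowded_le {h : ℝ} (hh : 0 ≤ h) (N : ℕ) :
    ∑ k ∈ (Finset.univ : Finset ι).piAntidiag N with Crowded k, cellWeight h k ≤
      h ^ 2 * (2 * (N : ℝ) ^ 4 * (1 + Fintype.card ι * h) ^ (N + 2) / N.factorial) := by
  set A := (Finset.univ : Finset ι).piAntidiag N
  set X := Fintype.card ι * h with hX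
  have hX0 : 0 ≤ X := by positivity
  have hk3 : ∀ k : ι → ℕ, ∀ l, 3 ≤ k l → Pi.single l 3 ≤ k := fun k l hl i => by
    rcases eq_or_ne i l with rfl | hi
    · simpa using hl
    · simp [hi]
  have hk4 : ∀ k : ι → ℕ, ∀ l l', l ≠ l' → 2 ≤ k l → 2 ≤ k l' →
      Pi.single l 2 + Pi.single l' 2 ≤ k := fun k l l' hll h1 h2 i => by
    rcases eq_or_ne i l with rfl | hi
    · simpa [hll] using h1
    · rcases eq_or_ne i l' with rfl | hi'
      · simpa [hi] using h2
      · simp [hi, hi']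
  have hnn : ∀ k : ι → ℕ, 0 ≤ cellWeight h k := cellWeight_nonneg hh
  have h3 : ∀ l : ι, ∑ k ∈ A with Pi.single l 3 ≤ k, cellWeight h k ≤
      h ^ 3 * (X ^ (N - 3) * (N : ℝ) ^ 3 / N.factorial) := by
    intro l
    simpa using sum_cellWeight_ge_le hh N (Pi.single l 3)
  have h4 : ∀ p : ι × ι, ∑ k ∈ A with Pi.single p.1 2 + Pi.single p.2 2 ≤ k, cellWeight h k ≤
      h ^ 4 * (X ^ (N - 4) * (N : ℝ) ^ 4 / N.factorial) := by
    intro p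
    have hs : ∑ l, (Pi.single p.1 2 + Pi.single p.2 2 : ι → ℕ) l = 4 := by
      simp only [Pi.add_apply, Finset.sum_add_distrib, Finset.sum_pi_single', Finset.mem_univ,
        if_true]
    have := sum_cellWeight_ge_le hh N (Pi.single p.1 2 + Pi.single p.2 2 : ι → ℕ)
    rwa [hs] at this
  have hN : (N : ℝ) ^ 3 ≤ (N : ℝ) ^ 4 := by
    rcases Nat.eq_zero_or_pos N with rfl | h0
    · simp
    · exact_mod_cast Nat.pow_le_pow_right h0 (by norm_num : 3 ≤ 4)
  have hY : ∀ j, j ≤ N + 2 → X ^ j ≤ (1 + X) ^ (N + 2) := fun j hj =>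
    (pow_le_pow_left₀ hX0 (by linarith) j).trans (pow_le_pow_right₀ (by linarith) hj)
  have hY1 := hY (N - 3 + 1) (by omega)
  have hY2 := hY (N - 4 + 2) (by omega)
  calc _ ≤ ∑ k ∈ A, (∑ l : ι, (if Pi.single l 3 ≤ k then cellWeight h k else 0) +
        ∑ p : ι × ι, if Pi.single p.1 2 + Pi.single p.2 2 ≤ k then cellWeight h k else 0) := by
        rw [Finset.sum_filter]
        refine Finset.sum_le_sum fun k _ => ?_
        have n3 : ∀ l ∈ (Finset.univ : Finset ι),
            0 ≤ if Pi.single l 3 ≤ k then cellWeight h k else 0 := fun l _ => by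
          split_ifs
          exacts [hnn k, le_rfl]
        have n4 : ∀ p ∈ (Finset.univ : Finset (ι × ι)),
            0 ≤ if Pi.single p.1 2 + Pi.single p.2 2 ≤ k then cellWeight h k else 0 :=
          fun p _ => by
            split_ifs
            exacts [hnn k, le_rfl]
        split_ifs with hk
        · rcases hk with ⟨l, hl⟩ | ⟨l, l', hll, h1, h2⟩
          · have h0 := Finset.single_le_sum n3 (Finset.mem_univ l)
            rw [if_pos (hk3 k l hl)] at h0
            exact h0.trans (le_add_of_nonneg_right (Finset.sum_nonneg n4))
          · have h0 := Finset.single_le_sum n4 (Finset.mem_univ (l, l'))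
            rw [if_pos (hk4 k l l' hll h1 h2)] at h0
            exact h0.trans (le_add_of_nonneg_left (Finset.sum_nonneg n3))
        · exact add_nonneg (Finset.sum_nonneg n3) (Finset.sum_nonneg n4)
    _ ≤ ∑ l : ι, h ^ 3 * (X ^ (N - 3) * (N : ℝ) ^ 3 / N.factorial) +
        ∑ p : ι × ι, h ^ 4 * (X ^ (N - 4) * (N : ℝ) ^ 4 / N.factorial) := by
        rw [Finset.sum_add_distrib, Finset.sum_comm, Finset.sum_comm (s := A)]
        simp only [← Finset.sum_filter]
        exact add_le_add (Finset.sum_le_sum fun l _ => h3 l) (Finset.sum_le_sum fun p _ => h4 p)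
    _ = h ^ 2 * ((X ^ (N - 3 + 1) * (N : ℝ) ^ 3 + X ^ (N - 4 + 2) * (N : ℝ) ^ 4) /
        N.factorial) := by
        simp only [Finset.sum_const, Finset.card_univ, Fintype.card_prod, nsmul_eq_mul,
          Nat.cast_mul, hX]
        ring
    _ ≤ h ^ 2 * (((1 + X) ^ (N + 2) * (N : ℝ) ^ 4 + (1 + X) ^ (N + 2) * (N : ℝ) ^ 4) /
        N.factorial) := by gcongr
    _ = _ := by ring

end Weights

/-! ### Configurations and time points -/

section Configurations

theorem coe_timeList (h : ℝ) (a : ℕ) (k : Fin a → ℕ) :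
    (timeList h a k : Multiset ℝ) = ∑ i : Fin a, k i • {midR h i} := by
  induction a with
  | zero => simp [timeList]
  | succ a ih =>
    rw [timeList, ← Multiset.coe_add, ih, Fin.sum_univ_castSucc, Multiset.coe_replicate,
      Multiset.nsmul_singleton]
    simp

theorem mem_timeList {h : ℝ} {a : ℕ} {k : Fin a → ℕ} {x : ℝ} (hx : x ∈ timeList h a k) :
    ∃ i < a, x = midR h i := by
  induction a with
  | zero => simp [timeList] at hx
  | succ a ih =>
    rw [timeList, List.mem_append] at hx
    rcases hx with hx | hx
    · obtain ⟨i, hi, rfl⟩ := ih hx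
      exact ⟨i, by omega, rfl⟩
    · exact ⟨a, by omega, List.eq_of_mem_replicate hx⟩

theorem midR_mono {h : ℝ} (hh : 0 < h) : Monotone (midR h) := by
  intro i j hij
  have : (i : ℝ) ≤ j := by exact_mod_cast hij
  unfold midR
  gcongr

theorem pairwise_timeList {h : ℝ} (hh : 0 < h) (a : ℕ) (k : Fin a → ℕ) :
    (timeList h a k).Pairwise (· ≤ ·) := by
  induction a with
  | zero => simp [timeList]
  | succ a ih =>
    rw [timeList, List.pairwise_append]
    refine ⟨ih _, List.pairwise_replicate_of_refl, fun x hx y hy => ?_⟩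
    obtain ⟨i, hi, rfl⟩ := mem_timeList hx
    rw [List.eq_of_mem_replicate hy]
    exact midR_mono hh hi.le

theorem length_timeList (h : ℝ) (a : ℕ) (k : Fin a → ℕ) :
    (timeList h a k).length = ∑ i, k i := by
  induction a with
  | zero => simp [timeList]
  | succ a ih =>
    rw [timeList, List.length_append, ih, Fin.sum_univ_castSucc, List.length_replicate]

theorem coe_append_timeList (h : ℝ) {a c : ℕ} (k : Interval a c → ℕ) :
    (((((timeList h a fun i => k (.inl i)).map Neg.neg).reverse ++
      timeList h c fun i => k (.inr i)) : List ℝ) : Multiset ℝ) = timeMultiset h k := by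
  rw [← Multiset.coe_add, Multiset.coe_reverse, ← Multiset.map_coe, coe_timeList, coe_timeList,
    timeMultiset, Fintype.sum_sum_type, ← Multiset.coe_mapAddMonoidHom, map_sum]
  congr 1
  refine Finset.sum_congr rfl fun i _ => ?_
  rw [Multiset.coe_mapAddMonoidHom, Multiset.map_nsmul, Multiset.map_singleton]
  simp only [mid, midL, midR, neg_mul]

theorem hafM_timeMultiset (B : ℝ → ℝ → ℂ) {h : ℝ} (hh : 0 < h) {a c : ℕ}
    (k : Interval a c → ℕ) :
    hafM B (timeMultiset h k) =
      inflL B (((timeList h a fun i => k (.inl i)).map Neg.neg).reverse ++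
        timeList h c fun i => k (.inr i)) := by
  rw [hafM, sort_eq_of_sorted _ (coe_append_timeList h k)]
  rw [List.pairwise_append, List.pairwise_reverse, List.pairwise_map]
  refine ⟨(pairwise_timeList hh _ _).imp fun hxy => neg_le_neg hxy, pairwise_timeList hh _ _,
    fun x hx y hy => ?_⟩
  obtain ⟨z, hz, rfl⟩ := List.mem_map.1 (List.mem_reverse.1 hx)
  obtain ⟨i, _, rfl⟩ := mem_timeList hz
  obtain ⟨j, _, rfl⟩ := mem_timeList hy
  linarith [midR_pos hh i, midR_pos hh j]

theorem prefactor_eq (z : ℂ) (h : ℝ) {a : ℕ} (k : Fin a → ℕ) :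
    prefactor (z * h) k = z ^ (∑ i, k i) * (cellWeight h k : ℝ) := by
  rw [prefactor, cellWeight, ← Finset.prod_pow_eq_pow_sum, Complex.ofReal_prod,
    ← Finset.prod_mul_distrib]
  refine Finset.prod_congr rfl fun i _ => ?_
  push_cast
  ring

variable {E : Type*} [NormedAddCommGroup E] [InnerProductSpace ℂ E] [CompleteSpace E]

theorem dysonMultiset_eq (H W ρ₀ : E →L[ℂ] E) (B : ℝ → ℝ → ℂ) {h : ℝ} (hh : 0 < h) (t : ℝ)
    {a c : ℕ} (k : Interval a c → ℕ) :
    dysonMultiset H W ρ₀ B t (∑ i, k (.inl i) • {midR h i}) (∑ i, k (.inr i) • {midR h i}) =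
      hafM B (timeMultiset h k) • sandwich H W ρ₀ t t (timeList h a fun i => k (.inl i))
        (timeList h c fun i => k (.inr i)) := by
  rw [dysonMultiset, sort_eq_of_sorted (pairwise_timeList hh _ _) (coe_timeList h a _),
    sort_eq_of_sorted (pairwise_timeList hh _ _) (coe_timeList h c _), hafM_timeMultiset B hh]

/-- The phases of the Dyson term and the cell volumes combine into the prefactors of `chainOp`,
which identifies a midpoint summand with a summand of the scheme carrying its hafnian weight. -/
theorem smul_dysonMultiset_eq (H W ρ₀ : E →L[ℂ] E) (B : ℝ → ℝ → ℂ) {h : ℝ} (hh : 0 < h)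
    {n : ℕ} (k : Interval n n → ℕ) :
    ((-Complex.I) ^ (∑ i, k (.inl i)) * Complex.I ^ (∑ i, k (.inr i))) •
      ((cellWeight h (fun i => k (.inl i)) * cellWeight h fun i => k (.inr i)) •
        dysonMultiset H W ρ₀ B (n * h) (∑ i, k (.inl i) • {midR h i})
          (∑ i, k (.inr i) • {midR h i})) =
      hafM B (timeMultiset h k) • chainOp H W ρ₀ h k := by
  rw [dysonMultiset_eq H W ρ₀ B hh, chainOp, prefactor_eq, prefactor_eq, ← Complex.coe_smul,
    smul_smul, smul_smul, smul_smul]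
  congr 1
  push_cast
  ring

theorem cellWeight_sum {a c : ℕ} (h : ℝ) (k : Interval a c → ℕ) :
    cellWeight h k = cellWeight h (fun i => k (.inl i)) * cellWeight h fun i => k (.inr i) :=
  Fintype.prod_sum_type _

theorem norm_chainOp_le {H : E →L[ℂ] E} (hH : IsSelfAdjoint H) (W ρ₀ : E →L[ℂ] E) {h : ℝ}
    (hh : 0 ≤ h) {a c : ℕ} (k : Interval a c → ℕ) :
    ‖chainOp H W ρ₀ h k‖ ≤ cellWeight h k * (‖ρ₀‖ * ‖W‖ ^ (∑ l, k l)) := by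
  have hw : ∀ {a : ℕ} (k : Fin a → ℕ), ‖((cellWeight h k : ℝ) : ℂ)‖ = cellWeight h k :=
    fun k => by rw [Complex.norm_real, Real.norm_of_nonneg (cellWeight_nonneg hh k)]
  have h1 := norm_sandwich_le hH W ρ₀ (a * h) (c * h) (timeList h a fun i => k (.inl i))
    (timeList h c fun i => k (.inr i))
  rw [length_timeList, length_timeList, ← Fintype.sum_sum_type] at h1
  rw [chainOp, norm_smul, prefactor_eq, prefactor_eq, norm_mul, norm_mul, norm_mul, norm_pow,
    norm_pow, norm_neg, Complex.norm_I, one_pow, one_pow, one_mul, one_mul, hw, hw,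
    cellWeight_sum]
  exact mul_le_mul_of_nonneg_left h1
    (mul_nonneg (cellWeight_nonneg hh _) (cellWeight_nonneg hh _))

theorem card_timeMultiset (h : ℝ) {a c : ℕ} (k : Interval a c → ℕ) :
    (timeMultiset h k).card = ∑ l, k l := by
  simp [timeMultiset]

theorem norm_hafM_le {B : ℝ → ℝ → ℂ} {b : ℝ} (hB : ∀ x y, ‖B x y‖ ≤ b) (M : Multiset ℝ) :
    ‖hafM B M‖ ≤ (1 + b) ^ M.card * √M.card.factorial := by
  refine (norm_influence_le hB (M.sort (· ≤ ·)).get).trans (le_of_eq ?_)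
  rw [Multiset.length_sort]

end Configurations

/-! ### The scheme by numbers of coupling operators -/

section Split

/-- The numbers of points on the left and on the right of a configuration. -/
def bidegree {a c : ℕ} (k : Interval a c → ℕ) : ℕ × ℕ := (∑ i, k (.inl i), ∑ i, k (.inr i))

/-- The configurations with `q.1` points on the left and `q.2` points on the right. -/
def configs (n : ℕ) (q : ℕ × ℕ) : Finset (Interval n n → ℕ) :=
  ((Finset.univ : Finset (Interval n n)).piAntidiag (q.1 + q.2)).filter (bidegree · = q)

theorem mem_configs {n : ℕ} {q : ℕ × ℕ} {k : Interval n n → ℕ} :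
    k ∈ configs n q ↔ bidegree k = q := by
  rw [configs, Finset.mem_filter, and_iff_right_iff_imp]
  rintro rfl
  simp [bidegree]

theorem sum_eq_of_mem_configs {n : ℕ} {q : ℕ × ℕ} {k : Interval n n → ℕ} (hk : k ∈ configs n q) :
    ∑ l, k l = q.1 + q.2 := by
  rw [← mem_configs.1 hk, bidegree, Fintype.sum_sum_type]

theorem sum_configs {M : Type*} [AddCommMonoid M] (n : ℕ) (q : ℕ × ℕ)
    (f : (Interval n n → ℕ) → M) :
    ∑ k ∈ (Finset.univ : Finset (Fin n)).piAntidiag q.1,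
      ∑ k' ∈ (Finset.univ : Finset (Fin n)).piAntidiag q.2, f (Sum.elim k k') =
      ∑ k ∈ configs n q, f k := by
  rw [← Finset.sum_product']
  refine Finset.sum_bij' (fun p _ => Sum.elim p.1 p.2)
    (fun k _ => (fun i => k (.inl i), fun i => k (.inr i))) ?_ ?_ ?_ ?_ ?_
  · intro p hp
    obtain ⟨h1, h2⟩ := Finset.mem_product.1 hp
    rw [mem_configs]
    exact Prod.ext (Finset.mem_piAntidiag.1 h1).1 (Finset.mem_piAntidiag.1 h2).1
  · intro k hk
    rw [mem_configs] at hk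
    exact Finset.mem_product.2
      ⟨Finset.mem_piAntidiag.2 ⟨congrArg Prod.fst hk, fun _ _ => Finset.mem_univ _⟩,
        Finset.mem_piAntidiag.2 ⟨congrArg Prod.snd hk, fun _ _ => Finset.mem_univ _⟩⟩
  · intro p _
    rfl
  · intro k _
    exact Sum.elim_comp_inl_inr k
  · intro p _
    rfl

/-- A function of the marks, extended by zero to all configurations. -/
def extendMarks {ι : Type*} [Fintype ι] (w : (ι → Fin 3) → ℂ) (k : ι → ℕ) : ℂ :=
  if hk : ∀ l, k l < 3 then w fun l => ⟨k l, hk l⟩ else 0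

theorem sum_marks_eq_sum_configs {E : Type*} [AddCommGroup E] [Module ℂ E] (n : ℕ) (q : ℕ × ℕ)
    (w : Marks n n → ℂ) (X : (Interval n n → ℕ) → E) :
    ∑ K : Marks n n with q = bidegree (toNat K), w K • X (toNat K) =
      ∑ k ∈ configs n q, extendMarks w k • X k := by
  refine Finset.sum_of_injOn toNat ?_ ?_ ?_ ?_
  · intro K _ K' _ hKK
    funext l
    exact Fin.ext (congrFun hKK l)
  · intro K hK
    exact mem_configs.2 (Finset.mem_filter.1 hK).2.symm
  · intro k hk hk'
    rw [extendMarks, dif_neg, zero_smul]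
    intro h3
    exact hk' ⟨fun l => ⟨k l, h3 l⟩,
      Finset.mem_filter.2 ⟨Finset.mem_univ _, (mem_configs.1 hk).symm⟩, rfl⟩
  · intro K _
    have h3 : ∀ l, toNat K l < 3 := fun l => (K l).isLt
    rw [extendMarks, dif_pos h3]
    rfl

/-- Regroups the finite scheme sum by bidegree, to be compared termwise with the Dyson series. -/
theorem hasSum_sum_fiber {α β M : Type*} [Fintype α] [DecidableEq β] [AddCommMonoid M]
    [TopologicalSpace M] [ContinuousAdd M] (d : α → β) (f : α → M) :
    HasSum (fun q => ∑ a with q = d a, f a) (∑ a, f a) := by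
  simp only [Finset.sum_filter]
  exact hasSum_sum fun a _ => hasSum_ite_eq (d a) (f a)

/-- After a shift of `N` the factorial part is `(N + 1) ^ 2 * N! ≤ (N + 2)!` under the square root.
-/
theorem growth_recursion {b : ℝ} (hb : 0 ≤ b) (N : ℕ) :
    b * N * ((1 + b) ^ (N - 1) * √(N - 1).factorial) ≤
      (1 + b) ^ (N + 1) * √(N + 1).factorial := by
  rcases N with - | N
  · simp only [Nat.cast_zero, mul_zero, zero_mul]
    positivity
  · rw [Nat.add_sub_cancel]
    have h1 : ((N + 1 : ℕ) : ℝ) * √N.factorial ≤ √(N + 1 + 1).factorial := by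
      refine Real.le_sqrt_of_sq_le ?_
      rw [mul_pow, Real.sq_sqrt (by positivity)]
      have : (N + 1) ^ 2 * N.factorial ≤ (N + 1 + 1).factorial := by
        rw [Nat.factorial_succ, Nat.factorial_succ, ← mul_assoc]
        exact Nat.mul_le_mul_right _ (by nlinarith)
      exact_mod_cast this
    calc _ = b * (1 + b) ^ N * (((N + 1 : ℕ) : ℝ) * √N.factorial) := by ring
      _ ≤ (1 + b) ^ (N + 1 + 1) * √(N + 1 + 1).factorial := by
        gcongr
        rw [pow_succ, pow_succ]
        nlinarith [pow_nonneg (by linarith : 0 ≤ 1 + b) N,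
          mul_nonneg (pow_nonneg (by linarith : 0 ≤ 1 + b) N) hb,
          mul_nonneg (mul_nonneg (pow_nonneg (by linarith : 0 ≤ 1 + b) N) hb) hb]

variable {E : Type*} [NormedAddCommGroup E] [InnerProductSpace ℂ E] [CompleteSpace E]
  {H W : E →L[ℂ] E} {B : ℝ → ℝ → ℂ} {b : ℝ}

/-- The two weights agree off the crowded configurations, and on those each is at most `G`; hence
the factor `2`. -/
theorem exists_hasSum_rhoTilde (ρ₀ : E →L[ℂ] E) (hH : IsSelfAdjoint H) (hW : IsSelfAdjoint W)
    {h : ℝ} (hh : 0 < h) (hB : ∀ x y, ‖B x y‖ ≤ b) (n : ℕ) :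
    ∃ r : ℕ × ℕ → (E →L[ℂ] E), HasSum r (rhoTilde H W ρ₀ B h n) ∧
      ∀ q, ‖∑ k ∈ configs n q, hafM B (timeMultiset h k) • chainOp H W ρ₀ h k - r q‖ ≤
        2 * ((1 + b) ^ (q.1 + q.2) * √(q.1 + q.2).factorial * (‖ρ₀‖ * ‖W‖ ^ (q.1 + q.2))) *
          (h ^ 2 * (2 * (q.1 + q.2 : ℕ) ^ 4 * (1 + 2 * (n * h)) ^ (q.1 + q.2 + 2) /
            (q.1 + q.2).factorial)) := by
  classical
  have hb : 0 ≤ b := (norm_nonneg _).trans (hB 0 0)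
  obtain ⟨w, hw, hw1, hw2⟩ := exists_rhoTilde_eq (g := fun N => (1 + b) ^ N * √N.factorial) ρ₀ hH
    hW hh hB (fun N => by positivity) (by simp) (growth_recursion hb) n
  refine ⟨fun q => ∑ k ∈ configs n q, extendMarks w k • chainOp H W ρ₀ h k, ?_, fun q => ?_⟩
  · rw [hw]
    have := hasSum_sum_fiber (fun K : Marks n n => bidegree (toNat K))
      fun K => w K • chainOp H W ρ₀ h (toNat K)
    simpa only [sum_marks_eq_sum_configs n _ w] using this
  set N := q.1 + q.2 with hN
  set G := (1 + b) ^ N * √N.factorial with hG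
  have hG0 : 0 ≤ G := by positivity
  have e1 : ∀ k ∈ configs n q, ‖hafM B (timeMultiset h k)‖ ≤ G := fun k hk => by
    have := norm_hafM_le hB (timeMultiset h k)
    rwa [card_timeMultiset, sum_eq_of_mem_configs hk] at this
  have e2 : ∀ k ∈ configs n q, ‖extendMarks w k‖ ≤ G := fun k hk => by
    rw [extendMarks]
    split_ifs with h3
    · have := hw1 fun l => ⟨k l, h3 l⟩
      rwa [show (∑ l, toNat (fun l => (⟨k l, h3 l⟩ : Fin 3)) l) = N from
        sum_eq_of_mem_configs hk] at this
    · simpa using hG0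
  have e3 : ∀ k : Interval n n → ℕ, ¬ Crowded k →
      extendMarks w k = hafM B (timeMultiset h k) := fun k hk => by
    rw [Crowded, not_or] at hk
    push Not at hk
    rw [extendMarks, dif_pos fun l => hk.1 l, hw2]
    · rfl
    · intro l l' hl hl'
      by_contra hll
      have h1 : k l = 2 := congrArg Fin.val hl
      have h2 : k l' = 2 := congrArg Fin.val hl'
      exact absurd (hk.2 l l' hll h1.ge) (by omega)
  have e4 : ∀ k ∈ configs n q,
      ‖hafM B (timeMultiset h k) • chainOp H W ρ₀ h k - extendMarks w k • chainOp H W ρ₀ h k‖ ≤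
        if Crowded k then 2 * (G * (‖ρ₀‖ * ‖W‖ ^ N)) * cellWeight h k else 0 := by
    intro k hk
    split_ifs with hc
    · rw [← sub_smul, norm_smul]
      have h1 := norm_chainOp_le hH W ρ₀ hh.le k
      rw [sum_eq_of_mem_configs hk] at h1
      calc _ ≤ (G + G) * (cellWeight h k * (‖ρ₀‖ * ‖W‖ ^ N)) :=
            mul_le_mul ((norm_sub_le _ _).trans (add_le_add (e1 k hk) (e2 k hk))) h1
              (norm_nonneg _) (by positivity)
        _ = _ := by ring
    · rw [e3 k hc, sub_self, norm_zero]
  have hcard : ((Fintype.card (Interval n n) : ℕ) : ℝ) * h = 2 * (n * h) := by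
    simp only [Fintype.card_sum, Fintype.card_fin]
    push_cast
    ring
  rw [← Finset.sum_sub_distrib]
  calc _ ≤ ∑ k ∈ configs n q,
        if Crowded k then 2 * (G * (‖ρ₀‖ * ‖W‖ ^ N)) * cellWeight h k else 0 :=
        norm_sum_le_of_le _ e4
    _ ≤ ∑ k ∈ (Finset.univ : Finset (Interval n n)).piAntidiag N,
        if Crowded k then 2 * (G * (‖ρ₀‖ * ‖W‖ ^ N)) * cellWeight h k else 0 := by
        refine Finset.sum_le_sum_of_subset_of_nonneg (Finset.filter_subset _ _) fun k _ _ => ?_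
        split_ifs
        · exact mul_nonneg (by positivity) (cellWeight_nonneg hh.le k)
        · exact le_rfl
    _ = 2 * (G * (‖ρ₀‖ * ‖W‖ ^ N)) *
        ∑ k ∈ (Finset.univ : Finset (Interval n n)).piAntidiag N with Crowded k,
          cellWeight h k := by
        rw [← Finset.sum_filter, Finset.mul_sum]
    _ ≤ _ := by
        have := sum_cellWeight_crowded_le (ι := Interval n n) hh.le N
        rw [hcard] at this
        exact mul_le_mul_of_nonneg_left this (by positivity)

end Split

/-! ### Summation of the error terms -/

section ErrorBound

/-- The term is `2⁻ᵐ` times `(2R) ^ m / √m!`; the inequality `x y ≤ x ^ 2 + y ^ 2` bounds it by a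
geometric and an exponential term. -/
theorem summable_pow_div_sqrt_factorial {R : ℝ} (hR : 0 ≤ R) :
    Summable fun m : ℕ => R ^ m / √m.factorial := by
  have h1 : Summable fun m : ℕ => (1 / 4 : ℝ) ^ m + (4 * R ^ 2) ^ m / m.factorial :=
    (summable_geometric_of_lt_one (by norm_num) (by norm_num)).add
      (Real.summable_pow_div_factorial _)
  refine Summable.of_nonneg_of_le (fun m => by positivity) (fun m => ?_) h1
  have h2 : ((2 * R) ^ m / √m.factorial) ^ 2 = (4 * R ^ 2) ^ m / m.factorial := by
    rw [div_pow, Real.sq_sqrt (by positivity), ← pow_mul, mul_comm m 2, pow_mul, mul_pow]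
    norm_num
  have h3 : ((1 / 2 : ℝ) ^ m) ^ 2 = (1 / 4) ^ m := by
    rw [← pow_mul, mul_comm m 2, pow_mul]
    norm_num
  have h4 : R ^ m / √m.factorial = (1 / 2 : ℝ) ^ m * ((2 * R) ^ m / √m.factorial) := by
    rw [← mul_div_assoc, ← mul_pow]
    ring_nf
  have h5 : 0 ≤ R ^ m / √m.factorial := by positivity
  rw [← h2, ← h3, h4]
  rw [h4] at h5
  nlinarith [sq_nonneg ((1 / 2 : ℝ) ^ m - (2 * R) ^ m / √m.factorial)]

theorem summable_prod_pow_div_sqrt_factorial {R : ℝ} (hR : 0 ≤ R) :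
    Summable fun q : ℕ × ℕ => R ^ q.1 / √q.1.factorial * (R ^ q.2 / √q.2.factorial) :=
  (summable_pow_div_sqrt_factorial hR).mul_of_nonneg (summable_pow_div_sqrt_factorial hR)
    (fun m => by positivity) (fun m => by positivity)

theorem sqrt_factorial_add_le (m m' : ℕ) :
    √(m + m').factorial ≤ 2 ^ (m + m') * (√m.factorial * √m'.factorial) := by
  rw [← Real.sqrt_mul (by positivity)]
  refine Real.sqrt_le_iff.2 ⟨by positivity, ?_⟩
  rw [mul_pow, Real.sq_sqrt (by positivity)]
  have h1 : (m + m').factorial ≤ 2 ^ (m + m') * (m.factorial * m'.factorial) := by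
    rw [← Nat.add_choose_mul_factorial_mul_factorial, mul_assoc]
    exact Nat.mul_le_mul_right _ (Nat.choose_le_two_pow _ _)
  have h2 : ((m + m').factorial : ℝ) ≤ 2 ^ (m + m') * (m.factorial * m'.factorial) := by
    exact_mod_cast h1
  refine h2.trans (mul_le_mul_of_nonneg_right ?_ (by positivity))
  exact le_self_pow₀ (one_le_pow₀ (by norm_num)) (by norm_num)

/-- The base `1 + 2 * T` is shared with the crowded term, where `2 * T` is the total length of the
intervals on both sides. -/
theorem nat_mul_pow_pred_div_le {T : ℝ} (hT : 0 ≤ T) (m : ℕ) :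
    m * (T ^ (m - 1) / (m - 1).factorial) ≤ (m : ℝ) ^ 2 * ((1 + 2 * T) ^ m / m.factorial) := by
  rcases m with - | m
  · simp
  · rw [Nat.add_sub_cancel, Nat.factorial_succ, Nat.cast_mul, sq, mul_assoc]
    have h1 : T ^ m ≤ (1 + 2 * T) ^ (m + 1) :=
      (pow_le_pow_left₀ hT (by linarith) m).trans
        (pow_le_pow_right₀ (by linarith) (Nat.le_succ m))
    have h2 : ((m + 1 : ℕ) : ℝ) * ((1 + 2 * T) ^ (m + 1) / (((m + 1 : ℕ) : ℝ) * m.factorial)) =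
        (1 + 2 * T) ^ (m + 1) / m.factorial := by
      field_simp
    rw [h2]
    gcongr

theorem pow_div_factorial_le {T : ℝ} (hT : 0 ≤ T) (m : ℕ) :
    T ^ m / m.factorial ≤ (1 + 2 * T) ^ m / m.factorial := by
  gcongr
  linarith

/-- The constant of the error estimate. -/
def errorConst (η ρ b' b'' T : ℝ) : ℝ :=
  4 * ((1 + b' + b'' + 2 * η) ^ 2 * T + (1 + b' + b'' + 2 * η) + (1 + 2 * T) ^ 2) * ρ

/-- The growth rate of the error terms. -/
def errorRate (ω b T : ℝ) : ℝ := 32 * (1 + b) * ω * (1 + 2 * T)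

/-- Powers of `N = m + m'` are absorbed by `N ^ 4 ≤ 16 ^ N`, and `√N! ≤ 2 ^ N * √m! * √m'!`;
together they give the `32` in `errorRate`. The roots cancel half of `1 / (m! * m'!)`. -/
theorem errorTerm_le {η ρ ω b b' b'' T h : ℝ} (hη : 0 ≤ η) (hρ : 0 ≤ ρ) (hω : 0 ≤ ω)
    (hb : 0 ≤ b) (hb' : 0 ≤ b') (hb'' : 0 ≤ b'') (hT : 0 ≤ T) (m m' : ℕ) {K L : ℝ}
    (hK : K = (1 + b) ^ (m + m') * √(m + m').factorial * (ρ * ω ^ (m + m')))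
    (hL : L = (m + m' : ℕ) * (1 + b' + b'' + 2 * η)) :
    m * (2 * (K * L ^ 2 * T + K * L) * h ^ 2 * (T ^ (m - 1) / (m - 1).factorial)) *
        (T ^ m' / m'.factorial) +
      m' * (2 * (K * L ^ 2 * T + K * L) * h ^ 2 * (T ^ (m' - 1) / (m' - 1).factorial)) *
        (T ^ m / m.factorial) +
      2 * K * (h ^ 2 * (2 * (m + m' : ℕ) ^ 4 * (1 + 2 * T) ^ (m + m' + 2) /
        (m + m').factorial)) ≤
    errorConst η ρ b' b'' T * (errorRate ω b T ^ m / √m.factorial *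
      (errorRate ω b T ^ m' / √m'.factorial)) * h ^ 2 := by
  set Y := 1 + 2 * T with hY
  set l := 1 + b' + b'' + 2 * η with hl
  set N := m + m' with hN
  have hY1 : 1 ≤ Y := by linarith
  have hl0 : 0 ≤ l := by positivity
  have hK0 : 0 ≤ K := by rw [hK]; positivity
  have hL0 : 0 ≤ L := by rw [hL]; positivity
  set Q := Y ^ N / (m.factorial * m'.factorial) with hQ
  have hQ0 : 0 ≤ Q := by positivity
  set S := 2 * (K * L ^ 2 * T + K * L) * h ^ 2 with hS
  have hS0 : 0 ≤ S := by positivity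
  have hmN : (m : ℝ) ^ 2 ≤ (N : ℝ) ^ 2 := by
    have : (m : ℝ) ≤ N := by exact_mod_cast Nat.le_add_right _ _
    gcongr
  have hmN' : (m' : ℝ) ^ 2 ≤ (N : ℝ) ^ 2 := by
    have : (m' : ℝ) ≤ N := by exact_mod_cast Nat.le_add_left _ _
    gcongr
  have hQ1 : Y ^ m / m.factorial * (Y ^ m' / m'.factorial) = Q := by
    rw [hQ, hN, pow_add, div_mul_div_comm]
  have t1 : m * (S * (T ^ (m - 1) / (m - 1).factorial)) * (T ^ m' / m'.factorial) ≤
      S * ((N : ℝ) ^ 2 * Q) := by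
    calc _ = S * ((m * (T ^ (m - 1) / (m - 1).factorial)) * (T ^ m' / m'.factorial)) := by ring
      _ ≤ S * (((m : ℝ) ^ 2 * (Y ^ m / m.factorial)) * (Y ^ m' / m'.factorial)) := by
        gcongr S * ?_
        exact mul_le_mul (nat_mul_pow_pred_div_le hT m) (pow_div_factorial_le hT m')
          (by positivity) (by positivity)
      _ = S * ((m : ℝ) ^ 2 * Q) := by rw [← hQ1]; ring
      _ ≤ _ := by gcongr
  have t2 : m' * (S * (T ^ (m' - 1) / (m' - 1).factorial)) * (T ^ m / m.factorial) ≤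
      S * ((N : ℝ) ^ 2 * Q) := by
    calc _ = S * ((m' * (T ^ (m' - 1) / (m' - 1).factorial)) * (T ^ m / m.factorial)) := by ring
      _ ≤ S * (((m' : ℝ) ^ 2 * (Y ^ m' / m'.factorial)) * (Y ^ m / m.factorial)) := by
        gcongr S * ?_
        exact mul_le_mul (nat_mul_pow_pred_div_le hT m') (pow_div_factorial_le hT m)
          (by positivity) (by positivity)
      _ = S * ((m' : ℝ) ^ 2 * Q) := by rw [← hQ1]; ring
      _ ≤ _ := by gcongr
  have t3 : Y ^ (N + 2) / N.factorial ≤ Y ^ 2 * Q := by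
    rw [hQ, pow_add, mul_comm (Y ^ N), mul_div_assoc]
    have : ((m.factorial * m'.factorial : ℕ) : ℝ) ≤ N.factorial := by
      exact_mod_cast Nat.le_of_dvd (Nat.factorial_pos _)
        (Nat.factorial_mul_factorial_dvd_factorial_add m m')
    push_cast at this
    gcongr
  have hN3 : (N : ℝ) ^ 3 ≤ (N : ℝ) ^ 4 := by
    rcases Nat.eq_zero_or_pos N with h0 | h0
    · rw [h0]; simp
    · exact_mod_cast Nat.pow_le_pow_right h0 (by norm_num : 3 ≤ 4)
  have t4 : S * (N : ℝ) ^ 2 ≤ 2 * K * (l ^ 2 * T + l) * (N : ℝ) ^ 4 * h ^ 2 := by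
    calc S * (N : ℝ) ^ 2 = 2 * K * (l ^ 2 * T * (N : ℝ) ^ 4 + l * (N : ℝ) ^ 3) * h ^ 2 := by
          rw [hS, hL]; ring
      _ ≤ 2 * K * (l ^ 2 * T * (N : ℝ) ^ 4 + l * (N : ℝ) ^ 4) * h ^ 2 := by gcongr
      _ = _ := by ring
  have hN16 : (N : ℝ) ^ 4 ≤ 16 ^ N := by
    have h1 : (N : ℝ) ≤ 2 ^ N := by exact_mod_cast N.lt_two_pow_self.le
    calc (N : ℝ) ^ 4 ≤ (2 ^ N) ^ 4 := by gcongr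
      _ = 16 ^ N := by rw [← pow_mul, mul_comm, pow_mul]; norm_num
  have t5 : K * (N : ℝ) ^ 4 * Q ≤ ρ * (errorRate ω b T ^ m / √m.factorial *
      (errorRate ω b T ^ m' / √m'.factorial)) := by
    calc K * (N : ℝ) ^ 4 * Q ≤ (1 + b) ^ N * (2 ^ N * (√m.factorial * √m'.factorial)) *
          (ρ * ω ^ N) * 16 ^ N * Q := by
          rw [hK]
          gcongr
          exact sqrt_factorial_add_le m m'
      _ = ρ * (((32 : ℝ) ^ N * (1 + b) ^ N * ω ^ N * Y ^ N) / (√m.factorial * √m'.factorial)) := by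
          have h32 : (32 : ℝ) ^ N = 2 ^ N * 16 ^ N := by rw [← mul_pow]; norm_num
          rw [hQ, h32]
          field_simp
          rw [Real.sq_sqrt (by positivity), Real.sq_sqrt (by positivity)]
          ring
      _ = _ := by
          rw [div_mul_div_comm, ← pow_add, errorRate, mul_pow, mul_pow, mul_pow]
  calc _ ≤ S * ((N : ℝ) ^ 2 * Q) + S * ((N : ℝ) ^ 2 * Q) +
        2 * K * (h ^ 2 * (2 * (N : ℝ) ^ 4 * (Y ^ 2 * Q))) := by
        refine add_le_add (add_le_add t1 t2) ?_
        rw [mul_div_assoc]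
        gcongr
    _ = 2 * (S * (N : ℝ) ^ 2) * Q + 4 * (Y ^ 2) * (K * (N : ℝ) ^ 4 * Q) * h ^ 2 := by ring
    _ ≤ 2 * (2 * K * (l ^ 2 * T + l) * (N : ℝ) ^ 4 * h ^ 2) * Q +
        4 * (Y ^ 2) * (K * (N : ℝ) ^ 4 * Q) * h ^ 2 := by gcongr
    _ = 4 * (l ^ 2 * T + l + Y ^ 2) * (K * (N : ℝ) ^ 4 * Q) * h ^ 2 := by ring
    _ ≤ 4 * (l ^ 2 * T + l + Y ^ 2) * (ρ * (errorRate ω b T ^ m / √m.factorial *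
      (errorRate ω b T ^ m' / √m'.factorial))) * h ^ 2 := by gcongr
    _ = _ := by rw [errorConst]; ring

variable {E : Type*} [NormedAddCommGroup E] [InnerProductSpace ℂ E] [CompleteSpace E]
  {H W : E →L[ℂ] E} {B : ℝ → ℝ → ℂ} {b b' b'' : ℝ}

theorem integrableOn_dysonIntegrand (hH : IsSelfAdjoint H) (W ρ₀ : E →L[ℂ] E)
    (hB : BathBounds B b b' b'') (t : ℝ) (m m' : ℕ) :
    IntegrableOn (dysonIntegrand H W ρ₀ B t m m') (simplex m t ×ˢ simplex m' t) := by
  have h1 : dysonIntegrand H W ρ₀ B t m m' = fun p => dysonFun H W ρ₀ B t p.1 p.2 :=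
    funext fun p => dysonIntegrand_eq H W ρ₀ B t m m' p
  rw [h1]
  exact integrableOn_dysonFun hH W ρ₀ hB t t m m'

theorem dysonTerm_eq (H W ρ₀ : E →L[ℂ] E) (B : ℝ → ℝ → ℂ) (t : ℝ) (q : ℕ × ℕ) :
    dysonTerm H W ρ₀ B t q = ((-Complex.I) ^ q.1 * Complex.I ^ q.2) •
      ∫ p in simplex q.1 t ×ˢ simplex q.2 t, dysonFun H W ρ₀ B t p.1 p.2 := by
  simp only [dysonTerm, dysonIntegrand_eq, dysonFun]

theorem smul_setIntegral_dysonFun_gridMid (hH : IsSelfAdjoint H) (W ρ₀ : E →L[ℂ] E)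
    (hB : BathBounds B b b' b'') {h : ℝ} (hh : 0 < h) (n : ℕ) (q : ℕ × ℕ) :
    ((-Complex.I) ^ q.1 * Complex.I ^ q.2) •
      ∫ p in simplex q.1 (n * h) ×ˢ simplex q.2 (n * h),
        dysonFun H W ρ₀ B (n * h) (fun i => gridMid h (p.1 i)) (fun i => gridMid h (p.2 i)) =
    ∑ k ∈ configs n q, hafM B (timeMultiset h k) • chainOp H W ρ₀ h k := by
  rw [setIntegral_dysonFun_gridMid hH W ρ₀ hB hh, Finset.smul_sum, ← sum_configs]
  refine Finset.sum_congr rfl fun k hk => ?_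
  rw [Finset.smul_sum]
  refine Finset.sum_congr rfl fun k' hk' => ?_
  rw [← smul_dysonMultiset_eq H W ρ₀ B hh]
  simp only [Sum.elim_inl, Sum.elim_inr, (Finset.mem_piAntidiag.1 hk).1,
    (Finset.mem_piAntidiag.1 hk').1, cellWeight]

/-- The midpoint sum of each Dyson term is the intermediate quantity in the triangle inequality. -/
theorem exists_hasSum_error_le (hH : IsSelfAdjoint H) (hW : IsSelfAdjoint W) (ρ₀ : E →L[ℂ] E)
    (hB : BathBounds B b b' b'') {h : ℝ} (hh : 0 < h) (n : ℕ) :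
    ∃ r : ℕ × ℕ → (E →L[ℂ] E), HasSum r (rhoTilde H W ρ₀ B h n) ∧
      ∀ q, ‖r q - dysonTerm H W ρ₀ B (n * h) q‖ ≤
        errorConst ‖H‖ ‖ρ₀‖ b' b'' (n * h) *
          (errorRate ‖W‖ b (n * h) ^ q.1 / √q.1.factorial *
            (errorRate ‖W‖ b (n * h) ^ q.2 / √q.2.factorial)) * h ^ 2 := by
  obtain ⟨hb, hb', hb''⟩ := hB.nonneg
  have hT : 0 ≤ n * h := by positivity
  obtain ⟨r, hr, hrq⟩ := exists_hasSum_rhoTilde ρ₀ hH hW hh hB.bound n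
  refine ⟨r, hr, fun q => ?_⟩
  have hu : ∀ x : E →L[ℂ] E, ‖((-Complex.I) ^ q.1 * Complex.I ^ q.2) • x‖ = ‖x‖ := fun x => by
    rw [norm_smul, norm_mul, norm_pow, norm_pow, norm_neg, Complex.norm_I, one_pow, one_pow,
      one_mul, one_mul]
  have h1 := norm_setIntegral_dysonFun_sub_le hH W ρ₀ hB hh hT (n * h) q.1 q.2 rfl rfl
  rw [← hu, smul_sub, ← dysonTerm_eq, smul_setIntegral_dysonFun_gridMid hH W ρ₀ hB hh] at h1
  rw [norm_sub_rev]
  exact (norm_sub_le_norm_sub_add_norm_sub _ _ _).trans ((add_le_add h1 (hrq q)).trans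
    (errorTerm_le (norm_nonneg H) (norm_nonneg ρ₀) (norm_nonneg W) hb hb' hb'' hT q.1 q.2 rfl rfl))

end ErrorBound

end

end FRODS

/-! ### The error estimate -/

theorem mainTheorem1 :
    ∃ C : ℝ → ℝ → ℝ → ℝ → ℝ → ℝ → ℝ → ℝ,
      ∀ (E : Type*) [NormedAddCommGroup E] [InnerProductSpace ℂ E] [CompleteSpace E]
        (H W ρ₀ : E →L[ℂ] E) (B : ℝ → ℝ → ℂ) (b b' b'' : ℝ),
        IsSelfAdjoint H → IsSelfAdjoint W → FRODS.BathBounds B b b' b'' →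
        ∀ (n : ℕ) (Δt : ℝ), 0 < Δt →
          (∀ m m' : ℕ, MeasureTheory.IntegrableOn
            (FRODS.dysonIntegrand H W ρ₀ B (n * Δt) m m')
            (FRODS.simplex m (n * Δt) ×ˢ FRODS.simplex m' (n * Δt))) ∧
          Summable (FRODS.dysonTerm H W ρ₀ B (n * Δt)) ∧
          ‖FRODS.rhoTilde H W ρ₀ B Δt n - FRODS.rhoExact H W ρ₀ B (n * Δt)‖ ≤
            C ‖H‖ ‖ρ₀‖ ‖W‖ b b' b'' (n * Δt) * Δt ^ 2 := by
  refine ⟨fun η ρ ω b b' b'' T => FRODS.errorConst η ρ b' b'' T *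
    ∑' q : ℕ × ℕ, FRODS.errorRate ω b T ^ q.1 / √q.1.factorial *
      (FRODS.errorRate ω b T ^ q.2 / √q.2.factorial), ?_⟩
  intro E _ _ _ H W ρ₀ B b b' b'' hH hW hB n Δt hΔ
  refine ⟨fun m m' => FRODS.integrableOn_dysonIntegrand hH W ρ₀ hB _ m m', ?_⟩
  obtain ⟨r, hr, hrq⟩ := FRODS.exists_hasSum_error_le hH hW ρ₀ hB hΔ n
  have hb := hB.nonneg.1
  have hR : 0 ≤ FRODS.errorRate ‖W‖ b (n * Δt) := by
    unfold FRODS.errorRate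
    positivity
  have hsum := ((FRODS.summable_prod_pow_div_sqrt_factorial hR).hasSum.mul_left
    (FRODS.errorConst ‖H‖ ‖ρ₀‖ b' b'' (n * Δt))).mul_right (Δt ^ 2)
  have hdiff : Summable fun q => r q - FRODS.dysonTerm H W ρ₀ B (n * Δt) q :=
    Summable.of_norm_bounded hsum.summable hrq
  -- `r` regroups a finite sum, so summability of the differences passes to the Dyson series without
  -- a separate bound on its terms.
  have hdyson : Summable (FRODS.dysonTerm H W ρ₀ B (n * Δt)) := by
    simpa using hr.summable.sub hdiff
  refine ⟨hdyson, ?_⟩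
  rw [FRODS.rhoExact, ← hr.tsum_eq, ← hr.summable.tsum_sub hdyson]
  exact tsum_of_norm_bounded hsum hrq
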